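/- Let $\mathbb K$ be an algebraically closed field, $n>2$ an integer and $q\in\mathbb K$ a primitive $n$-th root of unity. Let $H_n(1,q)$ be the Hopf algebra over $\mathbb K$ generated as an algebra by $a,b,c,d$ with relations $$ba=qab,\quad db=qbd,\quad ca=qac,\quad dc=qcd,\quad bc=cb,\quad a^n=d^n=0,\quad b^n=c^n=1,\quad da-qad=1-bc,$$ with comultiplication $\Delta(a)=a\otimes b+1\otimes a$, $\Delta(b)=b\otimes b$, $\Delta(c)=c\otimes c$, $\Delta(d)=d\otimes c+1\otimes d$, counit $\varepsilon(a)=\varepsilon(d)=0$, $\varepsilon(b)=\varepsilon(c)=1$, and antipode $S(a)=-ab^{n-1}$, $S(b)=b^{n-1}$, $S(c)=c^{n-1}$, $S(d)=-dc^{n-1}$. For a Hopf algebra $H$ the Green ring $r(H)$ is the abelian group generated by the isomorphism classes $[M]$ of finite dimensional left $H$-modules modulo the relations $[M\oplus N]=[M]+[N]$, with multiplication $[M][N]=[M\otimes N]$; the projective class ring $r_p(H)$ is the subring of $r(H)$ generated by the classes of the (finite dimensional) projective modules and of the simple modules. For $1\le l\le n$ and $r\in\mathbb Z/n\mathbb Z$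 let $V(l,r)$ be the simple $H_n(1,q)$-module with basis $v_1,\dots,v_l$ and action $av_i=v_{i+1}$ (where $v_{l+1}=0$), $bv_i=q^{r+i-1}v_i$, $cv_i=q^{i-r-l}v_i$, $dv_1=0$ and $dv_i=(1+q+\dots+q^{i-2})(1-q^{i-1-l})\,v_{i-1}$ for $2\le i\le l$. Let $I$ be the ideal of $\mathbb Z[x,y]$ generated by $x^n-1$ and $$\Bigl(\sum_{i=0}^{\lfloor n/2\rfloor}(-1)^i\tfrac{n}{n-i}\tbinom{n-i}{i}x^iy^{n-2i}-2\Bigr)\Bigl(\sum_{i=0}^{\lfloor (n-1)/2\rfloor}(-1)^i\tbinom{n-1-i}{i}x^iy^{n-1-2i}\Bigr).$$ Then there is a ring isomorphism $\mathbb Z[x,y]/I\to r_p(H_n(1,q))$ that sends the class of $x$ to $[V(1,1)]$ and the class of $y$ to $[V(2,0)]$. In particular, the elements $[V(1,1)]^l[V(2,0)]^m$ with $0\le l\le n-1$ and $0\le m\le 2n-2$ form a $\mathbb Z$-basis of $r_p(H_n(1,q))$. -/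

import Mathlib

open scoped TensorProduct

universe u v

noncomputable section

namespace Green

/-! ### Finite dimensional modules over a bialgebra -/

/-- A finite dimensional left module over the `K`-algebra `H`: a finite dimensional `K`-space
with an algebra map `ρ` to its endomorphism algebra. -/
structure FDMod (K : Type u) (H : Type v) [Field K] [Ring H] [Algebra K H] where
  carrier : Type u
  [addCommGroup : AddCommGroup carrier]
  [module : Module K carrier]
  [finite : Module.Finite K carrier]
  ρ : H →ₐ[K] Module.End K carrier

attribute [instance] FDMod.addCommGroup FDMod.module FDMod.finite

namespace FDMod

variable {K : Type u} {H : Type v} [Field K] [Ring H]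

/-- The `H`-module structure on the carrier. -/
instance instModule [Algebra K H] (M : FDMod K H) : Module H M.carrier :=
  Module.compHom M.carrier M.ρ.toRingHom

/-- Isomorphism of `H`-modules. -/
def Iso [Algebra K H] (M N : FDMod K H) : Prop :=
  ∃ e : M.carrier ≃ₗ[K] N.carrier, ∀ (h : H) (m : M.carrier), e (M.ρ h m) = N.ρ h (e m)

theorem Iso.refl [Algebra K H] (M : FDMod K H) : Iso M M :=
  ⟨LinearEquiv.refl K _, fun _ _ => rfl⟩

theorem Iso.symm [Algebra K H] {M N : FDMod K H} : Iso M N → Iso N M := by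
  rintro ⟨e, he⟩
  refine ⟨e.symm, fun h m => ?_⟩
  rw [LinearEquiv.symm_apply_eq, he, LinearEquiv.apply_symm_apply]

theorem Iso.trans [Algebra K H] {M N P : FDMod K H} : Iso M N → Iso N P → Iso M P := by
  rintro ⟨e, he⟩ ⟨f, hf⟩
  exact ⟨e.trans f, fun h m => by simp [he, hf]⟩

instance setoid (K : Type u) (H : Type v) [Field K] [Ring H] [Algebra K H] :
    Setoid (FDMod K H) where
  r := Iso
  iseqv := ⟨Iso.refl, Iso.symm, Iso.trans⟩

/-- The zero module. -/
def zero (K : Type u) (H : Type v) [Field K] [Ring H] [Algebra K H] : FDMod K H where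
  carrier := PUnit.{u + 1}
  ρ :=
    { toFun := fun _ => 0
      map_one' := Subsingleton.elim _ _
      map_mul' := fun _ _ => Subsingleton.elim _ _
      map_zero' := rfl
      map_add' := fun _ _ => Subsingleton.elim _ _
      commutes' := fun _ => Subsingleton.elim _ _ }

/-- The direct sum `M ⊕ N`. -/
def sum [Algebra K H] (M N : FDMod K H) : FDMod K H where
  carrier := M.carrier × N.carrier
  ρ := (LinearMap.prodMapAlgHom K M.carrier N.carrier).comp (M.ρ.prod N.ρ)

theorem sum_ρ [Algebra K H] (M N : FDMod K H) (h : H) (m : M.carrier) (n : N.carrier) :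
    (sum M N).ρ h (m, n) = (M.ρ h m, N.ρ h n) := rfl

/-- The trivial module: `K` with `h · k = ε(h) k`. -/
def unit (K : Type u) (H : Type v) [Field K] [Ring H] [Bialgebra K H] : FDMod K H where
  carrier := K
  ρ := (Algebra.ofId K (Module.End K K)).comp (Bialgebra.counitAlgHom K H)

section tensor

variable {A B C V W U : Type*} [Ring A] [Ring B] [Ring C]
  [AddCommGroup V] [Module K V] [AddCommGroup W] [Module K W] [AddCommGroup U] [Module K U]

/-- If `A` acts on `V` and `B` acts on `W`, then `A ⊗ B` acts on `V ⊗ W`. -/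
def act₂ [Algebra K A] [Algebra K B] (ρ : A →ₐ[K] Module.End K V) (σ : B →ₐ[K] Module.End K W) :
    A ⊗[K] B →ₐ[K] Module.End K (V ⊗[K] W) :=
  (Module.endTensorEndAlgHom (R := K) (S := K) (A := K)).comp (Algebra.TensorProduct.map ρ σ)

@[simp] theorem act₂_tmul [Algebra K A] [Algebra K B] (ρ : A →ₐ[K] Module.End K V)
    (σ : B →ₐ[K] Module.End K W) (x : A) (y : B) (m : V) (n : W) :
    act₂ ρ σ (x ⊗ₜ y) (m ⊗ₜ n) = ρ x m ⊗ₜ σ y n := by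
  simp [act₂, Module.endTensorEndAlgHom_apply]

/-- Two elements of the endomorphism algebras that intertwine on pure tensors intertwine. -/
theorem act₂_intertwine [Algebra K A] [Algebra K B] (ρ : A →ₐ[K] Module.End K V)
    (σ : B →ₐ[K] Module.End K W) (e : V ⊗[K] W →ₗ[K] U) (τ : A ⊗[K] B →ₗ[K] Module.End K U)
    (h : ∀ x y m n, e (ρ x m ⊗ₜ σ y n) = τ (x ⊗ₜ y) (e (m ⊗ₜ n)))
    (t : A ⊗[K] B) (z : V ⊗[K] W) : e (act₂ ρ σ t z) = τ t (e z) := by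
  induction t using TensorProduct.induction_on with
  | zero => simp
  | add x y hx hy => simp only [map_add, LinearMap.add_apply, hx, hy]
  | tmul x y =>
    induction z using TensorProduct.induction_on with
    | zero => simp
    | add x y hx hy => simp only [map_add, hx, hy]
    | tmul m n => rw [act₂_tmul, h]

theorem act₂_assoc [Algebra K A] [Algebra K B] [Algebra K C] (ρ : A →ₐ[K] Module.End K V)
    (σ : B →ₐ[K] Module.End K W) (τ : C →ₐ[K] Module.End K U)
    (t : (A ⊗[K] B) ⊗[K] C) (z : (V ⊗[K] W) ⊗[K] U) :
    TensorProduct.assoc K V W U (act₂ (act₂ ρ σ) τ t z) =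
      act₂ ρ (act₂ σ τ) (TensorProduct.assoc K A B C t) (TensorProduct.assoc K V W U z) := by
  refine act₂_intertwine (act₂ ρ σ) τ (TensorProduct.assoc K V W U).toLinearMap
    ((act₂ ρ (act₂ σ τ)).toLinearMap ∘ₗ (TensorProduct.assoc K A B C).toLinearMap) ?_ t z
  intro s x r p
  induction s using TensorProduct.induction_on with
  | zero => simp
  | add x y hx hy =>
    simp only [map_add, TensorProduct.add_tmul, LinearMap.add_apply, hx, hy]
  | tmul y w =>
    induction r using TensorProduct.induction_on with
    | zero => simp
    | add x y hx hy => simp only [map_add, TensorProduct.add_tmul, hx, hy]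
    | tmul m n => simp

theorem act₂_comp_left [Algebra K A] [Algebra K B] [Algebra K C] (ρ : A →ₐ[K] Module.End K V)
    (σ : B →ₐ[K] Module.End K W) (f : C →ₐ[K] A) (t : C ⊗[K] B) :
    act₂ (ρ.comp f) σ t = act₂ ρ σ (f.toLinearMap.rTensor B t) := by
  induction t using TensorProduct.induction_on with
  | zero => simp
  | add x y hx hy => simp only [map_add, hx, hy]
  | tmul x y => rfl

theorem act₂_comp_right [Algebra K A] [Algebra K B] [Algebra K C] (ρ : A →ₐ[K] Module.End K V)
    (σ : B →ₐ[K] Module.End K W) (f : C →ₐ[K] B) (t : A ⊗[K] C) :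
    act₂ ρ (σ.comp f) t = act₂ ρ σ (f.toLinearMap.lTensor A t) := by
  induction t using TensorProduct.induction_on with
  | zero => simp
  | add x y hx hy => simp only [map_add, hx, hy]
  | tmul x y => rfl

variable [Bialgebra K H]

/-- The tensor product `M ⊗ N` over `K`, on which `H` acts through the comultiplication. -/
def tensor (M N : FDMod K H) : FDMod K H where
  carrier := M.carrier ⊗[K] N.carrier
  ρ := (act₂ M.ρ N.ρ).comp (Bialgebra.comulAlgHom K H)

theorem Iso.sum {M M' N N' : FDMod K H} : Iso M M' → Iso N N' → Iso (sum M N) (sum M' N') := by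
  rintro ⟨e, he⟩ ⟨f, hf⟩
  refine ⟨e.prodCongr f, ?_⟩
  rintro h ⟨m, n⟩
  exact Prod.ext (he h m) (hf h n)

theorem Iso.tensor {M M' N N' : FDMod K H} :
    Iso M M' → Iso N N' → Iso (tensor M N) (tensor M' N') := by
  rintro ⟨e, he⟩ ⟨f, hf⟩
  exact ⟨TensorProduct.congr e f, fun h z =>
    act₂_intertwine M.ρ N.ρ (TensorProduct.congr e f).toLinearMap (act₂ M'.ρ N'.ρ).toLinearMap
      (fun x y m n => by simp [he, hf]) (Coalgebra.comul h) z⟩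

theorem sum_comm_iso (M N : FDMod K H) : Iso (sum M N) (sum N M) :=
  ⟨LinearEquiv.prodComm K _ _, fun _ _ => rfl⟩

theorem sum_assoc_iso (M N P : FDMod K H) : Iso (sum (sum M N) P) (sum M (sum N P)) :=
  ⟨LinearEquiv.prodAssoc K _ _ _, fun _ _ => rfl⟩

theorem zero_sum_iso (M : FDMod K H) : Iso (sum (zero K H) M) M :=
  ⟨(LinearEquiv.uniqueProd : (PUnit.{u + 1} × M.carrier) ≃ₗ[K] M.carrier), fun _ _ => rfl⟩

theorem unit_tensor_iso (M : FDMod K H) : Iso (tensor (unit K H) M) M := by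
  refine ⟨TensorProduct.lid K M.carrier, fun h z => ?_⟩
  have := act₂_intertwine ((Algebra.ofId K (Module.End K K)).comp (Bialgebra.counitAlgHom K H))
    M.ρ (TensorProduct.lid K M.carrier).toLinearMap
    (M.ρ.toLinearMap ∘ₗ (TensorProduct.lid K H).toLinearMap ∘ₗ Coalgebra.counit.rTensor H)
    (fun x y m n => by
      simp only [Algebra.ofId_apply, AlgHom.comp_apply, Bialgebra.counitAlgHom_apply,
        Module.algebraMap_end_apply, LinearEquiv.coe_coe, LinearMap.comp_apply,
        TensorProduct.lid_tmul, LinearMap.rTensor_tmul, AlgHom.toLinearMap_apply, map_smul, LinearMap.smul_apply,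
        smul_eq_mul, mul_smul]
      exact smul_comm _ _ _) (Coalgebra.comul h) z
  refine this.trans ?_
  simp only [LinearMap.comp_apply, Coalgebra.rTensor_counit_comul]
  simp
  rfl

theorem tensor_unit_iso (M : FDMod K H) : Iso (tensor M (unit K H)) M := by
  refine ⟨TensorProduct.rid K M.carrier, fun h z => ?_⟩
  have := act₂_intertwine M.ρ
    ((Algebra.ofId K (Module.End K K)).comp (Bialgebra.counitAlgHom K H))
    (TensorProduct.rid K M.carrier).toLinearMap
    (M.ρ.toLinearMap ∘ₗ (TensorProduct.rid K H).toLinearMap ∘ₗ Coalgebra.counit.lTensor H)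
    (fun x y m n => by
      simp only [Algebra.ofId_apply, AlgHom.comp_apply, Bialgebra.counitAlgHom_apply,
        Module.algebraMap_end_apply, LinearEquiv.coe_coe, LinearMap.comp_apply,
        TensorProduct.rid_tmul, LinearMap.lTensor_tmul, AlgHom.toLinearMap_apply, map_smul, LinearMap.smul_apply,
        smul_eq_mul, mul_smul]
      exact smul_comm _ _ _) (Coalgebra.comul h) z
  refine this.trans ?_
  simp only [LinearMap.comp_apply, Coalgebra.lTensor_counit_comul]
  simp
  rfl

theorem tensor_assoc_iso (M N P : FDMod K H) :
    Iso (tensor (tensor M N) P) (tensor M (tensor N P)) := by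
  refine ⟨TensorProduct.assoc K M.carrier N.carrier P.carrier, fun h z => ?_⟩
  have h₁ := act₂_comp_left (act₂ M.ρ N.ρ) P.ρ (Bialgebra.comulAlgHom K H) (Coalgebra.comul h)
  have h₂ := act₂_comp_right M.ρ (act₂ N.ρ P.ρ) (Bialgebra.comulAlgHom K H) (Coalgebra.comul h)
  have h₃ := act₂_assoc M.ρ N.ρ P.ρ (Coalgebra.comul.rTensor H (Coalgebra.comul h)) z
  rw [Coalgebra.coassoc_apply] at h₃
  exact ((congrArg (fun f => TensorProduct.assoc K M.carrier N.carrier P.carrier (f z)) h₁).trans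
    h₃).trans (congrArg (fun f => f (TensorProduct.assoc K M.carrier N.carrier P.carrier z)) h₂).symm

theorem sum_tensor_iso (M N P : FDMod K H) :
    Iso (tensor (sum M N) P) (sum (tensor M P) (tensor N P)) :=
  ⟨TensorProduct.prodLeft K K M.carrier N.carrier P.carrier, fun h z =>
    act₂_intertwine ((LinearMap.prodMapAlgHom K M.carrier N.carrier).comp (M.ρ.prod N.ρ)) P.ρ
      (TensorProduct.prodLeft K K M.carrier N.carrier P.carrier).toLinearMap
      ((LinearMap.prodMapAlgHom K _ _).comp ((act₂ M.ρ P.ρ).prod (act₂ N.ρ P.ρ))).toLinearMap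
      (fun x y m n => by obtain ⟨m, m'⟩ := m; simp) (Coalgebra.comul h) z⟩

theorem tensor_sum_iso (M N P : FDMod K H) :
    Iso (tensor M (sum N P)) (sum (tensor M N) (tensor M P)) :=
  ⟨TensorProduct.prodRight K K M.carrier N.carrier P.carrier, fun h z =>
    act₂_intertwine M.ρ ((LinearMap.prodMapAlgHom K N.carrier P.carrier).comp (N.ρ.prod P.ρ))
      (TensorProduct.prodRight K K M.carrier N.carrier P.carrier).toLinearMap
      ((LinearMap.prodMapAlgHom K _ _).comp ((act₂ M.ρ N.ρ).prod (act₂ M.ρ P.ρ))).toLinearMap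
      (fun x y m n => by simp) (Coalgebra.comul h) z⟩

theorem zero_tensor_iso (M : FDMod K H) : Iso (tensor (zero K H) M) (zero K H) := by
  have : Subsingleton (tensor (zero K H) M).carrier :=
    inferInstanceAs (Subsingleton (PUnit.{u + 1} ⊗[K] M.carrier))
  have : Subsingleton (zero K H).carrier := inferInstanceAs (Subsingleton PUnit.{u + 1})
  exact ⟨0, fun _ _ => Subsingleton.elim _ _⟩

theorem tensor_zero_iso (M : FDMod K H) : Iso (tensor M (zero K H)) (zero K H) := by
  have : Subsingleton (tensor M (zero K H)).carrier :=
    inferInstanceAs (Subsingleton (M.carrier ⊗[K] PUnit.{u + 1}))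
  have : Subsingleton (zero K H).carrier := inferInstanceAs (Subsingleton PUnit.{u + 1})
  exact ⟨0, fun _ _ => Subsingleton.elim _ _⟩

end tensor

end FDMod

/-! ### The Green ring -/

/-- The isomorphism classes of finite dimensional `H`-modules. -/
def IsoClass (K : Type u) (H : Type v) [Field K] [Ring H] [Bialgebra K H] : Type (max (u + 1) v) :=
  Quotient (FDMod.setoid K H)

section
variable (K : Type u) (H : Type v) [Field K] [Ring H] [Bialgebra K H]

instance : Add (IsoClass K H) :=
  ⟨Quotient.map₂ FDMod.sum fun _ _ h _ _ h' => FDMod.Iso.sum h h'⟩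

instance : Mul (IsoClass K H) :=
  ⟨Quotient.map₂ FDMod.tensor fun _ _ h _ _ h' => FDMod.Iso.tensor h h'⟩

instance : Zero (IsoClass K H) := ⟨Quotient.mk (FDMod.setoid K H) (FDMod.zero K H)⟩

instance : One (IsoClass K H) := ⟨Quotient.mk (FDMod.setoid K H) (FDMod.unit K H)⟩

/-- Isomorphism classes form a semiring under `⊕` and `⊗`. -/
instance : Semiring (IsoClass K H) where
  nsmul := nsmulRec
  npow := npowRec
  add_assoc := by
    rintro ⟨M⟩ ⟨N⟩ ⟨P⟩
    exact Quotient.sound (FDMod.sum_assoc_iso M N P)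
  zero_add := by
    rintro ⟨M⟩
    exact Quotient.sound (FDMod.zero_sum_iso M)
  add_zero := by
    rintro ⟨M⟩
    exact Quotient.sound ((FDMod.sum_comm_iso _ _).trans (FDMod.zero_sum_iso M))
  add_comm := by
    rintro ⟨M⟩ ⟨N⟩
    exact Quotient.sound (FDMod.sum_comm_iso M N)
  mul_assoc := by
    rintro ⟨M⟩ ⟨N⟩ ⟨P⟩
    exact Quotient.sound (FDMod.tensor_assoc_iso M N P)
  one_mul := by
    rintro ⟨M⟩
    exact Quotient.sound (FDMod.unit_tensor_iso M)
  mul_one := by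
    rintro ⟨M⟩
    exact Quotient.sound (FDMod.tensor_unit_iso M)
  zero_mul := by
    rintro ⟨M⟩
    exact Quotient.sound (FDMod.zero_tensor_iso M)
  mul_zero := by
    rintro ⟨M⟩
    exact Quotient.sound (FDMod.tensor_zero_iso M)
  left_distrib := by
    rintro ⟨M⟩ ⟨N⟩ ⟨P⟩
    exact Quotient.sound (FDMod.tensor_sum_iso M N P)
  right_distrib := by
    rintro ⟨M⟩ ⟨N⟩ ⟨P⟩
    exact Quotient.sound (FDMod.sum_tensor_iso M N P)

end

/-- The Grothendieck group of the additive monoid of a semiring `S`. -/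
def Completion (S : Type*) [Semiring S] : Type _ := Algebra.GrothendieckAddGroup S

namespace Completion

variable {S : Type*} [Semiring S]

instance : AddCommGroup (Completion S) :=
  inferInstanceAs (AddCommGroup (Algebra.GrothendieckAddGroup S))

/-- The canonical map of `S` to its Grothendieck group. -/
def of : S →+ Completion S := Algebra.GrothendieckAddGroup.of

/-- The universal property of the Grothendieck group. -/
def lift {G : Type*} [AddCommGroup G] (f : S →+ G) : Completion S →+ G :=
  Algebra.GrothendieckAddGroup.lift f

@[simp] theorem lift_of {G : Type*} [AddCommGroup G] (f : S →+ G) (s : S) :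
    lift f (of s) = f s :=
  DFunLike.congr_fun (Algebra.GrothendieckAddGroup.lift.symm_apply_apply f) s

theorem hom_ext {G : Type*} [AddCommGroup G] {f g : Completion S →+ G}
    (h : ∀ s, f (of s) = g (of s)) : f = g :=
  Algebra.GrothendieckAddGroup.lift.symm.injective (AddMonoidHom.ext h)

theorem ind {p : Completion S → Prop} (x : Completion S) (hof : ∀ s, p (of s))
    (hneg : ∀ x, p x → p (-x)) (hadd : ∀ x y, p x → p y → p (x + y)) : p x := by
  have hx : x ∈ (AddSubgroup.closure (Set.range (of (S := S)))) := by
    have : (QuotientAddGroup.mk' (AddSubgroup.closure (Set.range (of (S := S))))) = 0 :=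
      hom_ext fun s => by
        rw [QuotientAddGroup.mk'_apply, AddMonoidHom.zero_apply, QuotientAddGroup.eq_zero_iff]
        exact AddSubgroup.subset_closure (Set.mem_range_self s)
    exact (QuotientAddGroup.eq_zero_iff _).1 (DFunLike.congr_fun this x)
  induction hx using AddSubgroup.closure_induction with
  | mem x hx => obtain ⟨s, rfl⟩ := hx; exact hof s
  | zero => simpa using hof 0
  | add x y _ _ hx hy => exact hadd x y hx hy
  | neg x _ hx => exact hneg x hx

/-- The biadditive extension of the multiplication of `S`. -/
def mulHom : Completion S →+ Completion S →+ Completion S :=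
  lift
    { toFun := fun s => lift (of.comp (AddMonoidHom.mulLeft s))
      map_zero' := hom_ext fun t => by simp
      map_add' := fun s s' => hom_ext fun t => by simp [add_mul] }

instance : Mul (Completion S) := ⟨fun x y => mulHom x y⟩

theorem mul_def (x y : Completion S) : x * y = mulHom x y := rfl

theorem of_mul (s t : S) : of (s * t) = of s * of t := by
  simp [mul_def, mulHom]

/-- The ring structure on the Grothendieck group with `of s * of t = of (s * t)`. -/
instance : Ring (Completion S) where
  __ := (inferInstance : AddCommGroup (Completion S))
  __ := (inferInstance : Mul (Completion S))
  one := of 1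
  left_distrib x y z := by simp [mul_def]
  right_distrib x y z := by simp [mul_def]
  zero_mul x := by simp [mul_def]
  mul_zero x := by simp [mul_def]
  one_mul x := by
    change of 1 * x = x
    induction x using ind with
    | hof s => rw [← of_mul, one_mul]
    | hneg x hx => rw [mul_def] at hx ⊢; rw [map_neg, hx]
    | hadd x y hx hy => rw [mul_def] at hx hy ⊢; rw [map_add, hx, hy]
  mul_one x := by
    change x * of 1 = x
    induction x using ind with
    | hof s => rw [← of_mul, mul_one]
    | hneg x hx => rw [mul_def] at hx ⊢; rw [map_neg, AddMonoidHom.neg_apply, hx]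
    | hadd x y hx hy => rw [mul_def] at hx hy ⊢; rw [map_add, AddMonoidHom.add_apply, hx, hy]
  mul_assoc x y z := by
    induction x using ind with
    | hneg x hx => simp only [mul_def, map_neg, AddMonoidHom.neg_apply] at hx ⊢; rw [hx]
    | hadd x y hx hy =>
      simp only [mul_def, map_add, AddMonoidHom.add_apply] at hx hy ⊢; rw [hx, hy]
    | hof s =>
      induction y using ind with
      | hneg x hx => simp only [mul_def, map_neg, AddMonoidHom.neg_apply] at hx ⊢; rw [hx]
      | hadd x y hx hy =>
        simp only [mul_def, map_add, AddMonoidHom.add_apply] at hx hy ⊢; rw [hx, hy]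
      | hof t =>
        induction z using ind with
        | hneg x hx => simp only [mul_def, map_neg] at hx ⊢; rw [hx]
        | hadd x y hx hy => simp only [mul_def, map_add] at hx hy ⊢; rw [hx, hy]
        | hof r => simp only [← of_mul, mul_assoc]

end Completion

/-- The Green ring `r(H)`: the abelian group generated by the isomorphism classes `[M]` of finite
dimensional `H`-modules modulo `[M ⊕ N] = [M] + [N]`, with `[M][N] = [M ⊗ N]`. -/
abbrev GreenRing (K : Type u) (H : Type v) [Field K] [Ring H] [Bialgebra K H] :
    Type (max (u + 1) v) :=
  Completion (IsoClass K H)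

/-- The class `[M]` in the Green ring. -/
def cls {K : Type u} {H : Type v} [Field K] [Ring H] [Bialgebra K H] (M : FDMod K H) :
    GreenRing K H :=
  Completion.of (S := IsoClass K H) (Quotient.mk (FDMod.setoid K H) M)

theorem cls_sum {K : Type u} {H : Type v} [Field K] [Ring H] [Bialgebra K H] (M N : FDMod K H) :
    cls (M.sum N) = cls M + cls N :=
  (Completion.of (S := IsoClass K H)).map_add (Quotient.mk (FDMod.setoid K H) M)
    (Quotient.mk (FDMod.setoid K H) N)

theorem cls_tensor {K : Type u} {H : Type v} [Field K] [Ring H] [Bialgebra K H]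
    (M N : FDMod K H) : cls (M.tensor N) = cls M * cls N :=
  Completion.of_mul (S := IsoClass K H) (Quotient.mk (FDMod.setoid K H) M)
    (Quotient.mk (FDMod.setoid K H) N)

/-- The projective class ring `r_p(H)`: the subring of `r(H)` generated by the classes of the
projective modules and of the simple modules. -/
def projectiveClassRing (K : Type u) (H : Type v) [Field K] [Ring H] [Bialgebra K H] :
    Subring (GreenRing K H) :=
  Subring.closure
    {z | ∃ M : FDMod K H,
      (Module.Projective H M.carrier ∨ IsSimpleModule H M.carrier) ∧ z = cls M}

end Green

namespace Taft

/-! ### The Hopf algebras `H_n(p, q)` -/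

/-- The quantum integer `(m)_q = 1 + q + ⋯ + q^(m-1)`. -/
def qInt {K : Type u} [Field K] (q : K) (m : ℕ) : K := ∑ k ∈ Finset.range m, q ^ k

section qbinomial

variable {K : Type u} [Field K] (q : K)

theorem qInt_add (i j : ℕ) : qInt q (i + j) = qInt q i + q ^ i * qInt q j := by
  simp [qInt, Finset.sum_range_add, pow_add, Finset.mul_sum]

/-- The coefficient of `x ^ i * y ^ j` in `(x + y) ^ (i + j)` if `y x = q x y`. -/
def qBinom : ℕ → ℕ → K
  | 0, _ => 1
  | _ + 1, 0 => 1
  | i + 1, j + 1 => qBinom i (j + 1) + q ^ (i + 1) * qBinom (i + 1) j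
termination_by i j => i + j

/-- The quantum factorial. -/
def qFact (m : ℕ) : K := ∏ k ∈ Finset.range m, qInt q (k + 1)

theorem qFact_succ (m : ℕ) : qFact q (m + 1) = qFact q m * qInt q (m + 1) :=
  Finset.prod_range_succ _ _

theorem qBinom_zero_left (j : ℕ) : qBinom q 0 j = 1 := by simp [qBinom]

theorem qBinom_zero_right (i : ℕ) : qBinom q i 0 = 1 := by cases i <;> simp [qBinom]

theorem qBinom_succ (i j : ℕ) : qBinom q (i + 1) (j + 1) =
    qBinom q i (j + 1) + q ^ (i + 1) * qBinom q (i + 1) j := by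
  rw [qBinom]

theorem qBinom_mul_qFact : ∀ i j : ℕ,
    qBinom q i j * (qFact q i * qFact q j) = qFact q (i + j)
  | 0, j => by simp [qBinom_zero_left, qFact]
  | i + 1, 0 => by simp [qBinom_zero_right, qFact]
  | i + 1, j + 1 => by
    have h₁ := qBinom_mul_qFact i (j + 1)
    have h₂ := qBinom_mul_qFact (i + 1) j
    have e : i + (j + 1) = i + 1 + j := by ring
    rw [e] at h₁
    rw [qBinom_succ, show i + 1 + (j + 1) = (i + 1 + j) + 1 by ring, qFact_succ q (i + 1 + j),
      show i + 1 + j + 1 = (i + 1) + (j + 1) by ring, qInt_add, mul_add, ← h₁]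
    rw [h₁, ← h₂]
    rw [← h₂] at h₁
    rw [qFact_succ q j] at h₁ ⊢
    rw [qFact_succ q i] at h₁ ⊢
    linear_combination (qInt q (i + 1)) * h₁
termination_by i j => i + j

variable {q}

theorem qInt_eq_zero {n : ℕ} (hq : IsPrimitiveRoot q n) (hn : 1 < n) : qInt q n = 0 :=
  hq.geom_sum_eq_zero hn

theorem qInt_ne_zero {n m : ℕ} (hq : IsPrimitiveRoot q n) (hm : 0 < m) (hmn : m < n) :
    qInt q m ≠ 0 := by
  intro h
  have := geom_sum_mul q m
  rw [show ∑ i ∈ Finset.range m, q ^ i = qInt q m from rfl, h, zero_mul] at this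
  exact hq.pow_ne_one_of_pos_of_lt hm.ne' hmn (sub_eq_zero.1 this.symm)

theorem qFact_ne_zero {n m : ℕ} (hq : IsPrimitiveRoot q n) (hmn : m < n) : qFact q m ≠ 0 :=
  Finset.prod_ne_zero_iff.2 fun k hk =>
    qInt_ne_zero hq k.succ_pos (by have := Finset.mem_range.1 hk; omega)

theorem qBinom_eq_zero {n i j : ℕ} (hq : IsPrimitiveRoot q n) (h : i + j = n) (hi : i ≠ 0)
    (hj : j ≠ 0) : qBinom q i j = 0 := by
  have h₁ := qBinom_mul_qFact q i j
  obtain ⟨m, rfl⟩ : ∃ m, n = m + 1 := ⟨n - 1, by omega⟩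
  rw [h, qFact_succ, qInt_eq_zero hq (by omega), mul_zero] at h₁
  exact (mul_eq_zero.1 h₁).resolve_right
    (mul_ne_zero (qFact_ne_zero hq (by omega)) (qFact_ne_zero hq (by omega)))

variable {R : Type*} [Ring R] [Algebra K R] {x y : R}

theorem mul_pow_of_qcomm (h : y * x = q • (x * y)) (k : ℕ) : y * x ^ k = q ^ k • (x ^ k * y) := by
  induction k with
  | zero => simp
  | succ k ih =>
    rw [pow_succ x, ← mul_assoc, ih, smul_mul_assoc, mul_assoc, h, mul_smul_comm, smul_smul,
      pow_succ q, mul_assoc]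

theorem add_pow_of_qcomm (h : y * x = q • (x * y)) (m : ℕ) :
    (x + y) ^ m = ∑ p ∈ Finset.HasAntidiagonal.antidiagonal m, qBinom q p.1 p.2 • (x ^ p.1 * y ^ p.2) := by
  induction m with
  | zero => simp [qBinom_zero_left]
  | succ m ih =>
    have hx : x * ∑ p ∈ Finset.HasAntidiagonal.antidiagonal m, qBinom q p.1 p.2 • (x ^ p.1 * y ^ p.2) =
        ∑ p ∈ Finset.HasAntidiagonal.antidiagonal m, qBinom q p.1 p.2 • (x ^ (p.1 + 1) * y ^ p.2) := by
      rw [Finset.mul_sum]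
      refine Finset.sum_congr rfl fun p _ => ?_
      rw [mul_smul_comm, ← mul_assoc, ← pow_succ']
    have hy : y * ∑ p ∈ Finset.HasAntidiagonal.antidiagonal m, qBinom q p.1 p.2 • (x ^ p.1 * y ^ p.2) =
        ∑ p ∈ Finset.HasAntidiagonal.antidiagonal m, (q ^ p.1 * qBinom q p.1 p.2) • (x ^ p.1 * y ^ (p.2 + 1)) := by
      rw [Finset.mul_sum]
      refine Finset.sum_congr rfl fun p _ => ?_
      rw [mul_smul_comm, ← mul_assoc, mul_pow_of_qcomm h, smul_mul_assoc, smul_smul, mul_assoc,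
        ← pow_succ', mul_comm]
    rw [pow_succ', ih, add_mul, hx, hy]
    let f : ℕ × ℕ → K := fun p => if p.1 = 0 then 0 else qBinom q (p.1 - 1) p.2
    let g : ℕ × ℕ → K := fun p => if p.2 = 0 then 0 else q ^ p.1 * qBinom q p.1 (p.2 - 1)
    have hfg : ∀ p ∈ Finset.HasAntidiagonal.antidiagonal (m + 1),
        qBinom q p.1 p.2 • (x ^ p.1 * y ^ p.2) =
          f p • (x ^ p.1 * y ^ p.2) + g p • (x ^ p.1 * y ^ p.2) := by
      rintro ⟨i, j⟩ hp
      rw [Finset.HasAntidiagonal.mem_antidiagonal] at hp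
      rw [← add_smul]
      congr 1
      cases i with
      | zero =>
        have : j ≠ 0 := by rintro rfl; simp at hp
        simp [f, g, qBinom_zero_left, this]
      | succ i =>
        cases j with
        | zero => simp [f, g, qBinom_zero_right]
        | succ j => simp [f, g, qBinom_succ]
    rw [Finset.sum_congr rfl hfg, Finset.sum_add_distrib, Finset.Nat.sum_antidiagonal_succ,
      Finset.Nat.sum_antidiagonal_succ' (f := fun p => g p • (x ^ p.1 * y ^ p.2))]
    simp [f, g]

theorem add_pow_of_primitive {n : ℕ} (hq : IsPrimitiveRoot q n) (hx : x ^ n = 0) (hy : y ^ n = 0)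
    (h : y * x = q • (x * y)) : (x + y) ^ n = 0 := by
  rw [add_pow_of_qcomm h]
  refine Finset.sum_eq_zero fun p hp => ?_
  rw [Finset.HasAntidiagonal.mem_antidiagonal] at hp
  by_cases h1 : p.1 = 0
  · rw [h1, zero_add] at hp
    rw [hp, hy, mul_zero, smul_zero]
  by_cases h2 : p.2 = 0
  · rw [h2, add_zero] at hp
    rw [hp, hx, zero_mul, smul_zero]
  rw [qBinom_eq_zero hq hp h1 h2, zero_smul]

end qbinomial

/-- The four generators `a, b, c, d`. -/
inductive Gen
  | a | b | c | d

/-- The defining relations of `H_n(p, q)` for four elements of a `K`-algebra. -/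
structure Relations {K : Type u} [Field K] (n : ℕ) (p q : K) {R : Type*} [Ring R] [Algebra K R]
    (a b c d : R) : Prop where
  ba : b * a = q • (a * b)
  db : d * b = q • (b * d)
  ca : c * a = q • (a * c)
  dc : d * c = q • (c * d)
  bc : b * c = c * b
  an : a ^ n = 0
  bn : b ^ n = 1
  cn : c ^ n = 1
  dn : d ^ n = 0
  da : d * a - q • (a * d) = p • (1 - b * c)

open FreeAlgebra in
/-- The defining relations of `H_n(p, q)` in the free algebra on `a, b, c, d`. -/
inductive Rel {K : Type u} [Field K] (n : ℕ) (p q : K) :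
    FreeAlgebra K Gen → FreeAlgebra K Gen → Prop
  | ba : Rel n p q (ι K Gen.b * ι K Gen.a) (q • (ι K Gen.a * ι K Gen.b))
  | db : Rel n p q (ι K Gen.d * ι K Gen.b) (q • (ι K Gen.b * ι K Gen.d))
  | ca : Rel n p q (ι K Gen.c * ι K Gen.a) (q • (ι K Gen.a * ι K Gen.c))
  | dc : Rel n p q (ι K Gen.d * ι K Gen.c) (q • (ι K Gen.c * ι K Gen.d))
  | bc : Rel n p q (ι K Gen.b * ι K Gen.c) (ι K Gen.c * ι K Gen.b)
  | an : Rel n p q (ι K Gen.a ^ n) 0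
  | bn : Rel n p q (ι K Gen.b ^ n) 1
  | cn : Rel n p q (ι K Gen.c ^ n) 1
  | dn : Rel n p q (ι K Gen.d ^ n) 0
  | da : Rel n p q (ι K Gen.d * ι K Gen.a - q • (ι K Gen.a * ι K Gen.d))
      (p • (1 - ι K Gen.b * ι K Gen.c))

/-- The algebra `H_n(p, q)`, presented by the generators `a, b, c, d` and the relations `Rel`. -/
def Hn {K : Type u} [Field K] (n : ℕ) (p q : K) : Type u := RingQuot (Rel n p q)

namespace Hn

variable {K : Type u} [Field K] {n : ℕ} {p q : K}

instance : Ring (Hn n p q) := inferInstanceAs (Ring (RingQuot (Rel n p q)))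

instance : Algebra K (Hn n p q) := inferInstanceAs (Algebra K (RingQuot (Rel n p q)))

variable (n p q) in
/-- The generators of `H_n(p, q)`. -/
def gen (g : Gen) : Hn n p q := RingQuot.mkAlgHom K (Rel n p q) (FreeAlgebra.ι K g)

variable (n p q) in
theorem relations : Relations n p q (gen n p q .a) (gen n p q .b) (gen n p q .c) (gen n p q .d) where
  ba := by simpa using! RingQuot.mkAlgHom_rel K (Rel.ba (n := n) (p := p) (q := q))
  db := by simpa using! RingQuot.mkAlgHom_rel K (Rel.db (n := n) (p := p) (q := q))
  ca := by simpa using! RingQuot.mkAlgHom_rel K (Rel.ca (n := n) (p := p) (q := q))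
  dc := by simpa using! RingQuot.mkAlgHom_rel K (Rel.dc (n := n) (p := p) (q := q))
  bc := by simpa using! RingQuot.mkAlgHom_rel K (Rel.bc (n := n) (p := p) (q := q))
  an := by simpa using! RingQuot.mkAlgHom_rel K (Rel.an (n := n) (p := p) (q := q))
  bn := by simpa using! RingQuot.mkAlgHom_rel K (Rel.bn (n := n) (p := p) (q := q))
  cn := by simpa using! RingQuot.mkAlgHom_rel K (Rel.cn (n := n) (p := p) (q := q))
  dn := by simpa using! RingQuot.mkAlgHom_rel K (Rel.dn (n := n) (p := p) (q := q))
  da := by simpa using! RingQuot.mkAlgHom_rel K (Rel.da (n := n) (p := p) (q := q))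

section lift

variable {R : Type*} [Ring R] [Algebra K R] {a b c d : R}

/-- The values of an algebra map on the generators. -/
def vals (a b c d : R) : Gen → R
  | .a => a
  | .b => b
  | .c => c
  | .d => d

/-- The universal property of the presentation. -/
def lift (h : Relations n p q a b c d) : Hn n p q →ₐ[K] R :=
  RingQuot.liftAlgHom K ⟨FreeAlgebra.lift K (vals a b c d), by
    intro x y hxy
    cases hxy
    · simpa [vals] using h.ba
    · simpa [vals] using h.db
    · simpa [vals] using h.ca
    · simpa [vals] using h.dc
    · simpa [vals] using h.bc
    · simpa [vals] using h.an
    · simpa [vals] using h.bn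
    · simpa [vals] using h.cn
    · simpa [vals] using h.dn
    · simpa [vals] using h.da⟩

theorem lift_gen (h : Relations n p q a b c d) (g : Gen) :
    lift h (gen n p q g) = vals a b c d g :=
  (RingQuot.liftAlgHom_mkAlgHom_apply K _ _ _).trans (FreeAlgebra.lift_ι_apply _ _)

theorem algHom_ext {f g : Hn n p q →ₐ[K] R} (h : ∀ x, f (gen n p q x) = g (gen n p q x)) :
    f = g := by
  refine RingQuot.ringQuot_ext' K f g (FreeAlgebra.hom_ext ?_)
  funext x
  exact h x

end lift

/-- An induction principle: a subalgebra containing the generators is everything. -/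
theorem gen_induction (S : Subalgebra K (Hn n p q)) (h : ∀ g, gen n p q g ∈ S) (x : Hn n p q) :
    x ∈ S := by
  obtain ⟨x, rfl⟩ := RingQuot.mkAlgHom_surjective K (Rel n p q) x
  induction x using FreeAlgebra.induction with
  | grade0 r => exact (AlgHom.commutes (RingQuot.mkAlgHom K (Rel n p q)) r) ▸ S.algebraMap_mem r
  | grade1 g => exact h g
  | mul x y hx hy => rw [map_mul]; exact S.mul_mem hx hy
  | add x y hx hy => rw [map_add]; exact S.add_mem hx hy

end Hn

/-! ### The Hopf algebra structure -/

section hopf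

variable {K : Type u} [Field K] {n : ℕ} {p q : K}

/-- The images of `a, b, c, d` under the comultiplication satisfy the defining relations. -/
theorem Relations.comul {R : Type*} [Ring R] [Algebra K R] {a b c d : R}
    (h : Relations n p q a b c d) (hq : IsPrimitiveRoot q n) :
    Relations n p q (a ⊗ₜ[K] b + 1 ⊗ₜ[K] a) (b ⊗ₜ[K] b) (c ⊗ₜ[K] c)
      (d ⊗ₜ[K] c + 1 ⊗ₜ[K] d) where
  ba := by
    simp only [mul_add, add_mul, Algebra.TensorProduct.tmul_mul_tmul, h.ba, mul_one, one_mul,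
      smul_add, TensorProduct.tmul_smul, TensorProduct.smul_tmul']
  db := by
    simp only [mul_add, add_mul, Algebra.TensorProduct.tmul_mul_tmul, h.db, h.bc, mul_one, one_mul,
      smul_add, TensorProduct.tmul_smul, TensorProduct.smul_tmul']
  ca := by
    simp only [mul_add, add_mul, Algebra.TensorProduct.tmul_mul_tmul, h.ca, h.bc, mul_one, one_mul,
      smul_add, TensorProduct.tmul_smul, TensorProduct.smul_tmul']
  dc := by
    simp only [mul_add, add_mul, Algebra.TensorProduct.tmul_mul_tmul, h.dc, mul_one, one_mul,
      smul_add, TensorProduct.tmul_smul, TensorProduct.smul_tmul']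
  bc := by simp only [Algebra.TensorProduct.tmul_mul_tmul, h.bc]
  an := by
    rw [add_comm]
    refine add_pow_of_primitive hq ?_ ?_ ?_
    · rw [Algebra.TensorProduct.tmul_pow, h.an, TensorProduct.tmul_zero]
    · rw [Algebra.TensorProduct.tmul_pow, h.an, TensorProduct.zero_tmul]
    · simp only [Algebra.TensorProduct.tmul_mul_tmul, h.ba, mul_one, one_mul,
        TensorProduct.tmul_smul]
  bn := by rw [Algebra.TensorProduct.tmul_pow, h.bn, Algebra.TensorProduct.one_def]
  cn := by rw [Algebra.TensorProduct.tmul_pow, h.cn, Algebra.TensorProduct.one_def]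
  dn := by
    refine add_pow_of_primitive hq ?_ ?_ ?_
    · rw [Algebra.TensorProduct.tmul_pow, h.dn, TensorProduct.zero_tmul]
    · rw [Algebra.TensorProduct.tmul_pow, h.dn, TensorProduct.tmul_zero]
    · simp only [Algebra.TensorProduct.tmul_mul_tmul, h.dc, mul_one, one_mul,
        TensorProduct.tmul_smul]
  da := by
    have hda : d * a = q • (a * d) + p • (1 - b * c) := by rw [← h.da]; abel
    simp only [mul_add, add_mul, Algebra.TensorProduct.tmul_mul_tmul, h.db, h.ca, h.bc, mul_one,
      one_mul, hda, smul_add, smul_sub, TensorProduct.tmul_smul, TensorProduct.smul_tmul',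
      TensorProduct.add_tmul, TensorProduct.tmul_add, TensorProduct.sub_tmul,
      TensorProduct.tmul_sub, Algebra.TensorProduct.one_def]
    abel

/-- The values `0, 1, 1, 0` of the counit satisfy the defining relations. -/
theorem Relations.counit [NeZero n] : Relations n p q (0 : K) 1 1 0 where
  ba := by simp
  db := by simp
  ca := by simp
  dc := by simp
  bc := by simp
  an := by simp [NeZero.ne n]
  bn := by simp
  cn := by simp
  dn := by simp [NeZero.ne n]
  da := by simp

open MulOpposite in
/-- The images of `a, b, c, d` under the antipode satisfy the defining relations in the opposite
algebra. -/
theorem Relations.antipode {R : Type*} [Ring R] [Algebra K R] {a b c d : R} [NeZero n]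
    (h : Relations n p q a b c d) (hq : IsPrimitiveRoot q n) :
    Relations n p q (op (-(a * b ^ (n - 1)))) (op (b ^ (n - 1))) (op (c ^ (n - 1)))
      (op (-(d * c ^ (n - 1)))) := by
  have hq0 : q ≠ 0 := hq.ne_zero (NeZero.ne n)
  have hn : n - 1 + 1 = n := Nat.succ_pred_eq_of_pos (NeZero.pos n)
  have bB : b * b ^ (n - 1) = 1 := by rw [← pow_succ', hn, h.bn]
  have Bb : b ^ (n - 1) * b = 1 := by rw [← pow_succ, hn, h.bn]
  have cC : c * c ^ (n - 1) = 1 := by rw [← pow_succ', hn, h.cn]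
  have Cc : c ^ (n - 1) * c = 1 := by rw [← pow_succ, hn, h.cn]
  have BC : b ^ (n - 1) * c ^ (n - 1) = c ^ (n - 1) * b ^ (n - 1) :=
    (Commute.pow_pow (show Commute b c from h.bc) _ _)
  have hBn : (b ^ (n - 1)) ^ n = 1 := by rw [← pow_mul, mul_comm, pow_mul, h.bn, one_pow]
  have hCn : (c ^ (n - 1)) ^ n = 1 := by rw [← pow_mul, mul_comm, pow_mul, h.cn, one_pow]
  have bC : Commute b (c ^ (n - 1)) := Commute.pow_right h.bc _
  have cB : Commute c (b ^ (n - 1)) := Commute.pow_right (Commute.symm h.bc) _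
  generalize b ^ (n - 1) = B at *
  generalize c ^ (n - 1) = C at *
  have aux : ∀ {x y Y : R}, y * Y = 1 → Y * y = 1 → y * x = q • (x * y) →
      x * Y = q • (Y * x) := by
    intro x y Y h₁ h₂ h₃
    calc x * Y = Y * (y * x) * Y := by rw [← mul_assoc, h₂, one_mul]
      _ = q • (Y * x) := by
        rw [h₃, mul_smul_comm, smul_mul_assoc, mul_assoc, mul_assoc, h₁, mul_one]
  have aux' : ∀ {x y Y : R}, y * Y = 1 → Y * y = 1 → x * y = q • (y * x) →
      Y * x = q • (x * Y) := by
    intro x y Y h₁ h₂ h₃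
    calc Y * x = Y * (x * y) * Y := by rw [mul_assoc, mul_assoc, h₁, mul_one]
      _ = q • (x * Y) := by
        rw [h₃, mul_smul_comm, smul_mul_assoc, ← mul_assoc Y, h₂, one_mul]
  have aB : a * B = q • (B * a) := aux bB Bb h.ba
  have aC : a * C = q • (C * a) := aux cC Cc h.ca
  have Bd : B * d = q • (d * B) := aux' bB Bb h.db
  have Cd : C * d = q • (d * C) := aux' cC Cc h.dc
  have hnil : ∀ {x Y : R} {r : K}, r ≠ 0 → x * Y = r • (Y * x) → x ^ n = 0 →
      (x * Y) ^ n = 0 := by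
    intro x Y r hr hxY hx
    have hYx : Y * x = r⁻¹ • (x * Y) := by rw [hxY, smul_smul, inv_mul_cancel₀ hr, one_smul]
    have : ∀ m : ℕ, ∃ s : K, (x * Y) ^ m = s • (x ^ m * Y ^ m) := by
      intro m
      induction m with
      | zero => exact ⟨1, by simp⟩
      | succ m ih =>
        obtain ⟨s, hs⟩ := ih
        refine ⟨(r⁻¹) ^ m * s, ?_⟩
        rw [pow_succ', hs, mul_smul_comm, mul_assoc x Y, ← mul_assoc Y, mul_pow_of_qcomm hYx,
          smul_mul_assoc, mul_smul_comm, smul_smul, mul_assoc (x ^ m) Y, ← pow_succ', ← mul_assoc,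
          ← pow_succ', mul_comm]
    obtain ⟨s, hs⟩ := this n
    rw [hs, hx, zero_mul, smul_zero]
  refine ⟨?_, ?_, ?_, ?_, ?_, ?_, ?_, ?_, ?_, ?_⟩
  · rw [← op_mul, ← op_mul, ← op_smul, neg_mul, mul_neg, ← mul_assoc, smul_neg, aB,
      smul_mul_assoc]
  · rw [← op_mul, ← op_mul, ← op_smul, neg_mul, mul_neg, ← mul_assoc, Bd, smul_mul_assoc,
      mul_assoc, mul_assoc, BC, smul_neg]
  · rw [← op_mul, ← op_mul, ← op_smul, neg_mul, mul_neg, mul_assoc, BC, ← mul_assoc, aC,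
      smul_mul_assoc, smul_neg, mul_assoc]
  · rw [← op_mul, ← op_mul, ← op_smul, neg_mul, mul_neg, ← mul_assoc, Cd, smul_mul_assoc, smul_neg]
  · rw [← op_mul, ← op_mul, BC]
  · rw [← op_pow, neg_pow, hnil hq0 aB h.an, mul_zero, op_zero]
  · rw [← op_pow, hBn, op_one]
  · rw [← op_pow, hCn, op_one]
  · rw [← op_pow, neg_pow, hnil (r := q⁻¹) (inv_ne_zero hq0) ?_ h.dn, mul_zero, op_zero]
    rw [Cd, smul_smul, inv_mul_cancel₀ hq0, one_smul]
  · rw [← op_mul, ← op_mul, ← op_mul, ← op_smul, ← op_one, ← op_sub, ← op_sub, ← op_smul, neg_mul_neg,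
      neg_mul_neg]
    congr 1
    have e₁ : a * B * (d * C) = q • (a * d * (B * C)) := by
      rw [mul_assoc, ← mul_assoc B, Bd, smul_mul_assoc, mul_smul_comm, mul_assoc, mul_assoc]
    have e₂ : q • (d * C * (a * B)) = d * a * (B * C) := by
      rw [mul_assoc, ← mul_assoc C, ← mul_smul_comm, ← smul_mul_assoc, ← aC, mul_assoc, mul_assoc,
        BC]
    have e₃ : b * c * (B * C) = 1 := by
      rw [mul_assoc, ← mul_assoc c, cB.eq, mul_assoc, cC, mul_one, bB]
    rw [e₁, e₂, ← smul_mul_assoc, ← sub_mul, ← neg_sub, h.da, neg_mul, smul_mul_assoc, sub_mul, e₃,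
      one_mul, ← smul_neg, neg_sub, BC]

variable [NeZero n] [hq : Fact (IsPrimitiveRoot q n)]

/-- `Δ(a) = a ⊗ b + 1 ⊗ a`, `Δ(b) = b ⊗ b`, `Δ(c) = c ⊗ c`, `Δ(d) = d ⊗ c + 1 ⊗ d` and
`ε(a) = ε(d) = 0`, `ε(b) = ε(c) = 1`. -/
instance Hn.instBialgebra : Bialgebra K (Hn n p q) :=
  Bialgebra.ofAlgHom (Hn.lift ((Hn.relations n p q).comul hq.out)) (Hn.lift Relations.counit)
    (by
      refine Hn.algHom_ext fun g => ?_
      cases g <;>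
        simp [Hn.lift_gen, Hn.vals, TensorProduct.add_tmul, TensorProduct.tmul_add,
          Algebra.TensorProduct.one_def, add_assoc])
    (by
      refine Hn.algHom_ext fun g => ?_
      cases g <;> simp [Hn.lift_gen, Hn.vals])
    (by
      refine Hn.algHom_ext fun g => ?_
      cases g <;> simp [Hn.lift_gen, Hn.vals])

theorem Hn.comul_eq (x : Hn n p q) :
    Coalgebra.comul (R := K) x = Hn.lift ((Hn.relations n p q).comul hq.out) x := rfl

theorem Hn.counit_eq (x : Hn n p q) :
    Coalgebra.counit (R := K) x = Hn.lift (n := n) (p := p) (q := q) Relations.counit x := rfl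

variable (n p q) in
/-- `S(a) = -a b^(n-1)`, `S(b) = b^(n-1)`, `S(c) = c^(n-1)`, `S(d) = -d c^(n-1)`, as an algebra
map to the opposite algebra. -/
def Hn.antipodeHom : Hn n p q →ₐ[K] (Hn n p q)ᵐᵒᵖ :=
  Hn.lift ((Hn.relations n p q).antipode hq.out)

variable (n p q) in
/-- The antipode of `H_n(p, q)`. -/
def Hn.antipodeLin : Hn n p q →ₗ[K] Hn n p q :=
  (MulOpposite.opLinearEquiv K).symm.toLinearMap ∘ₗ (Hn.antipodeHom n p q).toLinearMap

theorem Hn.antipodeLin_mul (x y : Hn n p q) :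
    Hn.antipodeLin n p q (x * y) = Hn.antipodeLin n p q y * Hn.antipodeLin n p q x := by
  simp [Hn.antipodeLin]

theorem Hn.antipodeLin_one : Hn.antipodeLin n p q 1 = 1 := by
  simp [Hn.antipodeLin]

theorem Hn.antipode_left (x : Hn n p q) :
    LinearMap.mul' K (Hn n p q) ((Hn.antipodeLin n p q).rTensor _ (Coalgebra.comul x)) =
      algebraMap K _ (Coalgebra.counit x) := by
  let f := LinearMap.mul' K (Hn n p q) ∘ₗ (Hn.antipodeLin n p q).rTensor (Hn n p q)
  have hf : ∀ (t : Hn n p q ⊗[K] Hn n p q) (x y : Hn n p q),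
      f (t * x ⊗ₜ y) = Hn.antipodeLin n p q x * f t * y := by
    intro t x y
    induction t using TensorProduct.induction_on with
    | zero => simp
    | add s t hs ht => simp only [add_mul, mul_add, map_add, hs, ht]
    | tmul z w => simp [f, Hn.antipodeLin_mul, mul_assoc]
  let S : Subalgebra K (Hn n p q) :=
    { carrier := {x | f (Coalgebra.comul x) = algebraMap K _ (Coalgebra.counit (R := K) x)}
      mul_mem' := by
        intro x y hx hy
        simp only [Set.mem_ofPred_eq] at hx hy ⊢
        have : ∀ s, f (Coalgebra.comul x * s) =
            algebraMap K _ (Coalgebra.counit (R := K) x) * f s := by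
          intro s
          induction s using TensorProduct.induction_on with
          | zero => simp
          | add s t hs ht => simp only [mul_add, map_add, hs, ht]
          | tmul z w =>
            rw [hf, hx, ← Algebra.commutes, mul_assoc]
            simp [f]
        rw [Bialgebra.comul_mul, this, hy, Bialgebra.counit_mul, map_mul]
      add_mem' := by
        intro x y hx hy
        simp only [Set.mem_ofPred_eq] at hx hy ⊢
        simp only [map_add, hx, hy]
      algebraMap_mem' := by
        intro r
        have h1 : f 1 = 1 := by simp [f, Algebra.TensorProduct.one_def, Hn.antipodeLin_one]
        simp only [Set.mem_ofPred_eq, Algebra.algebraMap_eq_smul_one, map_smul,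
          Bialgebra.comul_one, Bialgebra.counit_one, h1, smul_eq_mul, mul_one] }
  refine Hn.gen_induction S (fun g => ?_) x
  change f (Coalgebra.comul (gen n p q g)) = algebraMap K _ (Coalgebra.counit (R := K) (gen n p q g))
  have hn : n - 1 + 1 = n := Nat.succ_pred_eq_of_pos (NeZero.pos n)
  have h := Hn.relations n p q
  rw [Hn.comul_eq, Hn.counit_eq, Hn.lift_gen, Hn.lift_gen]
  cases g
  · simp [f, Hn.vals, Hn.antipodeLin, Hn.antipodeHom, Hn.lift_gen, mul_assoc,
      ← pow_succ, hn, h.bn]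
  · simp [f, Hn.vals, Hn.antipodeLin, Hn.antipodeHom, Hn.lift_gen, ← pow_succ, hn, h.bn]
  · simp [f, Hn.vals, Hn.antipodeLin, Hn.antipodeHom, Hn.lift_gen, ← pow_succ, hn, h.cn]
  · simp [f, Hn.vals, Hn.antipodeLin, Hn.antipodeHom, Hn.lift_gen, mul_assoc,
      ← pow_succ, hn, h.cn]

theorem Hn.antipode_right (x : Hn n p q) :
    LinearMap.mul' K (Hn n p q) ((Hn.antipodeLin n p q).lTensor _ (Coalgebra.comul x)) =
      algebraMap K _ (Coalgebra.counit x) := by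
  let f := LinearMap.mul' K (Hn n p q) ∘ₗ (Hn.antipodeLin n p q).lTensor (Hn n p q)
  have hf : ∀ (t : Hn n p q ⊗[K] Hn n p q) (x y : Hn n p q),
      f (x ⊗ₜ y * t) = x * f t * Hn.antipodeLin n p q y := by
    intro t x y
    induction t using TensorProduct.induction_on with
    | zero => simp
    | add s t hs ht => simp only [add_mul, mul_add, map_add, hs, ht]
    | tmul z w => simp [f, Hn.antipodeLin_mul, mul_assoc]
  let S : Subalgebra K (Hn n p q) :=
    { carrier := {x | f (Coalgebra.comul x) = algebraMap K _ (Coalgebra.counit (R := K) x)}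
      mul_mem' := by
        intro x y hx hy
        simp only [Set.mem_ofPred_eq] at hx hy ⊢
        have : ∀ s, f (s * Coalgebra.comul y) =
            f s * algebraMap K _ (Coalgebra.counit (R := K) y) := by
          intro s
          induction s using TensorProduct.induction_on with
          | zero => simp
          | add s t hs ht => simp only [add_mul, map_add, hs, ht]
          | tmul z w =>
            rw [hf, hy, mul_assoc, Algebra.commutes, ← mul_assoc]
            simp [f]
        rw [Bialgebra.comul_mul, this, hx, Bialgebra.counit_mul, map_mul]
      add_mem' := by
        intro x y hx hy
        simp only [Set.mem_ofPred_eq] at hx hy ⊢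
        simp only [map_add, hx, hy]
      algebraMap_mem' := by
        intro r
        have h1 : f 1 = 1 := by simp [f, Algebra.TensorProduct.one_def, Hn.antipodeLin_one]
        simp only [Set.mem_ofPred_eq, Algebra.algebraMap_eq_smul_one, map_smul,
          Bialgebra.comul_one, Bialgebra.counit_one, h1, smul_eq_mul, mul_one] }
  refine Hn.gen_induction S (fun g => ?_) x
  change f (Coalgebra.comul (gen n p q g)) = algebraMap K _ (Coalgebra.counit (R := K) (gen n p q g))
  have hn : n - 1 + 1 = n := Nat.succ_pred_eq_of_pos (NeZero.pos n)
  have h := Hn.relations n p q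
  rw [Hn.comul_eq, Hn.counit_eq, Hn.lift_gen, Hn.lift_gen]
  cases g
  · simp [f, Hn.vals, Hn.antipodeLin, Hn.antipodeHom, Hn.lift_gen]
  · simp [f, Hn.vals, Hn.antipodeLin, Hn.antipodeHom, Hn.lift_gen, ← pow_succ', hn, h.bn]
  · simp [f, Hn.vals, Hn.antipodeLin, Hn.antipodeHom, Hn.lift_gen, ← pow_succ', hn, h.cn]
  · simp [f, Hn.vals, Hn.antipodeLin, Hn.antipodeHom, Hn.lift_gen]

/-- `H_n(p, q)` is a Hopf algebra. -/
instance Hn.instHopfAlgebra : HopfAlgebra K (Hn n p q) where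
  antipode := Hn.antipodeLin n p q
  mul_antipode_rTensor_comul := LinearMap.ext Hn.antipode_left
  mul_antipode_lTensor_comul := LinearMap.ext Hn.antipode_right

end hopf

/-! ### The modules `V(l, r)` -/

section simple

variable {K : Type u} [Field K] (q : K) (l : ℕ) (r : ℤ)

/-- The standard basis vectors `v_0, …, v_{l-1}` of `K ^ l`, with `v_k = 0` for `k ≥ l`. -/
def vec (K : Type u) [Field K] (l k : ℕ) : Fin l → K :=
  if h : k < l then Pi.single ⟨k, h⟩ 1 else 0

/-- `a v_i = v_{i+1}`, where `v_l = 0`. -/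
def opA (K : Type u) [Field K] (l : ℕ) : Module.End K (Fin l → K) :=
  (Pi.basisFun K (Fin l)).constr K fun i => vec K l (i + 1)

/-- `b v_i = q^(r+i) v_i`. -/
def opB : Module.End K (Fin l → K) :=
  (Pi.basisFun K (Fin l)).constr K fun i => q ^ (r + (i : ℕ)) • vec K l i

/-- `c v_i = q^(i+1-r-l) v_i`. -/
def opC : Module.End K (Fin l → K) :=
  (Pi.basisFun K (Fin l)).constr K fun i => q ^ ((i : ℕ) + 1 - r - l : ℤ) • vec K l i

/-- `d v_i = (i)_q (1 - q^(i-l)) v_{i-1}`, which is `0` for `i = 0`. -/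
def opD : Module.End K (Fin l → K) :=
  (Pi.basisFun K (Fin l)).constr K fun i =>
    (qInt q i * (1 - q ^ ((i : ℕ) - l : ℤ))) • vec K l (i - 1)

theorem vec_of_le {k : ℕ} (h : l ≤ k) : vec K l k = 0 := dif_neg (by omega)

theorem vec_coe (i : Fin l) : vec K l i = Pi.single i 1 := by simp [vec]

theorem constr_vec (f : ℕ → Fin l → K) {k : ℕ} (hk : k < l) :
    ((Pi.basisFun K (Fin l)).constr K fun i => f i) (vec K l k) = f k := by
  have := (Pi.basisFun K (Fin l)).constr_basis K (fun i => f i) ⟨k, hk⟩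
  rwa [Pi.basisFun_apply, ← vec_coe] at this

theorem opA_vec (k : ℕ) : opA K l (vec K l k) = vec K l (k + 1) := by
  by_cases hk : k < l
  · exact constr_vec l (fun k => vec K l (k + 1)) hk
  · rw [vec_of_le l (by omega), vec_of_le l (by omega), map_zero]

theorem opB_vec (k : ℕ) : opB q l r (vec K l k) = q ^ (r + k) • vec K l k := by
  by_cases hk : k < l
  · exact constr_vec l (fun k => q ^ (r + k) • vec K l k) hk
  · rw [vec_of_le l (by omega), map_zero, smul_zero]

theorem opC_vec (k : ℕ) : opC q l r (vec K l k) = q ^ (k + 1 - r - l : ℤ) • vec K l k := by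
  by_cases hk : k < l
  · exact constr_vec l (fun k => q ^ (k + 1 - r - l : ℤ) • vec K l k) hk
  · rw [vec_of_le l (by omega), map_zero, smul_zero]

theorem opD_vec {k : ℕ} (hk : k ≤ l) :
    opD q l (vec K l k) = (qInt q k * (1 - q ^ (k - l : ℤ))) • vec K l (k - 1) := by
  rcases hk.lt_or_eq with hk | rfl
  · exact constr_vec l (fun k => (qInt q k * (1 - q ^ (k - l : ℤ))) • vec K l (k - 1)) hk
  · rw [vec_of_le k le_rfl, map_zero]; simp

theorem end_ext {f g : Module.End K (Fin l → K)}
    (h : ∀ k, k < l → f (vec K l k) = g (vec K l k)) : f = g := by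
  refine (Pi.basisFun K (Fin l)).ext fun i => ?_
  rw [Pi.basisFun_apply, ← vec_coe]
  exact h i i.2

theorem opA_pow_vec (m k : ℕ) : (opA K l ^ m) (vec K l k) = vec K l (k + m) := by
  induction m with
  | zero => simp
  | succ m ih => rw [pow_succ', Module.End.mul_apply, ih, opA_vec, add_assoc]

theorem opB_pow_vec (m k : ℕ) :
    (opB q l r ^ m) (vec K l k) = (q ^ (r + k)) ^ m • vec K l k := by
  induction m with
  | zero => simp
  | succ m ih => rw [pow_succ', Module.End.mul_apply, ih, map_smul, opB_vec, smul_smul, pow_succ]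

theorem opC_pow_vec (m k : ℕ) :
    (opC q l r ^ m) (vec K l k) = (q ^ (k + 1 - r - l : ℤ)) ^ m • vec K l k := by
  induction m with
  | zero => simp
  | succ m ih => rw [pow_succ', Module.End.mul_apply, ih, map_smul, opC_vec, smul_smul, pow_succ]

theorem opD_pow_vec (m : ℕ) : ∀ k, k < l → k < m → (opD q l ^ m) (vec K l k) = 0 := by
  induction m with
  | zero => intro k _ h; omega
  | succ m ih =>
    intro k hk hm
    rw [pow_succ, Module.End.mul_apply, opD_vec q l hk.le, map_smul]
    rcases Nat.eq_zero_or_pos k with rfl | h0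
    · simp [qInt]
    · rw [ih (k - 1) (by omega) (by omega), smul_zero]

variable {n : ℕ} {l}

theorem relations_op (hq : IsPrimitiveRoot q n) (hl : l ≤ n) :
    Relations n 1 q (opA K l) (opB q l r) (opC q l r) (opD q l) := by
  by_cases hl0 : l = 0
  · subst hl0
    exact ⟨Subsingleton.elim _ _, Subsingleton.elim _ _, Subsingleton.elim _ _,
      Subsingleton.elim _ _, Subsingleton.elim _ _, Subsingleton.elim _ _,
      Subsingleton.elim _ _, Subsingleton.elim _ _, Subsingleton.elim _ _, Subsingleton.elim _ _⟩
  have hq0 : q ≠ 0 := hq.ne_zero (by omega)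
  have hz : ∀ z : ℤ, (q ^ z) ^ n = 1 := fun z => by
    rw [← zpow_natCast, ← zpow_mul, mul_comm, zpow_mul, zpow_natCast, hq.pow_eq_one, one_zpow]
  refine ⟨?_, ?_, ?_, ?_, ?_, ?_, ?_, ?_, ?_, ?_⟩ <;> refine end_ext l fun k hk => ?_
  · simp only [Module.End.mul_apply, LinearMap.smul_apply, opA_vec, opB_vec, map_smul, smul_smul]
    congr 1
    rw [← zpow_one_add₀ hq0]; congr 1; push_cast; ring
  · simp only [Module.End.mul_apply, LinearMap.smul_apply, opB_vec, opD_vec q l hk.le, map_smul,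
      smul_smul]
    rcases Nat.eq_zero_or_pos k with rfl | h0
    · simp [qInt]
    · congr 1
      have : q ^ (r + k) = q * q ^ (r + ((k - 1 : ℕ) : ℤ)) := by
        rw [← zpow_one_add₀ hq0]; congr 1; push_cast [h0]; ring
      rw [this]; ring
  · simp only [Module.End.mul_apply, LinearMap.smul_apply, opA_vec, opC_vec, map_smul, smul_smul]
    congr 1
    rw [← zpow_one_add₀ hq0]; congr 1; push_cast; ring
  · simp only [Module.End.mul_apply, LinearMap.smul_apply, opC_vec, opD_vec q l hk.le, map_smul,
      smul_smul]
    rcases Nat.eq_zero_or_pos k with rfl | h0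
    · simp [qInt]
    · congr 1
      have : q ^ (k + 1 - r - l : ℤ) = q * q ^ (((k - 1 : ℕ) : ℤ) + 1 - r - l) := by
        rw [← zpow_one_add₀ hq0]; congr 1; push_cast [h0]; ring
      rw [this]; ring
  · simp only [Module.End.mul_apply, opB_vec, opC_vec, map_smul, smul_smul, mul_comm]
  · rw [opA_pow_vec, vec_of_le l (by omega)]; rfl
  · rw [opB_pow_vec, hz, one_smul]; rfl
  · rw [opC_pow_vec, hz, one_smul]; rfl
  · rw [opD_pow_vec q l n k hk (by omega)]; rfl
  · simp only [Module.End.mul_apply, LinearMap.smul_apply, LinearMap.sub_apply, opA_vec, opB_vec,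
      opC_vec, opD_vec q l hk.le, opD_vec q l (show k + 1 ≤ l by omega), map_smul,
      Module.End.one_apply, smul_smul, one_smul, Nat.add_sub_cancel]
    have e : (qInt q k * (1 - q ^ (k - l : ℤ))) • vec K l (k - 1 + 1) =
        (qInt q k * (1 - q ^ (k - l : ℤ))) • vec K l k := by
      rcases Nat.eq_zero_or_pos k with rfl | h0
      · simp [qInt]
      · rw [Nat.sub_add_cancel h0]
    rw [mul_smul q, e, smul_smul, ← sub_smul]
    nth_rewrite 2 [← one_smul K (vec K l k)]
    rw [← sub_smul]
    congr 1
    have e₁ : qInt q (k + 1) = 1 + q * qInt q k := by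
      rw [add_comm k 1, qInt_add]; simp [qInt]
    have e₂ : qInt q (k + 1) = qInt q k + q ^ k := by
      rw [qInt_add]; simp [qInt]
    have e₃ : q ^ (((k + 1 : ℕ) : ℤ) - l) = q * q ^ (k - l : ℤ) := by
      rw [← zpow_one_add₀ hq0]; congr 1; push_cast; ring
    have e₄ : q ^ (k + 1 - r - l : ℤ) * q ^ (r + k) = q * q ^ (k - l : ℤ) * q ^ k := by
      rw [← zpow_natCast q k, ← zpow_add₀ hq0, ← zpow_one_add₀ hq0, ← zpow_add₀ hq0]
      congr 1; ring
    rw [e₃, e₄]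
    linear_combination e₁ - q * q ^ (k - l : ℤ) * e₂

end simple

/-- The module `V(l, r)` over `H_n(1, q)`, for `l ≤ n`: it has a basis `v_0, …, v_{l-1}` with
`a v_i = v_{i+1}`, `b v_i = q^(r+i) v_i`, `c v_i = q^(i+1-r-l) v_i` and
`d v_i = (i)_q (1 - q^(i-l)) v_{i-1}`, where `v_l = 0`. It depends on `r` only modulo `n`. -/
def V {K : Type u} [Field K] {n : ℕ} {q : K} [hq : Fact (IsPrimitiveRoot q n)] (l : ℕ)
    (hl : l ≤ n) (r : ℤ) : Green.FDMod K (Hn n 1 q) where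
  carrier := Fin l → K
  ρ := Hn.lift (relations_op q r hq.out hl)

/-! ### The ideal of relations -/

/-- `n / (n - i) * C(n - i, i)`, an integer for `2 * i ≤ n` and `0 < n`. -/
def lucasCoeff (n i : ℕ) : ℕ := n * (n - i).choose i / (n - i)

/-- The division in `lucasCoeff` is exact. -/
theorem sub_mul_lucasCoeff {n i : ℕ} (hn : 0 < n) (h : 2 * i ≤ n) :
    (n - i) * lucasCoeff n i = n * (n - i).choose i := by
  refine Nat.mul_div_cancel' ?_
  rcases Nat.eq_zero_or_pos i with rfl | hi
  · simp
  · obtain ⟨j, rfl⟩ : ∃ j, i = j + 1 := ⟨i - 1, by omega⟩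
    obtain ⟨m, hm⟩ : ∃ m, n - (j + 1) = m + 1 := ⟨n - (j + 1) - 1, by omega⟩
    have hn' : n = (m + 1) + (j + 1) := by omega
    rw [hm]
    refine ⟨(m + 1).choose (j + 1) + m.choose j, ?_⟩
    have := Nat.add_one_mul_choose_eq m j
    rw [hn', mul_add (m + 1), this]
    ring

open MvPolynomial in
/-- The ideal `I` of `ℤ[x, y]`, with `x = X 0` and `y = X 1`. -/
def relIdeal (n : ℕ) : Ideal (MvPolynomial (Fin 2) ℤ) :=
  Ideal.span
    {X 0 ^ n - 1,
      (∑ i ∈ Finset.range (n / 2 + 1),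
          (-1) ^ i * (lucasCoeff n i : MvPolynomial (Fin 2) ℤ) * X 0 ^ i * X 1 ^ (n - 2 * i) - 2) *
        ∑ i ∈ Finset.range ((n - 1) / 2 + 1),
          (-1) ^ i * ((n - 1 - i).choose i : MvPolynomial (Fin 2) ℤ) * X 0 ^ i *
            X 1 ^ (n - 1 - 2 * i)}

end Taft
end

/-!
A finite dimensional projective module over `H = H_n(1, q)` is determined by the dimensions of its
spaces of homomorphisms to the simple modules `V(l, r)`. Tensoring with `V(2, 0)` is left adjoint to
tensoring with `V(2, -1)`, and for `l < n` the module `V(2, 0) ⊗ V(l, r)` splits as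
`V(l + 1, r) ⊕ V(l - 1, r + 1)`. Write `x = [V(1, 1)]` and `y = [V(2, 0)]`. The splitting is the
recursion of a Lucas sequence, so `[V(l, k)] = x ^ k * U_l(x, y)`. By adjunction, tensoring the
projective module `V(n, k)` with `V(2, 0)` over and over produces the projective covers
`P(n - j, j + k)`, whose classes satisfy the same recursion and are
`x ^ k * V_j(x, y) * U_n(x, y)`, where `V_j` is the companion sequence `2, y, …`. At `j = n` the
recursion arrives at twice `[V(n, n)] = U_n(x, y)`, which is the relation `(V_n - 2) * U_n = 0`.

Conversely, the relations leave `n * (2 * n - 1)` monomials `x ^ i * y ^ j` that span the presented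
ring, and the Green ring contains as many independent elements in their span: the classes of the
`n * (n - 1)` simple modules that are not projective and of the `n ^ 2` projective covers. They
are independent because the dimension of the space of homomorphisms to `V(l, r)` that factor through
its cover vanishes on the former, and counts the cover of `V(l, r)` among the latter.
-/

noncomputable section

/-! ### Homomorphisms of finite dimensional modules -/

namespace Green.FDMod

variable {K : Type u} {H : Type v} [Field K] [Ring H] [Algebra K H]

theorem smul_eq (M : FDMod K H) (h : H) (m : M.carrier) : h • m = M.ρ h m := rfl

instance (M : FDMod K H) : IsScalarTower K H M.carrier :=
  ⟨fun k h m => by simp [smul_eq]⟩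

instance (M : FDMod K H) : SMulCommClass H K M.carrier :=
  ⟨fun h k m => by simp [smul_eq]⟩

instance (M : FDMod K H) : IsNoetherian H M.carrier := isNoetherian_of_tower K inferInstance

instance (M : FDMod K H) : IsArtinian H M.carrier := isArtinian_of_tower K inferInstance

instance (M : FDMod K H) (N : Submodule H M.carrier) : Module.Finite K N :=
  inferInstanceAs (Module.Finite K (N.restrictScalars K))

instance (M : FDMod K H) (N : Submodule H M.carrier) : Module.Finite K (M.carrier ⧸ N) :=
  Module.Finite.of_surjective (N.mkQ.restrictScalars K) N.mkQ_surjective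

instance (M N : FDMod K H) : Module.Finite K (M.carrier →ₗ[H] N.carrier) :=
  Module.Finite.of_injective (LinearMap.restrictScalarsₗ K H M.carrier N.carrier K)
    (LinearMap.restrictScalars_injective K)

theorem iso_iff {M N : FDMod K H} : Iso M N ↔ Nonempty (M.carrier ≃ₗ[H] N.carrier) :=
  ⟨fun ⟨e, he⟩ => ⟨{ e with map_smul' := he }⟩,
    fun ⟨e⟩ => ⟨e.restrictScalars K, fun h m => e.map_smul h m⟩⟩

section of

variable (K H) (X : Type u) [AddCommGroup X] [Module K X] [Module H X] [IsScalarTower K H X]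
  [Module.Finite K X]

/-- A finite dimensional `H`-module, bundled. -/
def of : FDMod K H where
  carrier := X
  ρ := Algebra.lsmul K K X

/-- The identity map from the bundled module `of K H X` to `X`. Its `H`-linearity bridges the
two `H`-actions, which agree only after unfolding `of`. -/
def ofEquiv : (of K H X).carrier ≃ₗ[H] X :=
  { LinearEquiv.refl K X with map_smul' := fun _ _ => rfl }

end of

/-- The inclusion of a submodule, regarded as a bundled module. -/
def incl {M : FDMod K H} (N : Submodule H M.carrier) : (of K H N).carrier →ₗ[H] M.carrier :=
  N.subtype ∘ₗ (ofEquiv K H N).toLinearMap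

theorem incl_injective {M : FDMod K H} (N : Submodule H M.carrier) :
    Function.Injective (incl N) :=
  Subtype.val_injective.comp (ofEquiv K H N).injective

theorem range_incl {M : FDMod K H} (N : Submodule H M.carrier) :
    LinearMap.range (incl N) = N := by
  rw [incl, LinearMap.range_comp_of_range_eq_top _ (ofEquiv K H N).range, N.range_subtype]

/-- The cokernel of a map of modules. -/
abbrev coker {M N : FDMod K H} (f : M.carrier →ₗ[H] N.carrier) : FDMod K H :=
  of K H (N.carrier ⧸ LinearMap.range f)

/-- The projection to the cokernel. -/
def toCoker {M N : FDMod K H} (f : M.carrier →ₗ[H] N.carrier) :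
    N.carrier →ₗ[H] (coker f).carrier :=
  (ofEquiv K H _).symm.toLinearMap ∘ₗ (LinearMap.range f).mkQ

theorem toCoker_surjective {M N : FDMod K H} (f : M.carrier →ₗ[H] N.carrier) :
    Function.Surjective (toCoker f) :=
  (ofEquiv K H _).symm.surjective.comp (LinearMap.range f).mkQ_surjective

theorem exact_toCoker {M N : FDMod K H} (f : M.carrier →ₗ[H] N.carrier) :
    Function.Exact f (toCoker f) := by
  rw [LinearMap.exact_iff, toCoker, LinearEquiv.ker_comp, Submodule.ker_mkQ]

/-- The direct sum of bundled modules is the product of the underlying `H`-modules. -/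
def sumEquiv (M N : FDMod K H) : (sum M N).carrier ≃ₗ[H] M.carrier × N.carrier :=
  { LinearEquiv.refl K (M.carrier × N.carrier) with map_smul' := fun _ _ => rfl }

/-- The `K`-dimension of a module. -/
def dim (M : FDMod K H) : ℕ := Module.finrank K M.carrier

theorem dim_eq_zero_iff {M : FDMod K H} : M.dim = 0 ↔ Subsingleton M.carrier :=
  Module.finrank_zero_iff

theorem dim_sum (M N : FDMod K H) : (sum M N).dim = M.dim + N.dim :=
  Module.finrank_prod

theorem dim_congr {M N : FDMod K H} (e : M.carrier ≃ₗ[H] N.carrier) : M.dim = N.dim :=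
  (e.restrictScalars K).finrank_eq

theorem bijective_of_injective {M N : FDMod K H} {f : M.carrier →ₗ[H] N.carrier}
    (hf : Function.Injective f) (h : M.dim = N.dim) : Function.Bijective f :=
  ⟨hf, (LinearMap.injective_iff_surjective_of_finrank_eq_finrank (f := f.restrictScalars K) h).1 hf⟩

theorem dim_coker_add_dim_range {M N : FDMod K H} (f : M.carrier →ₗ[H] N.carrier) :
    (coker f).dim + Module.finrank K (LinearMap.range (f.restrictScalars K)) = N.dim :=
  Submodule.finrank_quotient_add_finrank (LinearMap.range (f.restrictScalars K))

theorem dim_le_add_dim_coker {M N : FDMod K H} (f : M.carrier →ₗ[H] N.carrier) :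
    N.dim ≤ M.dim + (coker f).dim := by
  rw [← dim_coker_add_dim_range f, add_comm]
  exact Nat.add_le_add_right (LinearMap.finrank_range_le (f.restrictScalars K)) _

theorem injective_of_dim_eq {M N : FDMod K H} {f : M.carrier →ₗ[H] N.carrier}
    (h : N.dim = M.dim + (coker f).dim) : Function.Injective f := by
  have hrank : _ = M.dim := LinearMap.finrank_range_add_finrank_ker (f.restrictScalars K)
  rw [← dim_coker_add_dim_range f] at h
  have hinj : Function.Injective (f.restrictScalars K) :=
    LinearMap.ker_eq_bot.1 (Submodule.finrank_eq_zero.1 (by omega))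
  exact hinj

/-- The dimension of the space of `H`-linear maps `M → N`. -/
def homDim (M N : FDMod K H) : ℕ := Module.finrank K (M.carrier →ₗ[H] N.carrier)

theorem homDim_eq_zero_iff {M N : FDMod K H} :
    homDim M N = 0 ↔ ∀ f : M.carrier →ₗ[H] N.carrier, f = 0 :=
  Module.finrank_zero_iff.trans (subsingleton_iff_forall_eq 0)

theorem homDim_eq_zero_of_dim_left {M N : FDMod K H} (h : M.dim = 0) : homDim M N = 0 :=
  have := dim_eq_zero_iff.1 h
  homDim_eq_zero_iff.2 fun _ => Subsingleton.elim _ _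

theorem homDim_eq_zero_of_dim_right {M N : FDMod K H} (h : N.dim = 0) : homDim M N = 0 :=
  have := dim_eq_zero_iff.1 h
  homDim_eq_zero_iff.2 fun _ => Subsingleton.elim _ _

theorem homDim_congr_left {M M' : FDMod K H} (e : M.carrier ≃ₗ[H] M'.carrier) (N : FDMod K H) :
    homDim M N = homDim M' N :=
  (e.congrLeft N.carrier K).finrank_eq

theorem homDim_congr_right (M : FDMod K H) {N N' : FDMod K H} (e : N.carrier ≃ₗ[H] N'.carrier) :
    homDim M N = homDim M N' :=
  (LinearEquiv.ofLinearMap (LinearMap.compRight K e.toLinearMap)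
    (LinearMap.compRight K e.symm.toLinearMap) (by ext; simp) (by ext; simp)).finrank_eq

theorem homDim_sum_left (M N P : FDMod K H) :
    homDim (sum M N) P = homDim M P + homDim N P := by
  rw [homDim, ((sumEquiv M N).congrLeft P.carrier K).finrank_eq,
    ← (LinearMap.coprodEquiv K).finrank_eq, Module.finrank_prod]
  rfl

theorem homDim_sum_right (M N P : FDMod K H) :
    homDim P (sum M N) = homDim P M + homDim P N := by
  let e : (P.carrier →ₗ[H] (sum M N).carrier) ≃ₗ[K]
      (P.carrier →ₗ[H] M.carrier) × (P.carrier →ₗ[H] N.carrier) :=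
    LinearEquiv.ofLinearMap
      ((LinearMap.compRight K (LinearMap.fst H _ _ ∘ₗ (sumEquiv M N).toLinearMap)).prod
        (LinearMap.compRight K (LinearMap.snd H _ _ ∘ₗ (sumEquiv M N).toLinearMap)))
      (LinearMap.compRight K (sumEquiv M N).symm.toLinearMap ∘ₗ
        (LinearMap.prodEquiv K).toLinearMap)
      (by ext <;> rfl) (by ext; rfl)
  exact e.finrank_eq.trans Module.finrank_prod

theorem exists_equiv_sum_of_dim {A B M : FDMod K H} [IsSimpleModule H A.carrier]
    {f : A.carrier →ₗ[H] M.carrier} (hf : Function.Injective f) {g : B.carrier →ₗ[H] M.carrier}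
    (hg : Function.Injective g) (hlt : B.dim < A.dim) (h : A.dim + B.dim = M.dim) :
    Nonempty (M.carrier ≃ₗ[H] (sum A B).carrier) := by
  have hbot : (LinearMap.range g).comap f = ⊥ := by
    refine (eq_bot_or_eq_top _).resolve_right fun htop => ?_
    have hle : LinearMap.range (f.restrictScalars K) ≤ LinearMap.range (g.restrictScalars K) := by
      rintro _ ⟨x, rfl⟩
      exact (htop ▸ Submodule.mem_top : x ∈ (LinearMap.range g).comap f)
    have := Submodule.finrank_mono hle
    rw [LinearMap.finrank_range_of_inj (f := f.restrictScalars K) hf,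
      LinearMap.finrank_range_of_inj (f := g.restrictScalars K) hg] at this
    exact absurd this (not_le.2 hlt)
  have hinj : Function.Injective (f.coprod g) := by
    refine LinearMap.ker_eq_bot.1 ((LinearMap.ker_coprod_of_disjoint_range f g ?_).trans ?_)
    · rw [disjoint_iff, ← Submodule.map_comap_eq, hbot, Submodule.map_bot]
    · rw [LinearMap.ker_eq_bot.2 hf, LinearMap.ker_eq_bot.2 hg, Submodule.prod_bot]
  exact ⟨(LinearEquiv.ofBijective (f.coprod g ∘ₗ (sumEquiv A B).toLinearMap)
    (bijective_of_injective (hinj.comp (sumEquiv A B).injective) ((dim_sum A B).trans h))).symm⟩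

theorem exists_simple_quotient {M : FDMod K H} (h : M.dim ≠ 0) :
    ∃ (S : FDMod K H) (f : M.carrier →ₗ[H] S.carrier), IsSimpleModule H S.carrier ∧ f ≠ 0 := by
  have : Nontrivial M.carrier := not_subsingleton_iff_nontrivial.1 (mt dim_eq_zero_iff.2 h)
  obtain ⟨N, hN⟩ := IsCoatomic.exists_coatom (Submodule H M.carrier)
  have : IsSimpleModule H (M.carrier ⧸ N) := isSimpleModule_iff_isCoatom.2 hN
  let e := ofEquiv K H (M.carrier ⧸ N)
  refine ⟨_, e.symm.toLinearMap ∘ₗ N.mkQ, IsSimpleModule.congr e, fun h0 => hN.1 ?_⟩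
  rw [← N.ker_mkQ, ← LinearEquiv.ker_comp e.symm, h0, LinearMap.ker_zero]

/-! ### Projective covers -/

/-- Projectivity relative to finite dimensional modules: `P` lifts along surjections of finite
dimensional modules. -/
def IsFDProjective (P : FDMod K H) : Prop :=
  ∀ (N N' : FDMod K H) (g : N.carrier →ₗ[H] N'.carrier) (f : P.carrier →ₗ[H] N'.carrier),
    Function.Surjective g → ∃ f' : P.carrier →ₗ[H] N.carrier, g ∘ₗ f' = f

theorem isFDProjective_of_projective {P : FDMod K H} [Module.Projective H P.carrier] :
    IsFDProjective P :=
  fun _ _ g f hg => Module.projective_lifting_property g f hg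

namespace IsFDProjective

variable {P Q : FDMod K H}

theorem of_retract (hP : IsFDProjective P) (i : Q.carrier →ₗ[H] P.carrier)
    (p : P.carrier →ₗ[H] Q.carrier) (h : p ∘ₗ i = LinearMap.id) : IsFDProjective Q := by
  intro N N' g f hg
  obtain ⟨f', hf'⟩ := hP N N' g (f ∘ₗ p) hg
  refine ⟨f' ∘ₗ i, ?_⟩
  rw [← LinearMap.comp_assoc, hf', LinearMap.comp_assoc, h, LinearMap.comp_id]

theorem of_equiv (hP : IsFDProjective P) (e : P.carrier ≃ₗ[H] Q.carrier) : IsFDProjective Q :=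
  hP.of_retract e.symm.toLinearMap e.toLinearMap (by ext; simp)

theorem sum (hP : IsFDProjective P) (hQ : IsFDProjective Q) : IsFDProjective (P.sum Q) := by
  intro N N' g f hg
  obtain ⟨f', hf'⟩ := hP N N' g (f ∘ₗ (sumEquiv P Q).symm.toLinearMap ∘ₗ LinearMap.inl H _ _) hg
  obtain ⟨f'', hf''⟩ :=
    hQ N N' g (f ∘ₗ (sumEquiv P Q).symm.toLinearMap ∘ₗ LinearMap.inr H _ _) hg
  refine ⟨f'.coprod f'' ∘ₗ (sumEquiv P Q).toLinearMap, ?_⟩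
  rw [← LinearMap.comp_assoc, LinearMap.comp_coprod, hf', hf'']
  refine LinearMap.ext fun x => ?_
  simp [← map_add]

theorem left_of_sum (h : IsFDProjective (P.sum Q)) : IsFDProjective P :=
  h.of_retract ((sumEquiv P Q).symm.toLinearMap ∘ₗ LinearMap.inl H _ _)
    (LinearMap.fst H _ _ ∘ₗ (sumEquiv P Q).toLinearMap) rfl

theorem right_of_sum (h : IsFDProjective (P.sum Q)) : IsFDProjective Q :=
  h.of_retract ((sumEquiv P Q).symm.toLinearMap ∘ₗ LinearMap.inr H _ _)
    (LinearMap.snd H _ _ ∘ₗ (sumEquiv P Q).toLinearMap) rfl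

theorem homDim_eq_add (hP : IsFDProjective P) {A M N : FDMod K H} {i : A.carrier →ₗ[H] M.carrier}
    (hi : Function.Injective i) {g : M.carrier →ₗ[H] N.carrier} (hg : Function.Surjective g)
    (h : Function.Exact i g) : homDim P M = homDim P A + homDim P N := by
  let i' := LinearMap.compRight K (M := P.carrier) i
  let g' := LinearMap.compRight K (M := P.carrier) g
  have hi' : Function.Injective i' := fun f f' hff =>
    LinearMap.ext fun x => hi (LinearMap.congr_fun hff x)
  have hexact : LinearMap.ker g' = LinearMap.range i' := by
    refine LinearMap.exact_iff.1 fun f => ⟨fun hf => ?_, ?_⟩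
    · have hx (x) : f x ∈ LinearMap.range i := (h (f x)).1 (LinearMap.congr_fun hf x)
      exact ⟨(LinearEquiv.ofInjective i hi).symm.toLinearMap ∘ₗ f.codRestrict _ hx,
        LinearMap.ext fun x =>
          congrArg Subtype.val ((LinearEquiv.ofInjective i hi).apply_symm_apply ⟨f x, hx x⟩)⟩
    · rintro ⟨f, rfl⟩
      exact LinearMap.ext fun x => h.apply_apply_eq_zero (f x)
  have hrank := LinearMap.finrank_range_add_finrank_ker g'
  rw [LinearMap.range_eq_top.2 fun f => hP M N g f hg, finrank_top, hexact,
    LinearMap.finrank_range_of_inj hi'] at hrank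
  exact hrank.symm.trans (add_comm _ _)

theorem homDim_eq_add_coker (hP : IsFDProjective P) {A M : FDMod K H}
    {f : A.carrier →ₗ[H] M.carrier} (h : M.dim = A.dim + (coker f).dim) :
    homDim P M = homDim P A + homDim P (coker f) :=
  hP.homDim_eq_add (injective_of_dim_eq h) (toCoker_surjective f) (exact_toCoker f)

/-- By Fitting's lemma, a high power of an endomorphism projects onto its image. -/
theorem exists_range_pow (hP : IsFDProjective P) (g : Module.End H P.carrier) :
    ∃ k, IsFDProjective (of K H (LinearMap.range (g ^ (k + 1)))) := by
  obtain ⟨k, hk⟩ := Filter.eventually_atTop.1 (LinearMap.eventually_isCompl_ker_pow_range_pow g)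
  have hcompl := (hk (k + 1) k.le_succ).symm
  exact ⟨k, hP.of_retract (incl _)
    ((ofEquiv K H _).symm.toLinearMap ∘ₗ Submodule.projectionOnto _ _ hcompl)
    (LinearMap.ext fun x => Submodule.projectionOnto_apply_left hcompl x)⟩

end IsFDProjective

/-- `π : Q → S` is a projective cover of the simple module `S`: the module `Q` is projective and
its proper submodules lie in the kernel of `π`. -/
structure IsCover {Q S : FDMod K H} (π : Q.carrier →ₗ[H] S.carrier) : Prop where
  projective : IsFDProjective Q
  surjective : Function.Surjective π
  eq_top : ∀ N : Submodule H Q.carrier, ¬ N ≤ LinearMap.ker π → N = ⊤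

/-- The cover is found as a projective module of least dimension with a nonzero map to `S`. -/
theorem exists_isCover {P S : FDMod K H} (hP : IsFDProjective P) [IsSimpleModule H S.carrier]
    {f : P.carrier →ₗ[H] S.carrier} (hf : f ≠ 0) :
    ∃ (Q : FDMod K H) (π : Q.carrier →ₗ[H] S.carrier), IsCover π := by
  obtain ⟨⟨Q, π⟩, ⟨hQ, hπ⟩, hmin⟩ := exists_minimalFor_of_wellFoundedLT
    (fun x : Σ Q : FDMod K H, Q.carrier →ₗ[H] S.carrier => IsFDProjective x.1 ∧ x.2 ≠ 0)
    (fun x => x.1.dim) ⟨⟨P, f⟩, hP, hf⟩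
  refine ⟨Q, π, hQ, LinearMap.surjective_of_ne_zero hπ, fun N hN => ?_⟩
  have hN' : Function.Surjective (π ∘ₗ incl N) :=
    LinearMap.surjective_of_ne_zero fun h => hN fun x hx => LinearMap.congr_fun h ⟨x, hx⟩
  obtain ⟨g₀, hg₀⟩ := hQ (of K H N) S _ π hN'
  let g : Module.End H Q.carrier := incl N ∘ₗ g₀
  have hg (k : ℕ) : π ∘ₗ g ^ k = π := by
    induction k with
    | zero => rfl
    | succ k ih => rw [pow_succ', Module.End.mul_eq_comp, ← LinearMap.comp_assoc,
        ← LinearMap.comp_assoc, hg₀, ih]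
  obtain ⟨k, hk⟩ := hQ.exists_range_pow g
  set R := LinearMap.range (g ^ (k + 1))
  have hR : π ∘ₗ incl R ≠ 0 := fun h => hπ <| by
    rw [← hg (k + 1)]
    exact LinearMap.ext fun x => LinearMap.congr_fun h ⟨_, LinearMap.mem_range_self _ x⟩
  have hdim : (of K H R).dim = Q.dim :=
    le_antisymm (Submodule.finrank_le (R.restrictScalars K)) (not_lt.1 fun hlt =>
      hlt.not_ge (hmin (j := ⟨of K H R, π ∘ₗ incl R⟩) ⟨hk, hR⟩ hlt.le))
  have hRN : R ≤ N := by
    rintro _ ⟨x, rfl⟩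
    rw [pow_succ']
    exact (ofEquiv K H N (g₀ ((g ^ k) x))).2
  refine top_unique (le_trans (fun x _ => ?_) hRN)
  have htop : R.restrictScalars K = ⊤ := Submodule.eq_top_of_finrank_eq hdim
  exact (htop ▸ Submodule.mem_top : x ∈ R.restrictScalars K)

namespace IsCover

variable {Q S T : FDMod K H} {π : Q.carrier →ₗ[H] S.carrier}

theorem ker_le_ker (hπ : IsCover π) [IsSimpleModule H S.carrier] [IsSimpleModule H T.carrier]
    (f : Q.carrier →ₗ[H] T.carrier) : LinearMap.ker π ≤ LinearMap.ker f := by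
  by_cases hf : f = 0
  · simp [hf]
  have hle : LinearMap.ker f ≤ LinearMap.ker π :=
    not_not.1 fun h => hf (LinearMap.ker_eq_top.1 (hπ.eq_top _ h))
  have hcoatom : IsCoatom (LinearMap.ker f) :=
    LinearMap.isCoatom_ker_of_surjective (LinearMap.surjective_of_ne_zero hf)
  exact (hcoatom.le_iff_eq
    (LinearMap.isCoatom_ker_of_surjective hπ.surjective).1).1 hle |>.le

theorem homDim_eq (hπ : IsCover π) [IsSimpleModule H S.carrier] [IsSimpleModule H T.carrier] :
    homDim Q T = homDim S T := by
  refine (LinearEquiv.ofBijective (LinearMap.lcomp K T.carrier π)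
    ⟨fun f g hfg => ?_, fun f => ?_⟩).finrank_eq.symm
  · exact (LinearMap.cancel_right hπ.surjective).1 hfg
  · let e := LinearMap.quotKerEquivOfSurjective π hπ.surjective
    refine ⟨(LinearMap.ker π).liftQ f (hπ.ker_le_ker f) ∘ₗ e.symm.toLinearMap,
      LinearMap.ext fun x => ?_⟩
    have he : e.symm (π x) = Submodule.Quotient.mk x := e.symm_apply_eq.2 rfl
    simp [he]

theorem surjective_of_comp_ne_zero (hπ : IsCover π) {M : FDMod K H}
    {f : M.carrier →ₗ[H] Q.carrier} (hf : π ∘ₗ f ≠ 0) : Function.Surjective f :=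
  LinearMap.range_eq_top.1 (hπ.eq_top _ fun h =>
    hf (LinearMap.ext fun x => h (LinearMap.mem_range_self f x)))

theorem dim_pos (hπ : IsCover π) [IsSimpleModule H S.carrier] : 0 < Q.dim :=
  Nat.pos_of_ne_zero fun h =>
    have := dim_eq_zero_iff.1 h
    have := IsSimpleModule.nontrivial H S.carrier
    not_subsingleton S.carrier hπ.surjective.subsingleton

theorem exists_equiv_sum {P : FDMod K H} (hπ : IsCover π) [IsSimpleModule H S.carrier]
    (hP : IsFDProjective P) {f : P.carrier →ₗ[H] S.carrier} (hf : f ≠ 0) :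
    ∃ P' : FDMod K H, IsFDProjective P' ∧ Nonempty (P.carrier ≃ₗ[H] (sum P' Q).carrier) := by
  obtain ⟨g, hg⟩ := hP Q S π f hπ.surjective
  obtain ⟨s, hs⟩ := hπ.projective P Q g LinearMap.id
    (hπ.surjective_of_comp_ne_zero (hg ▸ hf))
  have hexact : Function.Exact (incl (LinearMap.ker g)) g :=
    LinearMap.exact_iff.2 (range_incl _).symm
  let e := (hexact.splitSurjectiveEquiv (incl_injective _) ⟨s, hs⟩).1 ≪≫ₗ
    (sumEquiv (of K H (LinearMap.ker g)) Q).symm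
  exact ⟨_, (hP.of_equiv e).left_of_sum, ⟨e⟩⟩

end IsCover

end Green.FDMod

/-! ### Independent classes in the Green ring -/

namespace Green

open FDMod

variable {K : Type u} {H : Type v} [Field K] [Ring H] [Bialgebra K H]

theorem cls_congr {M N : FDMod K H} (e : M.carrier ≃ₗ[H] N.carrier) : cls M = cls N :=
  congrArg (Completion.of (S := IsoClass K H)) (Quotient.sound (iso_iff.2 ⟨e⟩))

theorem dim_zero : (FDMod.zero K H).dim = 0 :=
  dim_eq_zero_iff.2 (inferInstanceAs (Subsingleton PUnit))

theorem cls_zero : cls (FDMod.zero K H) = 0 :=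
  (Completion.of (S := IsoClass K H)).map_zero

theorem cls_one : cls (FDMod.unit K H) = 1 := rfl

theorem cls_eq_zero {M : FDMod K H} (h : M.dim = 0) : cls M = 0 := by
  have := dim_eq_zero_iff.1 h
  have := dim_eq_zero_iff.1 (dim_zero (K := K) (H := H))
  rw [← cls_zero]
  exact cls_congr 0

/-- The additive map `[M] ↦ dim Hom(M, N)`. -/
def homDimHom (N : FDMod K H) : GreenRing K H →+ ℤ :=
  Completion.lift (S := IsoClass K H)
    { toFun := Quotient.lift (fun M => (homDim M N : ℤ)) fun M M' h => by
        obtain ⟨e⟩ := iso_iff.1 (show Iso M M' from h)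
        exact congrArg _ (homDim_congr_left e N)
      map_zero' := congrArg (Nat.cast (R := ℤ)) (homDim_eq_zero_of_dim_left dim_zero)
      map_add' := by
        rintro ⟨M⟩ ⟨M'⟩
        exact (congrArg (Nat.cast (R := ℤ)) (homDim_sum_left M M' N)).trans (Nat.cast_add _ _) }

@[simp] theorem homDimHom_cls (M N : FDMod K H) : homDimHom N (cls M) = homDim M N :=
  Completion.lift_of (S := IsoClass K H) _ _

/-- The additive map that sends `[M]` to the dimension of the space of maps `M → S` that factor
through `π : Q → S`. -/
def factorHom {Q S : FDMod K H} (π : Q.carrier →ₗ[H] S.carrier) : GreenRing K H →+ ℤ :=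
  homDimHom Q - homDimHom (of K H (LinearMap.ker π))

theorem factorHom_cls (M : FDMod K H) {Q S : FDMod K H} (π : Q.carrier →ₗ[H] S.carrier) :
    factorHom π (cls M) = homDim M Q - homDim M (of K H (LinearMap.ker π)) := by
  simp [factorHom]

theorem factorHom_of_projective {Q S P : FDMod K H} {π : Q.carrier →ₗ[H] S.carrier}
    (hπ : Function.Surjective π) (hP : IsFDProjective P) :
    factorHom π (cls P) = homDim P S := by
  have hexact : Function.Exact (incl (LinearMap.ker π)) π :=
    LinearMap.exact_iff.2 (range_incl _).symm
  rw [factorHom_cls, hP.homDim_eq_add (incl_injective _) hπ hexact]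
  push_cast
  ring

theorem factorHom_eq_zero {Q S M : FDMod K H} {π : Q.carrier →ₗ[H] S.carrier}
    (h : ∀ f : M.carrier →ₗ[H] Q.carrier, π ∘ₗ f = 0) : factorHom π (cls M) = 0 := by
  rw [factorHom_cls, sub_eq_zero, Nat.cast_inj]
  refine (LinearEquiv.ofBijective (LinearMap.compRight K (incl (LinearMap.ker π)))
    ⟨fun f g hfg => ?_, fun f => ?_⟩).finrank_eq.symm
  · exact (LinearMap.cancel_left (incl_injective _)).1 hfg
  · exact ⟨(ofEquiv K H _).symm.toLinearMap ∘ₗ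
      f.codRestrict (LinearMap.ker π) fun x => LinearMap.congr_fun (h f) x, rfl⟩

theorem FDMod.IsCover.factorHom_eq_zero {Q S T : FDMod K H} {π : Q.carrier →ₗ[H] S.carrier}
    (hπ : IsCover π) [IsSimpleModule H T.carrier] (hT : ¬ IsFDProjective T) :
    factorHom π (cls T) = 0 := by
  refine Green.factorHom_eq_zero fun f => ?_
  by_contra hne
  have hf : f ≠ 0 := fun h => hne (by rw [h, LinearMap.comp_zero])
  have hbij : Function.Bijective f :=
    ⟨(LinearMap.injective_or_eq_zero f).resolve_right hf, hπ.surjective_of_comp_ne_zero hne⟩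
  exact hT (hπ.projective.of_equiv (LinearEquiv.ofBijective f hbij).symm)

section simples

variable {ι : Type*} {S Q : ι → FDMod K H} [∀ i, IsSimpleModule H (S i).carrier]
  {π : ∀ i, (Q i).carrier →ₗ[H] (S i).carrier}

theorem exists_equiv_sum_cover
    (hall : ∀ M : FDMod K H, IsSimpleModule H M.carrier →
      ∃ i, Nonempty (M.carrier ≃ₗ[H] (S i).carrier))
    (hπ : ∀ i, IsCover (π i)) {P : FDMod K H} (hP : IsFDProjective P) (h0 : P.dim ≠ 0) :
    ∃ (i : ι) (P' : FDMod K H), IsFDProjective P' ∧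
      Nonempty (P.carrier ≃ₗ[H] (P'.sum (Q i)).carrier) := by
  obtain ⟨T, f, hT, hf⟩ := exists_simple_quotient h0
  obtain ⟨i, ⟨e⟩⟩ := hall T hT
  refine ⟨i, (hπ i).exists_equiv_sum hP (f := e.toLinearMap ∘ₗ f) fun h => hf ?_⟩
  rw [← LinearMap.ker_eq_top, ← LinearEquiv.ker_comp e, h, LinearMap.ker_zero]

variable [DecidableEq ι]
  (hδ : ∀ i j, homDim (S i) (S j) = if i = j then 1 else 0) (hπ : ∀ i, IsCover (π i))

include hδ hπ

theorem cls_eq_sum_of_projective [Fintype ι]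
    (hall : ∀ M : FDMod K H, IsSimpleModule H M.carrier →
      ∃ i, Nonempty (M.carrier ≃ₗ[H] (S i).carrier))
    {P : FDMod K H} (hP : IsFDProjective P) :
    cls P = ∑ i, homDim P (S i) • cls (Q i) := by
  induction hd : P.dim using Nat.strong_induction_on generalizing P with
  | _ d ih =>
  by_cases h0 : P.dim = 0
  · simp [cls_eq_zero h0, homDim_eq_zero_of_dim_left h0]
  obtain ⟨i, P', hP', ⟨e⟩⟩ := exists_equiv_sum_cover hall hπ hP h0
  have hdim : P.dim = P'.dim + (Q i).dim := (dim_congr e).trans (dim_sum _ _)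
  have hQ := (hπ i).dim_pos
  have hhom (j) : homDim P (S j) = homDim P' (S j) + if i = j then 1 else 0 := by
    rw [homDim_congr_left e, homDim_sum_left, (hπ i).homDim_eq, hδ]
  rw [cls_congr e, cls_sum, ih P'.dim (by omega) hP' rfl]
  simp [hhom, add_smul, Finset.sum_add_distrib]

/-- The coefficients of the covers are read off by `factorHom`, which kills the simple modules that
are not projective; then `homDimHom` gives the coefficients of the simple modules. -/
theorem linearIndependent_simple_cover [Finite ι] (p : ι → Prop)
    (hp : ∀ i, p i → ¬ IsFDProjective (S i)) :
    LinearIndependent ℤ (Sum.elim (fun i : {i // p i} => cls (S i)) fun i => cls (Q i)) := by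
  classical
  have := Fintype.ofFinite ι
  have hcover (i j) : factorHom (π i) (cls (Q j)) = if j = i then 1 else 0 := by
    rw [factorHom_of_projective (hπ i).surjective (hπ j).projective, (hπ j).homDim_eq, hδ]
    split_ifs <;> rfl
  have hsimple (i) (j : {j // p j}) : factorHom (π i) (cls (S j)) = 0 :=
    (hπ i).factorHom_eq_zero (hp j j.2)
  rw [Fintype.linearIndependent_iff]
  intro c hc
  simp only [Fintype.sum_sum_type, Sum.elim_inl, Sum.elim_inr] at hc
  have hr (i) : c (Sum.inr i) = 0 := by
    simpa [hcover, hsimple, -zsmul_eq_mul] using congrArg (factorHom (π i)) hc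
  rintro (j | i)
  · simpa [hr, hδ, Subtype.val_inj, -zsmul_eq_mul] using congrArg (homDimHom (S j)) hc
  · exact hr i

end simples

end Green

/-! ### Duality and tensor products -/

namespace Green

namespace FDMod

variable {K : Type u} {H : Type v} [Field K] [Ring H] [Bialgebra K H]

/-- The pure tensors in `M ⊗ N`. -/
def tmul (M N : FDMod K H) : M.carrier →ₗ[K] N.carrier →ₗ[K] (tensor M N).carrier :=
  TensorProduct.mk K M.carrier N.carrier

@[elab_as_elim]
theorem tensor_induction {M N : FDMod K H} {p : (tensor M N).carrier → Prop}
    (z : (tensor M N).carrier)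
    (zero : p 0) (tmul : ∀ m n, p (tmul M N m n)) (add : ∀ x y, p x → p y → p (x + y)) : p z :=
  TensorProduct.induction_on (motive := p) z zero tmul add

theorem tensor_hom_ext {M N P : FDMod K H} {f g : (tensor M N).carrier →ₗ[H] P.carrier}
    (h : ∀ m n, f (tmul M N m n) = g (tmul M N m n)) : f = g := by
  refine LinearMap.ext fun z => ?_
  induction z using tensor_induction with
  | zero => rw [map_zero, map_zero]
  | tmul m n => exact h m n
  | add x y hx hy => rw [map_add, map_add, hx, hy]

theorem dim_tensor (M N : FDMod K H) : (tensor M N).dim = M.dim * N.dim :=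
  Module.finrank_tensorProduct

/-- The tensor product of two maps of modules. -/
def tensorMap {M M' N N' : FDMod K H} (f : M.carrier →ₗ[H] M'.carrier)
    (g : N.carrier →ₗ[H] N'.carrier) : (tensor M N).carrier →ₗ[H] (tensor M' N').carrier :=
  { TensorProduct.map (f.restrictScalars K) (g.restrictScalars K) with
    map_smul' := fun h z =>
      act₂_intertwine M.ρ N.ρ (TensorProduct.map (f.restrictScalars K) (g.restrictScalars K))
        (act₂ M'.ρ N'.ρ).toLinearMap
        (fun x y m n => by
          have h₁ : f (M.ρ x m) = M'.ρ x (f m) := f.map_smul x m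
          have h₂ : g (N.ρ y n) = N'.ρ y (g n) := g.map_smul y n
          simp [h₁, h₂]) (Coalgebra.comul h) z }

@[simp] theorem tensorMap_tmul {M M' N N' : FDMod K H} (f : M.carrier →ₗ[H] M'.carrier)
    (g : N.carrier →ₗ[H] N'.carrier) (m : M.carrier) (x : N.carrier) :
    tensorMap f g (tmul M N m x) = tmul M' N' (f m) (g x) :=
  rfl

/-- The associativity constraint of the tensor product. -/
def assocEquiv (M N P : FDMod K H) :
    (tensor (tensor M N) P).carrier ≃ₗ[H] (tensor M (tensor N P)).carrier :=
  { TensorProduct.assoc K M.carrier N.carrier P.carrier with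
    map_smul' := fun h z => by
      have h₁ := act₂_comp_left (act₂ M.ρ N.ρ) P.ρ (Bialgebra.comulAlgHom K H) (Coalgebra.comul h)
      have h₂ := act₂_comp_right M.ρ (act₂ N.ρ P.ρ) (Bialgebra.comulAlgHom K H) (Coalgebra.comul h)
      have h₃ := act₂_assoc M.ρ N.ρ P.ρ (Coalgebra.comul.rTensor H (Coalgebra.comul h)) z
      rw [Coalgebra.coassoc_apply] at h₃
      exact ((congrArg (fun f => TensorProduct.assoc K M.carrier N.carrier P.carrier (f z))
        h₁).trans h₃).trans
        (congrArg (fun f => f (TensorProduct.assoc K M.carrier N.carrier P.carrier z)) h₂).symm }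

/-- The left unit constraint of the tensor product. -/
def unitEquiv (M : FDMod K H) : (tensor (unit K H) M).carrier ≃ₗ[H] M.carrier :=
  { TensorProduct.lid K M.carrier with
    map_smul' := fun h z => by
      have := act₂_intertwine
        ((Algebra.ofId K (Module.End K K)).comp (Bialgebra.counitAlgHom K H))
        M.ρ (TensorProduct.lid K M.carrier).toLinearMap
        (M.ρ.toLinearMap ∘ₗ (TensorProduct.lid K H).toLinearMap ∘ₗ Coalgebra.counit.rTensor H)
        (fun x y m n => by
          simp only [Algebra.ofId_apply, AlgHom.comp_apply, Bialgebra.counitAlgHom_apply,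
            Module.algebraMap_end_apply, LinearEquiv.coe_coe, LinearMap.comp_apply,
            TensorProduct.lid_tmul, LinearMap.rTensor_tmul, AlgHom.toLinearMap_apply, map_smul,
            LinearMap.smul_apply, smul_eq_mul, mul_smul]
          exact smul_comm _ _ _) (Coalgebra.comul h) z
      refine this.trans ?_
      simp only [LinearMap.comp_apply, Coalgebra.rTensor_counit_comul]
      simp
      rfl }

/-- A duality between `V` and `V'`: an invariant bilinear map `ev : V × V' → K` and an invariant
element `∑ i, e' i ⊗ e i` of `V' ⊗ V` that satisfy the triangle identities. -/
structure Duality (V V' : FDMod K H) where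
  ev : (tensor V V').carrier →ₗ[K] K
  κ : Type
  [fintype : Fintype κ]
  e : κ → V.carrier
  e' : κ → V'.carrier
  ev_smul : ∀ (h : H) (z : (tensor V V').carrier), ev (h • z) = Coalgebra.counit (R := K) h * ev z
  smul_coev : ∀ h : H, h • ∑ i, tmul V' V (e' i) (e i) =
    Coalgebra.counit (R := K) h • ∑ i, tmul V' V (e' i) (e i)
  left : ∀ v : V.carrier, ∑ i, ev (tmul V V' v (e' i)) • e i = v
  right : ∀ v : V'.carrier, ∑ i, ev (tmul V V' (e i) v) • e' i = v

attribute [instance] Duality.fintype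

namespace Duality

variable {V V' : FDMod K H} (D : Duality V V')

/-- The unit of the adjunction between `V ⊗ -` and `V' ⊗ -`. -/
def η (M : FDMod K H) : M.carrier →ₗ[H] (tensor V' (tensor V M)).carrier :=
  (assocEquiv V' V M).toLinearMap ∘ₗ
    tensorMap (M := unit K H)
      { toFun := fun k : K => k • ∑ i, tmul V' V (D.e' i) (D.e i)
        map_add' := fun k k' : K => add_smul k k' _
        map_smul' := fun h (k : K) => by
          change (Coalgebra.counit (R := K) h * k) • _ = _
          rw [mul_comm, mul_smul, ← D.smul_coev, RingHom.id_apply, smul_comm] } LinearMap.id ∘ₗ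
    (unitEquiv M).symm.toLinearMap

theorem η_apply (M : FDMod K H) (m : M.carrier) :
    D.η M m = ∑ i, tmul V' (tensor V M) (D.e' i) (tmul V M (D.e i) m) := by
  change assocEquiv V' V M (tmul (tensor V' V) M
    ((1 : K) • ∑ i, tmul V' V (D.e' i) (D.e i)) m) = _
  rw [one_smul, map_sum, LinearMap.sum_apply, map_sum]
  rfl

/-- The counit of the adjunction between `V ⊗ -` and `V' ⊗ -`. -/
def ε (N : FDMod K H) : (tensor V (tensor V' N)).carrier →ₗ[H] N.carrier :=
  (unitEquiv N).toLinearMap ∘ₗ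
    tensorMap (M := tensor V V') (M' := unit K H)
      { D.ev with map_smul' := D.ev_smul } LinearMap.id ∘ₗ
    (assocEquiv V V' N).symm.toLinearMap

@[simp] theorem ε_tmul (N : FDMod K H) (v : V.carrier) (v' : V'.carrier) (x : N.carrier) :
    D.ε N (tmul V (tensor V' N) v (tmul V' N v' x)) = D.ev (tmul V V' v v') • x :=
  rfl

theorem ε_tensorMap_η {M N : FDMod K H} (f : (tensor V M).carrier →ₗ[H] N.carrier) :
    D.ε N ∘ₗ tensorMap LinearMap.id (tensorMap LinearMap.id f ∘ₗ D.η M) = f := by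
  refine tensor_hom_ext fun v m => ?_
  simp only [LinearMap.comp_apply, tensorMap_tmul, LinearMap.id_apply, η_apply, map_sum, ε_tmul]
  conv_rhs => rw [← D.left v, map_sum, LinearMap.sum_apply, map_sum]
  refine Finset.sum_congr rfl fun i _ => ?_
  rw [map_smul, LinearMap.smul_apply]
  exact ((f.restrictScalars K).map_smul _ _).symm

theorem sum_tmul_ε {N : FDMod K H} (t : (tensor V' N).carrier) :
    ∑ i, tmul V' N (D.e' i) (D.ε N (tmul V (tensor V' N) (D.e i) t)) = t := by
  induction t using tensor_induction with
  | zero => simp only [map_zero, Finset.sum_const_zero]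
  | add y z hy hz => simp only [map_add, Finset.sum_add_distrib, hy, hz]
  | tmul v x =>
    conv_rhs => rw [← D.right v, map_sum, LinearMap.sum_apply]
    simp only [ε_tmul, map_smul, LinearMap.smul_apply]

theorem tensorMap_ε_η {M N : FDMod K H} (f : M.carrier →ₗ[H] (tensor V' N).carrier) :
    tensorMap LinearMap.id (D.ε N ∘ₗ tensorMap LinearMap.id f) ∘ₗ D.η M = f := by
  refine LinearMap.ext fun m => ?_
  simp only [LinearMap.comp_apply, tensorMap_tmul, LinearMap.id_apply, η_apply, map_sum,
    sum_tmul_ε]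

/-- The adjunction between `V ⊗ -` and `V' ⊗ -`. -/
def homEquiv (M N : FDMod K H) :
    ((tensor V M).carrier →ₗ[H] N.carrier) ≃ₗ[K] (M.carrier →ₗ[H] (tensor V' N).carrier) where
  toFun f := tensorMap LinearMap.id f ∘ₗ D.η M
  invFun g := D.ε N ∘ₗ tensorMap LinearMap.id g
  map_add' f g := by
    ext m
    simp [η_apply, Finset.sum_add_distrib]
  map_smul' k f := by
    ext m
    simp [η_apply, Finset.smul_sum]
  left_inv f := D.ε_tensorMap_η f
  right_inv g := D.tensorMap_ε_η g

include D in
theorem homDim_tensor (M N : FDMod K H) : homDim (tensor V M) N = homDim M (tensor V' N) :=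
  (D.homEquiv M N).finrank_eq

theorem homEquiv_symm_naturality {M N N' : FDMod K H} (g : N.carrier →ₗ[H] N'.carrier)
    (f : M.carrier →ₗ[H] (tensor V' N).carrier) :
    g ∘ₗ (D.homEquiv M N).symm f =
      (D.homEquiv M N').symm (tensorMap LinearMap.id g ∘ₗ f) := by
  refine tensor_hom_ext fun v m => ?_
  change g (D.ε N (tmul V _ v (f m))) = D.ε N' (tmul V _ v (tensorMap LinearMap.id g (f m)))
  induction f m using tensor_induction with
  | zero => simp only [map_zero]
  | add x y hx hy => simp only [map_add, hx, hy]
  | tmul v' x =>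
    simp only [ε_tmul, tensorMap_tmul, LinearMap.id_apply]
    exact (g.restrictScalars K).map_smul _ _

include D in
/-- A left adjoint of an exact functor preserves projectivity. -/
theorem isFDProjective_tensor {P : FDMod K H} (hP : IsFDProjective P) :
    IsFDProjective (tensor V P) := by
  intro N N' g f hg
  have hs : Function.Surjective (tensorMap (LinearMap.id : V'.carrier →ₗ[H] V'.carrier) g) :=
    TensorProduct.map_surjective Function.surjective_id hg
  obtain ⟨f', hf'⟩ := hP _ _ _ (D.homEquiv P N' f) hs
  refine ⟨(D.homEquiv P N).symm f', ?_⟩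
  rw [homEquiv_symm_naturality, hf', LinearEquiv.symm_apply_apply]

end Duality

end FDMod

end Green

/-! ### Lowest vectors -/

namespace Taft

open Green FDMod

variable {K : Type u} [Field K] {n : ℕ} {q : K}

section scalars

theorem q_ne_zero (n : ℕ) (q : K) [NeZero n] [hq : Fact (IsPrimitiveRoot q n)] : q ≠ 0 :=
  hq.out.ne_zero (NeZero.ne n)

theorem zpow_eq_zpow_iff [NeZero n] [hq : Fact (IsPrimitiveRoot q n)] (r s : ℤ) :
    q ^ r = q ^ s ↔ (n : ℤ) ∣ r - s := by
  rw [← hq.out.zpow_eq_one_iff_dvd, zpow_sub₀ (q_ne_zero n q),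
    div_eq_one_iff_eq (zpow_ne_zero _ (q_ne_zero n q))]

theorem qInt_succ (k : ℕ) : qInt q (k + 1) = qInt q k + q ^ k := Finset.sum_range_succ _ k

theorem qInt_succ' (k : ℕ) : qInt q (k + 1) = q * qInt q k + 1 := geom_sum_succ

/-- The coefficient of `d v_k = (k)_q (1 - q^(k-l)) v_{k-1}` in `V(l, r)`. -/
def dCoeff (q : K) (l k : ℕ) : K := qInt q k * (1 - q ^ (k - l : ℤ))

@[simp] theorem dCoeff_zero (q : K) (l : ℕ) : dCoeff q l 0 = 0 := by simp [dCoeff, qInt]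

theorem dCoeff_one (q : K) (l : ℕ) : dCoeff q l 1 = 1 - q ^ (1 - l : ℤ) := by simp [dCoeff, qInt]

@[simp] theorem dCoeff_self (q : K) (l : ℕ) : dCoeff q l l = 0 := by simp [dCoeff]

theorem dCoeff_ne_zero (hq : IsPrimitiveRoot q n) {k l : ℕ} (hk : 0 < k) (hkl : k < l)
    (hl : l ≤ n) : dCoeff q l k ≠ 0 := by
  refine mul_ne_zero (qInt_ne_zero hq hk (by omega)) ?_
  rw [sub_ne_zero, ne_comm, Ne, hq.zpow_eq_one_iff_dvd]
  intro h
  have := Int.eq_zero_of_abs_lt_dvd h (by rw [abs_lt]; omega)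
  omega

theorem dCoeff_succ (hq0 : q ≠ 0) (l k : ℕ) :
    dCoeff q l (k + 1) = q * dCoeff q l k + 1 - q ^ (2 * k + 1 - l : ℤ) := by
  have h₁ : q ^ (((k + 1 : ℕ) : ℤ) - l) = q * q ^ (k - l : ℤ) := by
    rw [← zpow_one_add₀ hq0]
    congr 1
    push_cast
    ring
  have h₂ : q ^ (2 * k + 1 - l : ℤ) = q * q ^ (k - l : ℤ) * q ^ k := by
    rw [← zpow_natCast q k, ← zpow_one_add₀ hq0, ← zpow_add₀ hq0]
    congr 1
    ring
  rw [dCoeff, dCoeff, h₁, h₂]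
  linear_combination qInt_succ' (q := q) k - q * q ^ (k - l : ℤ) * qInt_succ (q := q) k

end scalars

section op

/-- The action of a generator on a module. -/
def op (M : FDMod K (Hn n 1 q)) (g : Gen) : Module.End K M.carrier := M.ρ (Hn.gen n 1 q g)

variable {M N : FDMod K (Hn n 1 q)}

theorem Relations.map {R R' : Type*} [Ring R] [Algebra K R] [Ring R'] [Algebra K R'] {p : K}
    {a b c d : R} (h : Relations n p q a b c d) (f : R →ₐ[K] R') :
    Relations n p q (f a) (f b) (f c) (f d) where
  ba := by rw [← map_mul, h.ba, map_smul, map_mul]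
  db := by rw [← map_mul, h.db, map_smul, map_mul]
  ca := by rw [← map_mul, h.ca, map_smul, map_mul]
  dc := by rw [← map_mul, h.dc, map_smul, map_mul]
  bc := by rw [← map_mul, h.bc, map_mul]
  an := by rw [← map_pow, h.an, map_zero]
  bn := by rw [← map_pow, h.bn, map_one]
  cn := by rw [← map_pow, h.cn, map_one]
  dn := by rw [← map_pow, h.dn, map_zero]
  da := by
    rw [← map_mul, ← map_mul, ← map_mul, ← map_one f, ← map_sub, ← map_smul, ← map_smul,
      ← map_sub, h.da]

variable (M) in
theorem op_relations : Relations n 1 q (op M .a) (op M .b) (op M .c) (op M .d) :=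
  (Hn.relations n 1 q).map M.ρ

/-- A `K`-linear map that commutes with the generators is `H`-linear. -/
def homOfGen (f : M.carrier →ₗ[K] N.carrier) (h : ∀ g m, f (op M g m) = op N g (f m)) :
    M.carrier →ₗ[Hn n 1 q] N.carrier :=
  { f with
    map_smul' := fun x m => by
      let A : Subalgebra K (Hn n 1 q) :=
        { carrier := {x | ∀ m, f (M.ρ x m) = N.ρ x (f m)}
          mul_mem' := fun {x y} hx hy m => by
            rw [map_mul, map_mul, Module.End.mul_apply, Module.End.mul_apply, hx, hy]
          add_mem' := fun {x y} hx hy m => by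
            rw [map_add, map_add, LinearMap.add_apply, LinearMap.add_apply, map_add, hx, hy]
          algebraMap_mem' := fun r m => by simp }
      exact Hn.gen_induction A h x m }

theorem map_op (f : M.carrier →ₗ[Hn n 1 q] N.carrier) (g : Gen) (m : M.carrier) :
    f (op M g m) = op N g (f m) :=
  f.map_smul (Hn.gen n 1 q g) m

theorem map_op_pow (f : M.carrier →ₗ[Hn n 1 q] N.carrier) (g : Gen) (k : ℕ) (m : M.carrier) :
    f ((op M g ^ k) m) = (op N g ^ k) (f m) := by
  rw [Module.End.pow_apply, Module.End.pow_apply]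
  exact Function.Semiconj.iterate_right (map_op f g) k m

theorem op_pow_mem (N : Submodule (Hn n 1 q) M.carrier) (g : Gen) (k : ℕ) {m : M.carrier}
    (hm : m ∈ N) : (op M g ^ k) m ∈ N := by
  induction k with
  | zero => exact hm
  | succ k ih =>
    rw [pow_succ', Module.End.mul_apply]
    exact N.smul_mem (Hn.gen n 1 q g) ih

theorem op_b_a (m : M.carrier) : op M .b (op M .a m) = q • op M .a (op M .b m) :=
  LinearMap.congr_fun (op_relations M).ba m

theorem op_c_a (m : M.carrier) : op M .c (op M .a m) = q • op M .a (op M .c m) :=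
  LinearMap.congr_fun (op_relations M).ca m

theorem op_d_b (m : M.carrier) : op M .d (op M .b m) = q • op M .b (op M .d m) :=
  LinearMap.congr_fun (op_relations M).db m

theorem op_d_c (m : M.carrier) : op M .d (op M .c m) = q • op M .c (op M .d m) :=
  LinearMap.congr_fun (op_relations M).dc m

theorem op_b_c (m : M.carrier) : op M .b (op M .c m) = op M .c (op M .b m) :=
  LinearMap.congr_fun (op_relations M).bc m

theorem op_d_a (m : M.carrier) :
    op M .d (op M .a m) = q • op M .a (op M .d m) + m - op M .b (op M .c m) := by
  have := LinearMap.congr_fun (op_relations M).da m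
  simp only [one_smul, LinearMap.sub_apply, Module.End.mul_apply, LinearMap.smul_apply,
    Module.End.one_apply] at this
  rw [add_sub_assoc, ← this]
  abel

theorem op_a_pow_card (m : M.carrier) : (op M .a ^ n) m = 0 :=
  LinearMap.congr_fun (op_relations M).an m

theorem op_d_pow_card (m : M.carrier) : (op M .d ^ n) m = 0 :=
  LinearMap.congr_fun (op_relations M).dn m

theorem exists_op_d_eq_zero {N : Submodule (Hn n 1 q) M.carrier} (hN : N ≠ ⊥) :
    ∃ x ∈ N, x ≠ 0 ∧ op M .d x = 0 := by
  classical
  obtain ⟨y, hy, hy0⟩ := (Submodule.ne_bot_iff N).1 hN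
  have hex : ∃ k, (op M .d ^ k) y = 0 := ⟨n, op_d_pow_card y⟩
  have hpos : 0 < Nat.find hex := (Nat.find_pos hex).2 hy0
  obtain ⟨k, hk⟩ := Nat.exists_eq_add_one.2 hpos
  refine ⟨(op M .d ^ k) y, op_pow_mem N .d k hy, Nat.find_min hex (by omega), ?_⟩
  have := Nat.find_spec hex
  rwa [hk, pow_succ', Module.End.mul_apply] at this

end op

section eigenProj

variable {X Y : Type*} [AddCommGroup X] [Module K X] [AddCommGroup Y] [Module K Y]
  {f : Module.End K X} {t : ℤ} {x : X}

/-- If `f ^ n = 1`, this is `n` times the projection to the `q ^ t`-eigenspace of `f`. -/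
def eigenProj (n : ℕ) (q : K) (f : Module.End K X) (t : ℤ) : Module.End K X :=
  ∑ k ∈ Finset.range n, (q ^ (-t) • f) ^ k

theorem map_eigenProj {f' : Module.End K Y} (φ : X →ₗ[K] Y) (h : ∀ x, φ (f x) = f' (φ x)) :
    φ (eigenProj n q f t x) = eigenProj n q f' t (φ x) := by
  have hsemi : Function.Semiconj φ (q ^ (-t) • f : Module.End K X)
      (q ^ (-t) • f' : Module.End K Y) := fun x => by
    rw [LinearMap.smul_apply, map_smul, h, LinearMap.smul_apply]
  simp only [eigenProj, LinearMap.sum_apply, map_sum, Module.End.pow_apply]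
  exact Finset.sum_congr rfl fun k _ => hsemi.iterate_right k x

theorem eigenProj_mem {W : Submodule K X} (hW : ∀ x ∈ W, f x ∈ W) (hx : x ∈ W) :
    eigenProj n q f t x ∈ W := by
  rw [eigenProj, LinearMap.sum_apply]
  refine W.sum_mem fun k _ => ?_
  rw [Module.End.pow_apply]
  exact Set.MapsTo.iterate (fun x hx => W.smul_mem _ (hW x hx)) k hx

variable [NeZero n] [hq : Fact (IsPrimitiveRoot q n)]

theorem apply_eigenProj (hf : f ^ n = 1) :
    f (eigenProj n q f t x) = q ^ t • eigenProj n q f t x := by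
  have hpow : (q ^ (-t) • f) ^ n = 1 := by
    rw [smul_pow, hf, ← zpow_natCast, ← zpow_mul, mul_comm, zpow_mul, zpow_natCast,
      hq.out.pow_eq_one, one_zpow, one_smul]
  have hfix : (q ^ (-t) • f) * eigenProj n q f t = eigenProj n q f t := by
    rw [← sub_eq_zero, ← sub_one_mul, eigenProj, mul_geom_sum, hpow, sub_self]
  conv_rhs => rw [← hfix]
  rw [smul_mul_assoc, LinearMap.smul_apply, smul_smul, ← zpow_add₀ (q_ne_zero n q),
    add_neg_cancel, zpow_zero, one_smul, Module.End.mul_apply]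

theorem eigenProj_of_apply_eq (hx : f x = q ^ t • x) : eigenProj n q f t x = (n : K) • x := by
  have hfix : (q ^ (-t) • f) x = x := by
    rw [LinearMap.smul_apply, hx, smul_smul, ← zpow_add₀ (q_ne_zero n q), neg_add_cancel,
      zpow_zero, one_smul]
  simp only [eigenProj, LinearMap.sum_apply, Module.End.pow_apply, Function.iterate_fixed hfix,
    Finset.sum_const, Finset.card_range, Nat.cast_smul_eq_nsmul]

theorem sum_eigenProj (s : ℤ) :
    ∑ t ∈ Finset.range n, eigenProj n q f (s - t) = algebraMap K (Module.End K X) n := by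
  have hsum (k : ℕ) (hk : k ∈ Finset.range n) :
      ∑ t ∈ Finset.range n, (q ^ (-(s - t))) ^ k = if k = 0 then (n : K) else 0 := by
    have hterm (t : ℕ) : (q ^ (-(s - t))) ^ k = (q ^ (-s)) ^ k * (q ^ k) ^ t := by
      rw [neg_sub, sub_eq_neg_add, zpow_add₀ (q_ne_zero n q), mul_pow, zpow_natCast, pow_right_comm]
    split_ifs with h0
    · simp [h0]
    rw [Finset.sum_congr rfl fun t _ => hterm t, ← Finset.mul_sum]
    have hne : q ^ k - 1 ≠ 0 :=
      sub_ne_zero.2 (hq.out.pow_ne_one_of_pos_of_lt h0 (Finset.mem_range.1 hk))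
    refine mul_eq_zero_of_right _ ((mul_eq_zero_iff_left hne).1 ?_)
    rw [mul_geom_sum, pow_right_comm, hq.out.pow_eq_one, one_pow, sub_self]
  simp only [eigenProj, smul_pow]
  rw [Finset.sum_comm]
  simp only [← Finset.sum_smul]
  rw [Finset.sum_congr rfl fun k hk => by rw [hsum k hk]]
  simp only [ite_smul, zero_smul, Finset.sum_ite_eq', Finset.mem_range, NeZero.pos n, if_true,
    pow_zero, Algebra.algebraMap_eq_smul_one]

theorem exists_eigenProj_ne_zero (f : Module.End K X) (hx : x ≠ 0) (s : ℤ) :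
    ∃ t < n, eigenProj n q f (s - t) x ≠ 0 := by
  by_contra! h
  have hsum := LinearMap.congr_fun (sum_eigenProj (n := n) (q := q) (f := f) s) x
  rw [LinearMap.sum_apply, Finset.sum_eq_zero fun t ht => h t (Finset.mem_range.1 ht),
    Module.algebraMap_end_apply] at hsum
  exact smul_ne_zero hq.out.neZero'.out hx hsum.symm

end eigenProj

section lowest

/-- A vector that is annihilated by `d` and has the weight of the vector `v_0` of `V(l, r)`. -/
structure IsLowest (M : FDMod K (Hn n 1 q)) (l : ℕ) (r : ℤ) (v : M.carrier) : Prop where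
  b : op M .b v = q ^ r • v
  c : op M .c v = q ^ (1 - r - l : ℤ) • v
  d : op M .d v = 0

variable {M N : FDMod K (Hn n 1 q)} {l : ℕ} {r : ℤ} {v : M.carrier}

theorem IsLowest.map (h : IsLowest M l r v) (f : M.carrier →ₗ[Hn n 1 q] N.carrier) :
    IsLowest N l r (f v) where
  b := by rw [← map_op, h.b]; exact (f.restrictScalars K).map_smul _ _
  c := by rw [← map_op, h.c]; exact (f.restrictScalars K).map_smul _ _
  d := by rw [← map_op, h.d, map_zero]

variable [NeZero n] [hq : Fact (IsPrimitiveRoot q n)]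

theorem IsLowest.of_dvd (h : IsLowest M l r v) {l' : ℕ} {r' : ℤ} (hl : (n : ℤ) ∣ l - l')
    (hr : (n : ℤ) ∣ r - r') : IsLowest M l' r' v where
  b := h.b.trans (congrArg (· • v) ((zpow_eq_zpow_iff r r').2 hr))
  c := h.c.trans (congrArg (· • v) ((zpow_eq_zpow_iff _ _).2 (by
    have := (dvd_add hl hr).neg_right
    rwa [show -((l : ℤ) - l' + (r - r')) = 1 - r - l - (1 - r' - l') by ring] at this)))
  d := h.d

theorem IsLowest.op_b_pow (h : IsLowest M l r v) (k : ℕ) :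
    op M .b ((op M .a ^ k) v) = q ^ (r + k) • (op M .a ^ k) v := by
  induction k with
  | zero => simpa using h.b
  | succ k ih =>
    rw [pow_succ', Module.End.mul_apply, op_b_a, ih, map_smul, smul_smul,
      ← zpow_one_add₀ (q_ne_zero n q)]
    congr 2
    push_cast
    ring

theorem IsLowest.op_c_pow (h : IsLowest M l r v) (k : ℕ) :
    op M .c ((op M .a ^ k) v) = q ^ (k + 1 - r - l : ℤ) • (op M .a ^ k) v := by
  induction k with
  | zero => simpa using h.c
  | succ k ih =>
    rw [pow_succ', Module.End.mul_apply, op_c_a, ih, map_smul, smul_smul,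
      ← zpow_one_add₀ (q_ne_zero n q)]
    congr 2
    push_cast
    ring

theorem IsLowest.op_d_pow (h : IsLowest M l r v) (k : ℕ) :
    op M .d ((op M .a ^ k) v) = dCoeff q l k • (op M .a ^ (k - 1)) v := by
  induction k with
  | zero => simpa using h.d
  | succ k ih =>
    have hshift : dCoeff q l k • op M .a ((op M .a ^ (k - 1)) v) =
        dCoeff q l k • (op M .a ^ k) v := by
      cases k with
      | zero => simp
      | succ k => rw [Nat.add_sub_cancel, pow_succ', Module.End.mul_apply]
    rw [Nat.add_sub_cancel, dCoeff_succ (q_ne_zero n q), pow_succ', Module.End.mul_apply, op_d_a,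
      ih, map_smul, hshift, h.op_c_pow, map_smul, h.op_b_pow, smul_smul, smul_smul,
      ← zpow_add₀ (q_ne_zero n q), sub_smul, add_smul, one_smul]
    congr 3
    ring

theorem IsLowest.pow (h : IsLowest M l r v) {l' : ℕ} (hl : l + l' = n) :
    IsLowest M l' (r + l) ((op M .a ^ l) v) where
  b := h.op_b_pow l
  c := by
    rw [h.op_c_pow l]
    congr 1
    rw [zpow_eq_zpow_iff (n := n), ← hl]
    exact ⟨1, by push_cast; ring⟩
  d := by rw [h.op_d_pow l, dCoeff_self, zero_smul]

theorem IsLowest.eq_and_dvd {l' : ℕ} {r' : ℤ} (h : IsLowest M l r v) (h' : IsLowest M l' r' v)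
    (hv : v ≠ 0) (h0 : 0 < l) (hl : l ≤ n) (h0' : 0 < l') (hl' : l' ≤ n) :
    l = l' ∧ (n : ℤ) ∣ r - r' := by
  have hb : (n : ℤ) ∣ r - r' :=
    (zpow_eq_zpow_iff (q := q) r r').1 (smul_left_injective K hv (h.b.symm.trans h'.b))
  have hc : (n : ℤ) ∣ 1 - r - l - (1 - r' - l') :=
    (zpow_eq_zpow_iff (q := q) _ _).1 (smul_left_injective K hv (h.c.symm.trans h'.c))
  have hd : (n : ℤ) ∣ (l : ℤ) - l' := by
    have := (dvd_add hb hc).neg_right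
    rwa [show -(r - r' + (1 - r - l - (1 - r' - l'))) = (l : ℤ) - l' by ring] at this
  have := Int.eq_zero_of_abs_lt_dvd hd (by rw [abs_lt]; omega)
  exact ⟨by omega, hb⟩

/-- A scalar multiple of the projection to the common eigenspace of `b` and `c` that contains the
lowest vectors of type `(l, r)`. -/
def weightProj (M : FDMod K (Hn n 1 q)) (l : ℕ) (r : ℤ) : Module.End K M.carrier :=
  eigenProj n q (op M .c) (1 - r - l) * eigenProj n q (op M .b) r

omit [NeZero n] hq in
theorem map_weightProj (f : M.carrier →ₗ[Hn n 1 q] N.carrier) (x : M.carrier) :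
    f (weightProj M l r x) = weightProj N l r (f x) :=
  (map_eigenProj (f.restrictScalars K) (map_op f .c)).trans
    (congrArg _ (map_eigenProj (f.restrictScalars K) (map_op f .b)))

theorem isLowest_weightProj {x : M.carrier} (hx : op M .d x = 0) :
    IsLowest M l r (weightProj M l r x) where
  b := by
    have h := map_eigenProj (n := n) (q := q) (t := 1 - r - l) (f := op M .c) (op M .b) op_b_c
      (x := eigenProj n q (op M .b) r x)
    rw [apply_eigenProj (op_relations M).bn, map_smul] at h
    exact h
  c := apply_eigenProj (op_relations M).cn
  d := by
    refine eigenProj_mem (W := LinearMap.ker (op M .d)) (fun y hy => ?_)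
      (eigenProj_mem (W := LinearMap.ker (op M .d)) (fun y hy => ?_) hx)
    · rw [LinearMap.mem_ker, op_d_c, LinearMap.mem_ker.1 hy, map_zero, smul_zero]
    · rw [LinearMap.mem_ker, op_d_b, LinearMap.mem_ker.1 hy, map_zero, smul_zero]

theorem IsLowest.weightProj_eq (h : IsLowest M l r v) :
    weightProj M l r v = (n : K) • (n : K) • v := by
  rw [weightProj, Module.End.mul_apply, eigenProj_of_apply_eq h.b, map_smul,
    eigenProj_of_apply_eq h.c]

theorem exists_isLowest (M : FDMod K (Hn n 1 q)) [Nontrivial M.carrier] :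
    ∃ (l : ℕ) (r : ℤ) (v : M.carrier), 0 < l ∧ l ≤ n ∧ v ≠ 0 ∧ IsLowest M l r v := by
  obtain ⟨x, -, hx0, hx⟩ := exists_op_d_eq_zero (M := M) (N := ⊤) top_ne_bot
  obtain ⟨t, -, ht⟩ := exists_eigenProj_ne_zero (n := n) (q := q) (op M .b) hx0 0
  obtain ⟨l, hl, hv⟩ := exists_eigenProj_ne_zero (n := n) (q := q) (op M .c) ht (t : ℤ)
  refine ⟨l + 1, 0 - t, weightProj M (l + 1) (0 - t) x, l.succ_pos, hl, ?_,
    isLowest_weightProj hx⟩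
  rwa [weightProj, Module.End.mul_apply,
    show (1 - (0 - t) - (l + 1 : ℕ) : ℤ) = t - l by push_cast; ring]

end lowest

end Taft

/-! ### The modules `V(l, r)` -/

namespace Taft

open Green FDMod

variable {K : Type u} [Field K] {n : ℕ} {q : K}

theorem vec_apply (l k : ℕ) (i : Fin l) : vec K l k i = if (i : ℕ) = k then 1 else 0 := by
  unfold vec
  split_ifs with hk hi hi
  · simp [← hi]
  · exact Pi.single_eq_of_ne (by simpa [Fin.ext_iff] using hi) 1
  · omega
  · rfl

theorem linearMap_ext_vec {l : ℕ} {X : Type*} [AddCommGroup X] [Module K X]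
    {f g : (Fin l → K) →ₗ[K] X} (h : ∀ k < l, f (vec K l k) = g (vec K l k)) : f = g := by
  refine (Pi.basisFun K (Fin l)).ext fun i => ?_
  rw [Pi.basisFun_apply, ← vec_coe]
  exact h i i.2

theorem opD_apply (q : K) {l k : ℕ} (hk : k + 1 < l) (x : Fin l → K) :
    opD q l x ⟨k, by omega⟩ = dCoeff q l (k + 1) * x ⟨k + 1, hk⟩ := by
  refine LinearMap.congr_fun (f := LinearMap.proj (⟨k, by omega⟩ : Fin l) ∘ₗ opD q l)
    (g := dCoeff q l (k + 1) • LinearMap.proj (⟨k + 1, hk⟩ : Fin l))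
    (linearMap_ext_vec fun j hj => ?_) x
  rw [LinearMap.comp_apply, opD_vec q l hj.le, map_smul, LinearMap.smul_apply,
    LinearMap.proj_apply, LinearMap.proj_apply, vec_apply, vec_apply, smul_eq_mul, smul_eq_mul,
    ← dCoeff]
  cases j with
  | zero => simp
  | succ j => rcases eq_or_ne k j with rfl | h <;> simp [*]

theorem exists_eq_smul_of_opD_eq_zero (hq : IsPrimitiveRoot q n) {l : ℕ} (hl : l ≤ n)
    {x : Fin l → K} (hx : opD q l x = 0) : ∃ t : K, x = t • vec K l 0 := by
  have hzero (k : ℕ) (hk : k + 1 < l) : x ⟨k + 1, hk⟩ = 0 :=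
    (mul_eq_zero_iff_left (dCoeff_ne_zero hq k.succ_pos hk hl)).1
      ((opD_apply q hk x).symm.trans (congrFun hx _))
  rcases Nat.eq_zero_or_pos l with rfl | h0
  · exact ⟨0, Subsingleton.elim _ _⟩
  refine ⟨x ⟨0, h0⟩, funext ?_⟩
  rintro ⟨_ | k, hk⟩
  · simp [vec_apply]
  · simp [vec_apply, hzero k hk]

theorem constr_op_a_pow {M : FDMod K (Hn n 1 q)} {l : ℕ} {v : M.carrier}
    (ha : (op M .a ^ l) v = 0) {k : ℕ} (hk : k ≤ l) :
    (Pi.basisFun K (Fin l)).constr K (fun i => (op M .a ^ (i : ℕ)) v) (vec K l k) =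
      (op M .a ^ k) v := by
  rcases hk.lt_or_eq with hk | rfl
  · have := (Pi.basisFun K (Fin l)).constr_basis K (fun i => (op M .a ^ (i : ℕ)) v) ⟨k, hk⟩
    rwa [Pi.basisFun_apply, ← vec_coe] at this
  · rw [vec_of_le k le_rfl, map_zero, ha]

variable [hq : Fact (IsPrimitiveRoot q n)] {M : FDMod K (Hn n 1 q)} {l : ℕ} (hl : l ≤ n)
  {r s : ℤ}

/-- The basis vectors `v_0, …, v_{l-1}` of `V(l, r)`, with `v_k = 0` for `k ≥ l`. -/
def basisVec (l : ℕ) (hl : l ≤ n) (r : ℤ) (k : ℕ) : (V (q := q) l hl r).carrier := vec K l k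

theorem op_V_a (k : ℕ) :
    op (V (q := q) l hl r) .a (basisVec l hl r k) = basisVec l hl r (k + 1) :=
  (LinearMap.congr_fun (Hn.lift_gen (relations_op q r hq.out hl) .a) _).trans (opA_vec l k)

theorem op_V_b (k : ℕ) :
    op (V (q := q) l hl r) .b (basisVec l hl r k) = q ^ (r + k) • basisVec l hl r k :=
  (LinearMap.congr_fun (Hn.lift_gen (relations_op q r hq.out hl) .b) _).trans (opB_vec q l r k)

theorem op_V_c (k : ℕ) : op (V (q := q) l hl r) .c (basisVec l hl r k) =
    q ^ (k + 1 - r - l : ℤ) • basisVec l hl r k :=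
  (LinearMap.congr_fun (Hn.lift_gen (relations_op q r hq.out hl) .c) _).trans (opC_vec q l r k)

theorem op_V_d {k : ℕ} (hk : k ≤ l) :
    op (V (q := q) l hl r) .d (basisVec l hl r k) = dCoeff q l k • basisVec l hl r (k - 1) :=
  (LinearMap.congr_fun (Hn.lift_gen (relations_op q r hq.out hl) .d) _).trans (opD_vec q l hk)

theorem basisVec_eq_zero {k : ℕ} (hk : l ≤ k) : basisVec (q := q) l hl r k = 0 := vec_of_le l hk

theorem basisVec_ne_zero {k : ℕ} (hk : k < l) : basisVec (q := q) l hl r k ≠ 0 := fun h => by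
  have := congrFun (show vec K l k = 0 from h) ⟨k, hk⟩
  simp [vec_apply] at this

theorem op_V_a_pow (m k : ℕ) :
    (op (V (q := q) l hl r) .a ^ m) (basisVec l hl r k) = basisVec l hl r (k + m) := by
  induction m with
  | zero => rfl
  | succ m ih => rw [pow_succ', Module.End.mul_apply, ih, op_V_a, add_assoc]

theorem dim_V : (V (q := q) l hl r).dim = l :=
  (Module.finrank_fintype_fun_eq_card K).trans (Fintype.card_fin l)

theorem isLowest_basisVec : IsLowest (V (q := q) l hl r) l r (basisVec l hl r 0) where
  b := by simpa using op_V_b (q := q) hl 0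
  c := by simpa using op_V_c (q := q) hl 0
  d := by simpa using op_V_d (q := q) hl l.zero_le

theorem V_eq_of_dvd (h : (n : ℤ) ∣ r - s) : V (q := q) l hl r = V l hl s := by
  rcases Nat.eq_zero_or_pos n with rfl | hn
  · rw [zero_dvd_iff.1 h |> sub_eq_zero.1]
  have : NeZero n := ⟨hn.ne'⟩
  have hpow {i j : ℤ} (hij : r - s = i - j) : q ^ i = q ^ j :=
    (zpow_eq_zpow_iff (n := n) i j).2 (hij ▸ h)
  have hρ : Hn.lift (relations_op q r hq.out hl) = Hn.lift (relations_op q s hq.out hl) := by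
    refine Hn.algHom_ext fun g => ?_
    rw [Hn.lift_gen, Hn.lift_gen]
    cases g
    case b =>
      exact linearMap_ext_vec fun k _ => by
        rw [Hn.vals, opB_vec, Hn.vals, opB_vec, hpow (j := s + k) (by ring)]
    case c =>
      exact linearMap_ext_vec fun k _ => by
        rw [Hn.vals, opC_vec, Hn.vals, opC_vec, ← hpow (i := k + 1 - s - l) (by ring)]
    all_goals rfl
  rw [V, V, hρ]

theorem ext_basisVec {X : Type*} [AddCommGroup X] [Module K X]
    {f g : (V (q := q) l hl r).carrier →ₗ[K] X}
    (h : ∀ k < l, f (basisVec l hl r k) = g (basisVec l hl r k)) : f = g :=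
  linearMap_ext_vec h

theorem eq_top_of_basisVec_mem {N : Submodule (Hn n 1 q) (V (q := q) l hl r).carrier}
    (h : basisVec l hl r 0 ∈ N) : N = ⊤ := by
  have hmkQ : (N.restrictScalars K).mkQ = 0 := ext_basisVec hl fun k _ => by
    have := op_pow_mem N .a k h
    rw [op_V_a_pow, zero_add] at this
    exact (Submodule.Quotient.mk_eq_zero _).2 this
  exact Submodule.eq_top_iff'.2 fun x =>
    (Submodule.Quotient.mk_eq_zero (N.restrictScalars K)).1 (LinearMap.congr_fun hmkQ x)

theorem hom_ext_basisVec {f g : (V (q := q) l hl r).carrier →ₗ[Hn n 1 q] M.carrier}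
    (h : f (basisVec l hl r 0) = g (basisVec l hl r 0)) : f = g :=
  LinearMap.eqLocus_eq_top.1 (eq_top_of_basisVec_mem hl h)

theorem eq_smul_of_op_d {x : (V (q := q) l hl r).carrier} (hx : op (V l hl r) .d x = 0) :
    ∃ t : K, x = t • basisVec l hl r 0 :=
  exists_eq_smul_of_opD_eq_zero hq.out hl
    ((LinearMap.congr_fun (Hn.lift_gen (relations_op q r hq.out hl) .d) x).symm.trans hx)

theorem isSimpleModule_V (hl0 : 0 < l) :
    IsSimpleModule (Hn n 1 q) (V (q := q) l hl r).carrier := by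
  have : Nontrivial (V (q := q) l hl r).carrier := ⟨_, _, basisVec_ne_zero hl hl0⟩
  refine (isSimpleModule_iff _ _).2 ⟨fun N => or_iff_not_imp_left.2 fun hN => ?_⟩
  obtain ⟨x, hx, hx0, hd⟩ := exists_op_d_eq_zero hN
  obtain ⟨t, rfl⟩ := eq_smul_of_op_d hl hd
  have ht : t ≠ 0 := fun ht => hx0 (by rw [ht, zero_smul])
  exact eq_top_of_basisVec_mem hl (((N.restrictScalars K).smul_mem_iff ht).1 hx)

theorem exists_op_d_pow_basisVec {k : ℕ} (hk : k < l) : ∃ t : K, t ≠ 0 ∧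
    (op (V (q := q) l hl r) .d ^ k) (basisVec l hl r k) = t • basisVec l hl r 0 := by
  induction k with
  | zero => exact ⟨1, one_ne_zero, (one_smul _ _).symm⟩
  | succ k ih =>
    obtain ⟨t, ht, h⟩ := ih (by omega)
    refine ⟨dCoeff q l (k + 1) * t, mul_ne_zero (dCoeff_ne_zero hq.out k.succ_pos hk hl) ht, ?_⟩
    rw [pow_succ, Module.End.mul_apply, op_V_d hl hk.le, map_smul, Nat.add_sub_cancel, h,
      smul_smul]

section homOfLowest

variable [NeZero n] {v : M.carrier}

/-- The universal property of `V(l, r)`: it is generated by its lowest vector `v_0`, subject to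
the relation `a ^ l v_0 = 0`. -/
def homOfLowest (hv : IsLowest M l r v) (ha : (op M .a ^ l) v = 0) :
    (V (q := q) l hl r).carrier →ₗ[Hn n 1 q] M.carrier :=
  let F : (V (q := q) l hl r).carrier →ₗ[K] M.carrier :=
    (Pi.basisFun K (Fin l)).constr K fun i => (op M .a ^ (i : ℕ)) v
  homOfGen F fun g => LinearMap.congr_fun (f := F ∘ₗ op _ g) (g := op M g ∘ₗ F) <|
    ext_basisVec hl fun k hk => by
      have hF {k : ℕ} (hk : k ≤ l) : F (basisVec (q := q) l hl r k) = (op M .a ^ k) v :=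
        constr_op_a_pow ha hk
      rw [LinearMap.comp_apply, LinearMap.comp_apply, hF hk.le]
      cases g
      · rw [op_V_a, hF hk, pow_succ', Module.End.mul_apply]
      · rw [op_V_b, map_smul, hF hk.le, hv.op_b_pow]
      · rw [op_V_c, map_smul, hF hk.le, hv.op_c_pow]
      · rw [op_V_d hl hk.le, map_smul, hF (by omega), hv.op_d_pow]

theorem homOfLowest_basisVec (hv : IsLowest M l r v) (ha : (op M .a ^ l) v = 0) {k : ℕ}
    (hk : k ≤ l) : homOfLowest hl hv ha (basisVec l hl r k) = (op M .a ^ k) v :=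
  constr_op_a_pow ha hk

theorem homOfLowest_ne_zero (hv : IsLowest M l r v) (ha : (op M .a ^ l) v = 0) (hv0 : v ≠ 0) :
    homOfLowest hl hv ha ≠ 0 := fun h => hv0 <| by
  simpa [h] using (homOfLowest_basisVec hl hv ha l.zero_le).symm

theorem isFDProjective_V (r : ℤ) : IsFDProjective (V (q := q) n le_rfl r) := by
  intro N N' g f hg
  have hn := NeZero.pos n
  obtain ⟨t, ht, htv⟩ := exists_op_d_pow_basisVec (q := q) (n := n) le_rfl (r := r)
    (Nat.sub_lt hn one_pos)
  obtain ⟨x, hx⟩ := hg (f (basisVec n le_rfl r (n - 1)))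
  have hd : op N .d ((op N .d ^ (n - 1)) x) = 0 := by
    rw [← Module.End.mul_apply, ← pow_succ', Nat.sub_add_cancel hn, op_d_pow_card]
  -- Averaging over the powers of `b` and `c` moves `d ^ (n - 1) x` to a vector of the right weight.
  have hw : IsLowest N n r (weightProj N n r ((op N .d ^ (n - 1)) x)) := isLowest_weightProj hd
  have hgw : g (weightProj N n r ((op N .d ^ (n - 1)) x)) =
      ((n : K) * n * t) • f (basisVec n le_rfl r 0) := by
    rw [map_weightProj, map_op_pow, hx, ← map_op_pow, htv, ← map_weightProj, map_smul,
      (isLowest_basisVec le_rfl).weightProj_eq, f.map_smul_of_tower, f.map_smul_of_tower,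
      f.map_smul_of_tower, smul_smul, smul_smul]
    congr 1
    ring
  have hs : (n : K) * n * t ≠ 0 :=
    mul_ne_zero (mul_ne_zero hq.out.neZero'.out hq.out.neZero'.out) ht
  refine ⟨((n : K) * n * t)⁻¹ • homOfLowest le_rfl hw (op_a_pow_card _), hom_ext_basisVec le_rfl ?_⟩
  rw [LinearMap.comp_apply, LinearMap.smul_apply, homOfLowest_basisVec _ _ _ n.zero_le, pow_zero,
    Module.End.one_apply, g.map_smul_of_tower, hgw, inv_smul_smul₀ hs]

end homOfLowest

section classification

variable [NeZero n]

theorem homDim_V {l' : ℕ} (hl' : l' ≤ n) {r' : ℤ} (h0 : 0 < l) (h0' : 0 < l') :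
    homDim (V (q := q) l hl r) (V (q := q) l' hl' r') =
      if l = l' ∧ (n : ℤ) ∣ r - r' then 1 else 0 := by
  split_ifs with h
  · obtain ⟨rfl, h⟩ := h
    rw [V_eq_of_dvd hl h]
    refine finrank_eq_one LinearMap.id (fun h => ?_) fun f => ?_
    · exact basisVec_ne_zero (q := q) hl (r := r') h0 (LinearMap.congr_fun h _)
    · obtain ⟨t, ht⟩ := eq_smul_of_op_d hl ((isLowest_basisVec (q := q) hl (r := r')).map f).d
      exact ⟨t, hom_ext_basisVec hl ht.symm⟩
  · refine homDim_eq_zero_iff.2 fun f => hom_ext_basisVec hl ?_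
    by_contra! hf
    have hlow := (isLowest_basisVec (q := q) hl (r := r)).map f
    obtain ⟨t, ht⟩ := eq_smul_of_op_d hl' hlow.d
    have hlow' := (isLowest_basisVec (q := q) hl' (r := r')).map (t • LinearMap.id)
    exact h (hlow.eq_and_dvd (ht ▸ hlow') hf h0 hl h0' hl')

theorem exists_equiv_V (hM : IsSimpleModule (Hn n 1 q) M.carrier) :
    ∃ (l : ℕ) (hl : l ≤ n) (r : ℤ), 0 < l ∧
      Nonempty (M.carrier ≃ₗ[Hn n 1 q] (V (q := q) l hl r).carrier) := by
  have := IsSimpleModule.nontrivial (Hn n 1 q) M.carrier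
  obtain ⟨l, r, v, hl0, hl, hv0, hv⟩ : ∃ (l : ℕ) (r : ℤ) (v : M.carrier), 0 < l ∧ l ≤ n ∧ v ≠ 0 ∧
      IsLowest M l r v ∧ (op M .a ^ l) v = 0 := by
    obtain ⟨l, r, v, hl0, hl, hv0, hv⟩ := exists_isLowest M
    by_cases ha : (op M .a ^ l) v = 0
    · exact ⟨l, r, v, hl0, hl, hv0, hv, ha⟩
    · have hln : l + (n - l) = n := by omega
      have hpow : (op M .a ^ (n - l)) ((op M .a ^ l) v) = 0 := by
        rw [← Module.End.mul_apply, ← pow_add, Nat.sub_add_cancel hl, op_a_pow_card]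
      refine ⟨n - l, r + l, (op M .a ^ l) v, Nat.pos_of_ne_zero fun h => ha ?_, by omega, ha,
        hv.pow hln, hpow⟩
      rwa [h] at hpow
  have := isSimpleModule_V (q := q) hl (r := r) hl0
  exact ⟨l, hl, r, hl0, ⟨(LinearEquiv.ofBijective (homOfLowest hl hv.1 hv.2)
    ((LinearMap.bijective_or_eq_zero _).resolve_right
      (homOfLowest_ne_zero hl hv.1 hv.2 hv0))).symm⟩⟩

end classification

end Taft

/-! ### The dual of `V(2, 0)` -/

namespace Taft

open Green FDMod

variable {K : Type u} [Field K] {n : ℕ} {q : K} [NeZero n] [hq : Fact (IsPrimitiveRoot q n)]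

section tensor

variable {M N : FDMod K (Hn n 1 q)} (x : M.carrier) (y : N.carrier)

theorem op_tensor (g : Gen) (z : (tensor M N).carrier) : op (tensor M N) g z =
    act₂ M.ρ N.ρ (Hn.lift ((Hn.relations n 1 q).comul hq.out) (Hn.gen n 1 q g)) z := rfl

theorem op_tensor_a : op (tensor M N) .a (tmul M N x y) =
    tmul M N (op M .a x) (op N .b y) + tmul M N x (op N .a y) := by
  rw [op_tensor, Hn.lift_gen, Hn.vals, map_add]
  refine congrArg₂ (· + ·) (act₂_tmul M.ρ N.ρ _ _ x y) ((act₂_tmul M.ρ N.ρ _ _ x y).trans ?_)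
  rw [map_one]
  rfl

theorem op_tensor_b :
    op (tensor M N) .b (tmul M N x y) = tmul M N (op M .b x) (op N .b y) := by
  rw [op_tensor, Hn.lift_gen, Hn.vals]
  exact act₂_tmul M.ρ N.ρ _ _ x y

theorem op_tensor_c :
    op (tensor M N) .c (tmul M N x y) = tmul M N (op M .c x) (op N .c y) := by
  rw [op_tensor, Hn.lift_gen, Hn.vals]
  exact act₂_tmul M.ρ N.ρ _ _ x y

theorem op_tensor_d : op (tensor M N) .d (tmul M N x y) =
    tmul M N (op M .d x) (op N .c y) + tmul M N x (op N .d y) := by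
  rw [op_tensor, Hn.lift_gen, Hn.vals, map_add]
  refine congrArg₂ (· + ·) (act₂_tmul M.ρ N.ρ _ _ x y) ((act₂_tmul M.ρ N.ρ _ _ x y).trans ?_)
  rw [map_one]
  rfl

/-- The values of the counit on the generators. -/
def counitVal (K : Type u) [Field K] : Gen → K := Hn.vals 0 1 1 0

theorem op_unit (g : Gen) (k : K) : op (unit K (Hn n 1 q)) g k = counitVal K g * k := by
  have : Coalgebra.counit (R := K) (Hn.gen n 1 q g) = counitVal K g := by
    rw [Hn.counit_eq, Hn.lift_gen]
    rfl
  rw [← this]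
  rfl

variable {l l' : ℕ} (hl : l ≤ n) (hl' : l' ≤ n) {r r' : ℤ}

theorem ext_tmul_basisVec {X : Type*} [AddCommGroup X] [Module K X]
    {f g : (tensor (V (q := q) l hl r) (V (q := q) l' hl' r')).carrier →ₗ[K] X}
    (h : ∀ i < l, ∀ j < l', f (tmul _ _ (basisVec l hl r i) (basisVec l' hl' r' j)) =
      g (tmul _ _ (basisVec l hl r i) (basisVec l' hl' r' j))) : f = g :=
  TensorProduct.ext (ext_basisVec hl fun i hi => ext_basisVec hl' fun j hj => h i hi j hj)

/-- The coordinate functions on `V(l, r) ⊗ V(l', r')` with respect to the basis `v_i ⊗ v_j`. -/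
def coord (i : Fin l) (j : Fin l') :
    (tensor (V (q := q) l hl r) (V (q := q) l' hl' r')).carrier →ₗ[K] K :=
  TensorProduct.lift ((LinearMap.mul K K).compl₁₂ (LinearMap.proj i : (Fin l → K) →ₗ[K] K)
    (LinearMap.proj j : (Fin l' → K) →ₗ[K] K))

theorem coord_tmul_basisVec (i : Fin l) (j : Fin l') (k k' : ℕ) :
    coord (q := q) hl hl' (r := r) (r' := r') i j
      (tmul _ _ (basisVec l hl r k) (basisVec l' hl' r' k')) =
      if (i : ℕ) = k ∧ (j : ℕ) = k' then 1 else 0 := by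
  change vec K l k i * vec K l' k' j = _
  rw [vec_apply, vec_apply, ite_and]
  split_ifs <;> simp

end tensor

/-- A duality over `H_n(1, q)` may be checked on the generators. -/
def dualityOfGen {M M' : FDMod K (Hn n 1 q)} (ev : (tensor M M').carrier →ₗ[K] K)
    {κ : Type} [Fintype κ] (e : κ → M.carrier) (e' : κ → M'.carrier)
    (hev : ∀ g z, ev (op _ g z) = counitVal K g * ev z)
    (hcoev : ∀ g, op (tensor M' M) g (∑ i, tmul M' M (e' i) (e i)) =
      counitVal K g • ∑ i, tmul M' M (e' i) (e i))
    (left : ∀ v, ∑ i, ev (tmul M M' v (e' i)) • e i = v)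
    (right : ∀ v, ∑ i, ev (tmul M M' (e i) v) • e' i = v) : Duality M M' where
  ev := ev
  κ := κ
  e := e
  e' := e'
  ev_smul h z := (homOfGen (N := unit K (Hn n 1 q)) ev fun g m =>
    (hev g m).trans (op_unit g _).symm).map_smul h z
  smul_coev h := by
    have := (homOfGen (M := unit K (Hn n 1 q)) (N := tensor M' M)
      (LinearMap.toSpanSingleton K _ (∑ i, tmul M' M (e' i) (e i)))
      (fun g (k : K) => by
        rw [op_unit]
        change (counitVal K g * k) • _ = op (tensor M' M) g (k • _)
        rw [map_smul, hcoev, smul_smul, mul_comm])).map_smul h (1 : K)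
    change (Coalgebra.counit (R := K) h * (1 : K)) • (∑ i, tmul M' M (e' i) (e i)) =
      h • ((1 : K) • ∑ i, tmul M' M (e' i) (e i)) at this
    rw [one_smul, mul_one] at this
    exact this.symm
  left := left
  right := right

section dualityTwo

variable (h2 : 2 ≤ n)

/-- The evaluation `V(2, 0) ⊗ V(2, -1) → K`, `v_1 ⊗ v_0 ↦ 1`, `v_0 ⊗ v_1 ↦ -q⁻¹`. -/
def evTwo : (tensor (V (q := q) 2 h2 0) (V (q := q) 2 h2 (-1))).carrier →ₗ[K] K :=
  coord h2 h2 1 0 - q⁻¹ • coord h2 h2 0 1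

theorem evTwo_tmul_basisVec (i j : ℕ) :
    evTwo (q := q) h2 (tmul _ _ (basisVec 2 h2 0 i) (basisVec 2 h2 (-1) j)) =
      (if 1 = i ∧ 0 = j then 1 else 0) - q⁻¹ * if 0 = i ∧ 1 = j then 1 else 0 := by
  simp [evTwo, coord_tmul_basisVec]

theorem evTwo_op (g : Gen) (z : (tensor (V (q := q) 2 h2 0) (V (q := q) 2 h2 (-1))).carrier) :
    evTwo h2 (op _ g z) = counitVal K g * evTwo h2 z := by
  have hq0 : q ≠ 0 := q_ne_zero n q
  refine LinearMap.congr_fun (f := evTwo h2 ∘ₗ op _ g) (g := counitVal K g • evTwo h2)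
    (ext_tmul_basisVec h2 h2 fun i hi j hj => ?_) z
  rw [LinearMap.comp_apply, LinearMap.smul_apply]
  cases g
  · rw [op_tensor_a, op_V_a, op_V_a, op_V_b]
    interval_cases i <;> interval_cases j <;> simp [counitVal, Hn.vals, evTwo_tmul_basisVec]
  · rw [op_tensor_b, op_V_b, op_V_b]
    interval_cases i <;> interval_cases j <;> simp [counitVal, Hn.vals, evTwo_tmul_basisVec, hq0]
  · rw [op_tensor_c, op_V_c, op_V_c]
    interval_cases i <;> interval_cases j <;> simp [counitVal, Hn.vals, evTwo_tmul_basisVec, hq0]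
  · rw [op_tensor_d, op_V_d h2 hi.le, op_V_d h2 hj.le, op_V_c]
    interval_cases i <;> interval_cases j <;>
      simp [counitVal, Hn.vals, evTwo_tmul_basisVec, dCoeff_one, mul_comm (1 - q⁻¹), hq0]

variable (q) in
/-- The coevaluation of the duality between `V(2, 0)` and `V(2, -1)`. -/
def coevTwo : (tensor (V (q := q) 2 h2 (-1)) (V (q := q) 2 h2 0)).carrier :=
  tmul _ _ (basisVec 2 h2 (-1) 0) (basisVec 2 h2 0 1) -
    q • tmul _ _ (basisVec 2 h2 (-1) 1) (basisVec 2 h2 0 0)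

theorem op_coevTwo (g : Gen) : op _ g (coevTwo q h2) = counitVal K g • coevTwo q h2 := by
  have hq0 : q ≠ 0 := q_ne_zero n q
  have hz (r : ℤ) : basisVec (q := q) 2 h2 r 2 = 0 := basisVec_eq_zero h2 le_rfl
  rw [coevTwo, map_sub, map_smul]
  cases g
  · simp [op_tensor_a, op_V_a, op_V_b, hz, counitVal, Hn.vals]
  · simp [op_tensor_b, op_V_b, hq0, counitVal, Hn.vals]
  · simp [op_tensor_c, op_V_c, hq0, counitVal, Hn.vals]
  · simp only [op_tensor_d, op_V_c, op_V_d h2 one_le_two, op_V_d h2 zero_le_two]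
    simp [dCoeff_one, counitVal, Hn.vals, mul_sub, smul_smul, hq0]

/-- The dual of `V(2, 0)` is `V(2, -1)`. -/
def dualityTwo : Duality (V (q := q) 2 h2 0) (V (q := q) 2 h2 (-1)) :=
  have hq0 : q ≠ 0 := q_ne_zero n q
  dualityOfGen (evTwo h2) (κ := Fin 2)
    ![basisVec 2 h2 0 1, basisVec 2 h2 0 0] ![basisVec 2 h2 (-1) 0, -q • basisVec 2 h2 (-1) 1]
    (evTwo_op h2) (fun g => by simpa [coevTwo, sub_eq_add_neg] using op_coevTwo h2 g)
    (fun v => by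
      rw [Fin.sum_univ_two]
      refine LinearMap.congr_fun (g := LinearMap.id)
        (f := (evTwo h2 ∘ₗ (tmul _ _).flip _).smulRight _ +
          (evTwo h2 ∘ₗ (tmul _ _).flip _).smulRight _) (ext_basisVec h2 fun k hk => ?_) v
      interval_cases k <;> simp [evTwo_tmul_basisVec, hq0])
    (fun v => by
      rw [Fin.sum_univ_two]
      refine LinearMap.congr_fun (g := LinearMap.id)
        (f := (evTwo h2 ∘ₗ tmul _ _ _).smulRight _ + (evTwo h2 ∘ₗ tmul _ _ _).smulRight _)
        (ext_basisVec h2 fun k hk => ?_) v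
      interval_cases k <;> simp [evTwo_tmul_basisVec, hq0])

end dualityTwo

end Taft

/-! ### Tensor products of simple modules -/

namespace Taft

open Green FDMod

variable {K : Type u} [Field K] {n : ℕ} {q : K} [NeZero n] [hq : Fact (IsPrimitiveRoot q n)]

theorem injective_homOfLowest {M : FDMod K (Hn n 1 q)} {l : ℕ} (hl : l ≤ n) {r : ℤ}
    {v : M.carrier} (hv : IsLowest M l r v) (ha : (op M .a ^ l) v = 0) (hv0 : 0 < l → v ≠ 0) :
    Function.Injective (homOfLowest hl hv ha) := by
  rcases Nat.eq_zero_or_pos l with h0 | h0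
  · have := dim_eq_zero_iff.1 ((dim_V (q := q) hl (r := r)).trans h0)
    exact Function.injective_of_subsingleton _
  · have := isSimpleModule_V (q := q) hl (r := r) h0
    exact (LinearMap.injective_or_eq_zero _).resolve_right
      (homOfLowest_ne_zero hl hv ha (hv0 h0))

theorem equiv_unit (h1 : 1 ≤ n) :
    Nonempty ((V (q := q) 1 h1 0).carrier ≃ₗ[Hn n 1 q] (unit K (Hn n 1 q)).carrier) := by
  let e : (unit K (Hn n 1 q)).carrier := (1 : K)
  have hop (g : Gen) : op (unit K (Hn n 1 q)) g e = counitVal K g • e := op_unit g 1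
  have hlow : IsLowest (unit K (Hn n 1 q)) 1 0 e :=
    ⟨by simp [hop, counitVal, Hn.vals], by simp [hop, counitVal, Hn.vals],
      by simp [hop, counitVal, Hn.vals]⟩
  have ha : (op (unit K (Hn n 1 q)) .a ^ 1) e = 0 := by simp [hop, counitVal, Hn.vals]
  exact ⟨LinearEquiv.ofBijective (homOfLowest h1 hlow ha) (bijective_of_injective
    (injective_homOfLowest h1 hlow ha fun _ => one_ne_zero (α := K))
    ((dim_V h1).trans (Module.finrank_self K).symm))⟩

/-- The submodule generated by a lowest vector has composition factors `V(l, s)` and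
`V(n - l, s + l)` unless it is too small. -/
theorem IsLowest.exists_quotient {M : FDMod K (Hn n 1 q)} {l l' : ℕ} (hl : l + l' = n) {s : ℤ}
    {w : M.carrier} (hw : IsLowest M l s w) :
    ∃ (M' : FDMod K (Hn n 1 q)) (p : M.carrier →ₗ[Hn n 1 q] M'.carrier),
      Function.Surjective p ∧ p w = 0 ∧ M.dim ≤ n + M'.dim ∧
      (M.dim = n + M'.dim → ∀ P : FDMod K (Hn n 1 q), IsFDProjective P → homDim P M =
        homDim P (V (q := q) l (by omega) s) + homDim P (V (q := q) l' (by omega) (s + l)) +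
          homDim P M') := by
  have ha : (op M .a ^ l') ((op M .a ^ l) w) = 0 := by
    rw [← Module.End.mul_apply, ← pow_add, add_comm, hl, op_a_pow_card]
  let f := homOfLowest (by omega) (hw.pow hl) ha
  have hpf : toCoker f ((op M .a ^ l) w) = 0 := by
    have := (exact_toCoker f).apply_apply_eq_zero (basisVec l' _ _ 0)
    rwa [homOfLowest_basisVec _ _ _ l'.zero_le] at this
  let g := homOfLowest (by omega) (hw.map (toCoker f)) (by rw [← map_op_pow, hpf])
  have hf := dim_le_add_dim_coker f
  have hg := dim_le_add_dim_coker g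
  rw [dim_V] at hf hg
  refine ⟨coker g, toCoker g ∘ₗ toCoker f, (toCoker_surjective g).comp (toCoker_surjective f),
    ?_, by omega, fun h P hP => ?_⟩
  · have := (exact_toCoker g).apply_apply_eq_zero (basisVec l _ _ 0)
    rwa [homOfLowest_basisVec _ _ _ l.zero_le] at this
  · rw [hP.homDim_eq_add_coker (f := f) (by rw [dim_V]; omega),
      hP.homDim_eq_add_coker (f := g) (by rw [dim_V]; omega)]
    ring

variable {l : ℕ} (hl : l ≤ n) {r t : ℤ}

section one

variable (h1 : 1 ≤ n)

theorem op_a_pow_tmul_V_one (m k : ℕ) : (op (tensor (V (q := q) 1 h1 t) (V l hl r)) .a ^ m)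
    (tmul _ _ (basisVec 1 h1 t 0) (basisVec l hl r k)) =
      tmul _ _ (basisVec 1 h1 t 0) (basisVec l hl r (k + m)) := by
  induction m with
  | zero => rfl
  | succ m ih =>
    rw [pow_succ', Module.End.mul_apply, ih, op_tensor_a, op_V_a, op_V_a,
      basisVec_eq_zero h1 le_rfl, map_zero, LinearMap.zero_apply, zero_add, add_assoc]

theorem isLowest_tmul_V_one : IsLowest (tensor (V (q := q) 1 h1 t) (V l hl r)) l (t + r)
    (tmul _ _ (basisVec 1 h1 t 0) (basisVec l hl r 0)) := by
  have h₁ := isLowest_basisVec (q := q) h1 (r := t)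
  have h₂ := isLowest_basisVec (q := q) hl (r := r)
  refine ⟨?_, ?_, ?_⟩
  · rw [op_tensor_b, h₁.b, h₂.b, map_smul, LinearMap.map_smul₂, smul_smul,
      ← zpow_add₀ (q_ne_zero n q), add_comm]
  · rw [op_tensor_c, h₁.c, h₂.c, map_smul, LinearMap.map_smul₂, smul_smul,
      ← zpow_add₀ (q_ne_zero n q)]
    congr 2
    push_cast
    ring
  · rw [op_tensor_d, h₁.d, h₂.d, map_zero, map_zero, LinearMap.zero_apply, zero_add]

theorem equiv_V_one_tensor : Nonempty ((V (q := q) l hl (t + r)).carrier ≃ₗ[Hn n 1 q]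
    (tensor (V (q := q) 1 h1 t) (V (q := q) l hl r)).carrier) := by
  have hlow := isLowest_tmul_V_one (q := q) hl (r := r) (t := t) h1
  have ha := op_a_pow_tmul_V_one (q := q) hl (r := r) (t := t) h1 l 0
  rw [zero_add, basisVec_eq_zero hl le_rfl, map_zero] at ha
  refine ⟨LinearEquiv.ofBijective (homOfLowest hl hlow ha)
    (bijective_of_injective (injective_homOfLowest hl hlow ha fun h0 h => ?_) ?_)⟩
  · have := congrArg (coord h1 hl ⟨0, one_pos⟩ ⟨0, h0⟩) h
    simp [coord_tmul_basisVec] at this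
  · rw [dim_tensor, dim_V, dim_V, dim_V, one_mul]

end one

section two

variable (h2 : 2 ≤ n) (k m : ℕ)

variable (t r) in
/-- The tensor product `V(2, t) ⊗ V(l, r)`. -/
abbrev twoTensor : FDMod K (Hn n 1 q) := tensor (V (q := q) 2 h2 t) (V (q := q) l hl r)

variable (t r) in
/-- The basis vectors `v_i ⊗ v_k` of `V(2, t) ⊗ V(l, r)`. -/
def tensorVec (i k : ℕ) : (twoTensor (q := q) hl r t h2).carrier :=
  tmul _ _ (basisVec 2 h2 t i) (basisVec l hl r k)

theorem tensorVec_eq_zero (i : ℕ) (hk : l ≤ k) : tensorVec (q := q) hl r t h2 i k = 0 := by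
  rw [tensorVec, basisVec_eq_zero hl hk, map_zero]

theorem op_a_tensorVec_zero : op (twoTensor (q := q) hl r t h2) .a (tensorVec hl r t h2 0 k) =
    q ^ (r + k) • tensorVec hl r t h2 1 k + tensorVec hl r t h2 0 (k + 1) := by
  rw [tensorVec, op_tensor_a, op_V_a, op_V_a, op_V_b, map_smul]
  rfl

theorem op_a_tensorVec_one : op (twoTensor (q := q) hl r t h2) .a (tensorVec hl r t h2 1 k) =
    tensorVec hl r t h2 1 (k + 1) := by
  rw [tensorVec, op_tensor_a, op_V_a, op_V_a, basisVec_eq_zero h2 le_rfl, map_zero,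
    LinearMap.zero_apply, zero_add]
  rfl

theorem op_a_pow_tensorVec_one : (op (twoTensor (q := q) hl r t h2) .a ^ m)
    (tensorVec hl r t h2 1 k) = tensorVec hl r t h2 1 (k + m) := by
  induction m with
  | zero => rfl
  | succ m ih => rw [pow_succ', Module.End.mul_apply, ih, op_a_tensorVec_one, add_assoc]

theorem op_a_pow_tensorVec_zero : (op (twoTensor (q := q) hl r t h2) .a ^ m)
    (tensorVec hl r t h2 0 k) = tensorVec hl r t h2 0 (k + m) +
      (q ^ (r + k) * qInt q m) • tensorVec hl r t h2 1 (k + m - 1) := by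
  induction m with
  | zero => simp [qInt]
  | succ m ih =>
    have hshift : (q ^ (r + k) * qInt q m) • tensorVec (q := q) hl r t h2 1 (k + m - 1 + 1) =
        (q ^ (r + k) * qInt q m) • tensorVec (q := q) hl r t h2 1 (k + m) := by
      cases m with
      | zero => simp [qInt]
      | succ m => rw [Nat.sub_add_cancel (by omega)]
    have hpow : q ^ (r + (k + m : ℕ)) = q ^ (r + k) * q ^ m := by
      rw [Nat.cast_add, ← add_assoc, zpow_add₀ (q_ne_zero n q), zpow_natCast]
    rw [pow_succ', Module.End.mul_apply, ih, map_add, map_smul, op_a_tensorVec_zero,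
      op_a_tensorVec_one, hshift, hpow, qInt_succ, mul_add, add_smul, ← add_assoc k m 1,
      Nat.add_sub_cancel]
    abel

theorem op_b_tensorVec (i : ℕ) : op (twoTensor (q := q) hl r t h2) .b (tensorVec hl r t h2 i k) =
    q ^ (t + r + i + k) • tensorVec hl r t h2 i k := by
  rw [tensorVec, op_tensor_b, op_V_b, op_V_b, map_smul, LinearMap.map_smul₂, smul_smul,
    ← zpow_add₀ (q_ne_zero n q)]
  congr 2
  ring

theorem op_c_tensorVec (i : ℕ) : op (twoTensor (q := q) hl r t h2) .c (tensorVec hl r t h2 i k) =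
    q ^ (i + k - t - r - l : ℤ) • tensorVec hl r t h2 i k := by
  rw [tensorVec, op_tensor_c, op_V_c, op_V_c, map_smul, LinearMap.map_smul₂, smul_smul,
    ← zpow_add₀ (q_ne_zero n q)]
  congr 2
  push_cast
  ring

theorem op_d_tensorVec_zero (hk : k ≤ l) :
    op (twoTensor (q := q) hl r t h2) .d (tensorVec hl r t h2 0 k) =
      dCoeff q l k • tensorVec hl r t h2 0 (k - 1) := by
  rw [tensorVec, op_tensor_d, (isLowest_basisVec h2).d, op_V_d hl hk, map_zero,
    LinearMap.zero_apply, zero_add, map_smul]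
  rfl

theorem op_d_tensorVec_one_zero :
    op (twoTensor (q := q) hl r t h2) .d (tensorVec hl r t h2 1 0) =
      ((1 - q⁻¹) * q ^ (1 - r - l : ℤ)) • tensorVec hl r t h2 0 0 := by
  rw [tensorVec, op_tensor_d, (isLowest_basisVec hl).d, (isLowest_basisVec hl).c,
    op_V_d h2 one_le_two, map_zero, add_zero, map_smul, LinearMap.map_smul₂, smul_smul, mul_comm,
    dCoeff_one, show (1 - (2 : ℕ) : ℤ) = -1 by norm_num, zpow_neg_one]
  rfl

theorem isLowest_tensorVec_zero : IsLowest (twoTensor (q := q) hl r t h2) (l + 1) (t + r)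
    (tensorVec hl r t h2 0 0) where
  b := by simpa using op_b_tensorVec (q := q) hl (r := r) (t := t) h2 0 0
  c := by
    rw [op_c_tensorVec]
    congr 2
    push_cast
    ring
  d := by rw [op_d_tensorVec_zero hl h2 0 l.zero_le, dCoeff_zero, zero_smul]

theorem coord_tensorVec (i k i' k' : ℕ) (hi : i < 2) (hk : k < l) :
    coord (q := q) h2 hl (r := t) (r' := r) ⟨i, hi⟩ ⟨k, hk⟩ (tensorVec hl r t h2 i' k') =
      if i = i' ∧ k = k' then 1 else 0 :=
  coord_tmul_basisVec h2 hl _ _ _ _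

theorem dim_twoTensor : (twoTensor (q := q) hl r t h2).dim = 2 * l := by
  rw [dim_tensor, dim_V, dim_V]

section lowVec

variable (t r) in
/-- The lowest vector of the summand `V(l - 1, t + r + 1)` of `V(2, t) ⊗ V(l, r)`; its two
coefficients are chosen so that `d` kills it. -/
def lowVec : (twoTensor (q := q) hl r t h2).carrier :=
  (1 - q ^ (1 - l : ℤ)) • tensorVec hl r t h2 1 0 -
    ((1 - q⁻¹) * q ^ (1 - r - l : ℤ)) • tensorVec hl r t h2 0 1

theorem isLowest_lowVec (h0 : 0 < l) :
    IsLowest (twoTensor (q := q) hl r t h2) (l - 1) (t + r + 1) (lowVec hl r t h2) where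
  b := by
    simp only [lowVec, map_sub, map_smul, op_b_tensorVec, smul_sub, Nat.cast_one, Nat.cast_zero,
      add_zero, smul_comm (q ^ (t + r + 1))]
  c := by
    have h : (1 - t - r - l : ℤ) = 1 - (t + r + 1) - (l - 1 : ℕ) := by
      push_cast [h0]
      ring
    simp only [lowVec, map_sub, map_smul, op_c_tensorVec, smul_sub, Nat.cast_one, Nat.cast_zero,
      add_zero, zero_add, h, smul_comm (q ^ (1 - (t + r + 1) - (l - 1 : ℕ) : ℤ))]
  d := by
    rw [lowVec, map_sub, map_smul, map_smul, op_d_tensorVec_zero hl h2 1 h0,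
      op_d_tensorVec_one_zero, dCoeff_one, Nat.sub_self, smul_smul, smul_smul, mul_comm, sub_self]

theorem op_a_pow_lowVec (h0 : 0 < l) :
    (op (twoTensor (q := q) hl r t h2) .a ^ (l - 1)) (lowVec hl r t h2) = 0 := by
  have hq0 := q_ne_zero n q
  obtain ⟨l, rfl⟩ := Nat.exists_eq_succ_of_ne_zero h0.ne'
  have hgeom : qInt q l * (q - 1) = q ^ l - 1 := geom_sum_mul q l
  have hpow : q ^ (1 - r - (l + 1 : ℕ) : ℤ) * q ^ (r + 1) * q ^ l = q := by
    rw [← zpow_natCast q l, ← zpow_add₀ hq0, ← zpow_add₀ hq0]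
    convert zpow_one q using 2
    push_cast
    ring
  have hpow' : q ^ (1 - (l + 1 : ℕ) : ℤ) * q ^ l = 1 := by
    rw [← zpow_natCast q l, ← zpow_add₀ hq0]
    simp
  have hcoeff : (1 - q ^ (1 - (l + 1 : ℕ) : ℤ)) =
      (1 - q⁻¹) * q ^ (1 - r - (l + 1 : ℕ) : ℤ) * (q ^ (r + 1) * qInt q l) := by
    refine mul_right_cancel₀ (pow_ne_zero l hq0) ?_
    have hinv : (1 - q⁻¹) * q = q - 1 := by field_simp
    linear_combination (-(1 - q⁻¹) * qInt q l) * hpow - qInt q l * hinv - hgeom - hpow'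
  rw [lowVec, Nat.succ_sub_one, map_sub, map_smul, map_smul, op_a_pow_tensorVec_zero,
    op_a_pow_tensorVec_one, tensorVec_eq_zero hl h2 (1 + l) 0 (by omega), zero_add, zero_add,
    Nat.add_sub_cancel_left, smul_smul, Nat.cast_one, hcoeff, sub_self]

theorem lowVec_ne_zero (h1 : 1 < l) : lowVec (q := q) hl r t h2 ≠ 0 := fun h => by
  have hq1 : q ≠ 1 := hq.out.ne_one (by omega)
  have hcoord := congrArg (coord h2 hl ⟨0, two_pos⟩ ⟨1, h1⟩) h
  rw [lowVec, map_sub, map_smul, map_smul, coord_tensorVec, coord_tensorVec, map_zero] at hcoord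
  simp [zpow_ne_zero _ (q_ne_zero n q), sub_eq_zero, hq1] at hcoord

end lowVec

theorem equiv_twoTensor (h0 : 0 < l) (hln : l < n) :
    Nonempty ((twoTensor (q := q) hl r t h2).carrier ≃ₗ[Hn n 1 q]
      (sum (V (q := q) (l + 1) hln (t + r))
        (V (q := q) (l - 1) (by omega) (t + r + 1))).carrier) := by
  have := isSimpleModule_V (q := q) (l := l + 1) hln (r := t + r) l.succ_pos
  have ha : (op (twoTensor (q := q) hl r t h2) .a ^ (l + 1)) (tensorVec hl r t h2 0 0) = 0 := by
    rw [op_a_pow_tensorVec_zero, tensorVec_eq_zero hl h2 _ _ (by omega),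
      tensorVec_eq_zero hl h2 _ _ (by omega), smul_zero, add_zero]
  refine exists_equiv_sum_of_dim
    (injective_homOfLowest hln (isLowest_tensorVec_zero hl h2) ha fun _ h => ?_)
    (injective_homOfLowest (by omega) (isLowest_lowVec hl h2 h0) (op_a_pow_lowVec hl h2 h0)
      fun h1 => lowVec_ne_zero hl h2 (by omega))
    (by rw [dim_V, dim_V]; omega) (by rw [dim_V, dim_V, dim_twoTensor]; omega)
  have hcoord := congrArg (coord h2 hl ⟨0, two_pos⟩ ⟨0, h0⟩) h
  rw [coord_tensorVec, map_zero] at hcoord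
  simp at hcoord

theorem eq_zero_of_tensorVec {M : FDMod K (Hn n 1 q)}
    (p : (twoTensor (q := q) hl r t h2).carrier →ₗ[Hn n 1 q] M.carrier)
    (h₀ : p (tensorVec hl r t h2 0 0) = 0) (h₁ : p (tensorVec hl r t h2 1 0) = 0) : p = 0 := by
  have hp₁ (k : ℕ) : p (tensorVec hl r t h2 1 k) = 0 := by
    have := op_a_pow_tensorVec_one (q := q) hl (r := r) (t := t) h2 0 k
    rw [zero_add] at this
    rw [← this, map_op_pow, h₁, map_zero]
  have hp₀ (k : ℕ) : p (tensorVec hl r t h2 0 k) = 0 := by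
    induction k with
    | zero => exact h₀
    | succ k ih =>
      have := congrArg p (op_a_tensorVec_zero (q := q) hl (r := r) (t := t) h2 k)
      rwa [map_op, ih, map_zero, map_add, p.map_smul_of_tower, hp₁, smul_zero, zero_add,
        eq_comm] at this
  have hp : p.restrictScalars K = 0 := ext_tmul_basisVec h2 hl fun i hi j _ => by
    interval_cases i
    exacts [hp₀ j, hp₁ j]
  exact LinearMap.ext fun x => LinearMap.congr_fun hp x

theorem homDim_twoTensor {P : FDMod K (Hn n 1 q)} (hP : IsFDProjective P) (r : ℤ) :
    homDim P (twoTensor (q := q) (le_refl n) r (-1) h2) =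
      2 * homDim P (V (q := q) (n - 1) (Nat.sub_le n 1) r) +
        2 * homDim P (V (q := q) 1 (one_le_two.trans h2) (r - 1)) := by
  have h1 : 1 ≤ n := by omega
  let T := twoTensor (q := q) (le_refl n) r (-1) h2
  have hw₀ : IsLowest T 1 (r - 1) (tensorVec le_rfl r (-1) h2 0 0) :=
    (isLowest_tensorVec_zero le_rfl h2).of_dvd (by simp) (by simp [add_comm, sub_eq_add_neg])
  obtain ⟨T₁, p₁, hp₁, hz₁, hd₁, hhom₁⟩ := hw₀.exists_quotient (Nat.add_sub_cancel' h1)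
  have hw₁ : IsLowest T₁ (n - 1) r (p₁ (tensorVec le_rfl r (-1) h2 1 0)) := by
    refine ⟨?_, ?_, ?_⟩
    · rw [← map_op, op_b_tensorVec, p₁.map_smul_of_tower]
      simp
    · rw [← map_op, op_c_tensorVec, p₁.map_smul_of_tower]
      congr 2
      push_cast [h1]
      ring
    · rw [← map_op, op_d_tensorVec_one_zero, p₁.map_smul_of_tower, hz₁, smul_zero]
  obtain ⟨T₂, p₂, hp₂, hz₂, hd₂, hhom₂⟩ := hw₁.exists_quotient (Nat.sub_add_cancel h1)
  have hp : p₂ ∘ₗ p₁ = 0 :=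
    eq_zero_of_tensorVec _ h2 _ (by rw [LinearMap.comp_apply, hz₁, map_zero]) hz₂
  have hT₂ : T₂.dim = 0 := dim_eq_zero_iff.2 <| subsingleton_of_forall_eq 0 fun x => by
    obtain ⟨x, rfl⟩ := (hp₂.comp hp₁) x
    exact LinearMap.congr_fun hp x
  have hT : T.dim = 2 * n := dim_twoTensor _ _
  rw [hhom₁ (by omega) P hP, hhom₂ (by omega) P hP, homDim_eq_zero_of_dim_right hT₂, Nat.cast_one,
    sub_add_cancel, V_eq_of_dvd (r := r + (n - 1 : ℕ)) (s := r - 1) _ ⟨1, by push_cast [h1]; ring⟩]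
  ring

end two

end Taft

/-! ### Projective covers -/

namespace Taft

open Green FDMod

variable {K : Type u} [Field K] {n : ℕ} {q : K} [NeZero n] [hq : Fact (IsPrimitiveRoot q n)]
  {P : FDMod K (Hn n 1 q)} {l : ℕ} {r : ℤ}

theorem homDim_two_tensor (h2 : 2 ≤ n) (P : FDMod K (Hn n 1 q)) (h0 : 0 < l) (hl : l < n) :
    homDim (tensor (V (q := q) 2 h2 0) P) (V (q := q) l hl.le r) =
      homDim P (V (q := q) (l + 1) hl (r - 1)) + homDim P (V (q := q) (l - 1) (by omega) r) := by
  obtain ⟨e⟩ := equiv_twoTensor (q := q) hl.le (r := r) (t := -1) h2 h0 hl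
  rw [(dualityTwo h2).homDim_tensor, homDim_congr_right P e, homDim_sum_right,
    neg_add_cancel_comm, neg_add_eq_sub]

theorem homDim_two_tensor_top (h2 : 2 ≤ n) (hP : IsFDProjective P) :
    homDim (tensor (V (q := q) 2 h2 0) P) (V (q := q) n le_rfl r) =
      2 * homDim P (V (q := q) (n - 1) (Nat.sub_le n 1) r) +
        2 * homDim P (V (q := q) 1 (one_le_two.trans h2) (r - 1)) := by
  rw [(dualityTwo h2).homDim_tensor]
  exact homDim_twoTensor h2 hP r

/-- Descending induction from `V(n, r)`, which is projective: tensoring with `V(2, 0)` turns a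
projective module that maps onto `V(l + 1, r - 1)` into one that maps onto `V(l, r)`. -/
theorem exists_homDim_ne_zero (h2 : 2 ≤ n) (h0 : 0 < l) (hl : l ≤ n) (r : ℤ) :
    ∃ P : FDMod K (Hn n 1 q), IsFDProjective P ∧ homDim P (V (q := q) l hl r) ≠ 0 := by
  induction hj : n - l generalizing l r with
  | zero =>
    obtain rfl : l = n := by omega
    exact ⟨_, isFDProjective_V r, by simp [homDim_V _ _ h0 h0]⟩
  | succ j ih =>
    obtain ⟨P, hP, hPl⟩ := ih (l := l + 1) l.succ_pos (by omega) (r - 1) (by omega)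
    refine ⟨_, (dualityTwo h2).isFDProjective_tensor hP, ?_⟩
    rw [homDim_two_tensor h2 P h0 (by omega)]
    omega

theorem exists_isCover_V (h2 : 2 ≤ n) (h0 : 0 < l) (hl : l ≤ n) (r : ℤ) :
    ∃ (Q : FDMod K (Hn n 1 q)) (π : Q.carrier →ₗ[Hn n 1 q] (V (q := q) l hl r).carrier),
      IsCover π := by
  obtain ⟨P, hP, h⟩ := exists_homDim_ne_zero (q := q) h2 h0 hl r
  obtain ⟨f, hf⟩ := not_forall.1 (mt homDim_eq_zero_iff.2 h)
  have := isSimpleModule_V (q := q) hl (r := r) h0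
  exact exists_isCover hP hf

/-- `V(2, 0) ⊗ V(1, r) = V(2, r)` has no pair of equal simple quotients. -/
theorem not_isFDProjective_V_one (h2 : 2 ≤ n) (r : ℤ) :
    ¬ IsFDProjective (V (q := q) 1 (one_le_two.trans h2) r) := by
  intro hP
  obtain ⟨e⟩ := equiv_twoTensor (q := q) (one_le_two.trans h2) (r := r) (t := 0) h2 one_pos h2
  have htop := homDim_two_tensor_top (r := r + 1) h2 hP
  rw [homDim_congr_left e, homDim_sum_left, homDim_V _ _ (by omega) (NeZero.pos n),
    homDim_eq_zero_of_dim_left (dim_V (l := 1 - 1) (Nat.zero_le n)),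
    homDim_V _ _ one_pos one_pos,
    if_pos (show 1 = 1 ∧ (n : ℤ) ∣ r - (r + 1 - 1) from ⟨rfl, by simp⟩)] at htop
  split_ifs at htop <;> omega

/-- If `V(l + 1, r)` is projective, then so is the summand `V(l, r + 1)` of
`V(2, 0) ⊗ V(l + 1, r)`. -/
theorem not_isFDProjective_V_succ (h2 : 2 ≤ n) (hl : l + 1 < n) (r : ℤ) :
    ¬ IsFDProjective (V (q := q) (l + 1) hl.le r) := by
  induction l generalizing r with
  | zero => exact not_isFDProjective_V_one h2 r
  | succ l ih =>
    intro hP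
    obtain ⟨e⟩ := equiv_twoTensor (q := q) hl.le (r := r) (t := 0) h2 (l + 1).succ_pos hl
    exact ih (by omega) _ (((dualityTwo h2).isFDProjective_tensor hP).of_equiv e).right_of_sum

variable (K n q) in
/-- The representatives `V(i + 1, j)` of the simple modules. -/
def simple (i : Fin n × Fin n) : FDMod K (Hn n 1 q) := V (i.1 + 1) i.1.2 (i.2 : ℕ)

omit [NeZero n] in
theorem isSimpleModule_simple (i : Fin n × Fin n) :
    IsSimpleModule (Hn n 1 q) (simple K n q i).carrier :=
  isSimpleModule_V _ (Nat.succ_pos _)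

theorem homDim_simple (i j : Fin n × Fin n) :
    homDim (simple K n q i) (simple K n q j) = if i = j then 1 else 0 := by
  rw [simple, simple, homDim_V _ _ (Nat.succ_pos _) (Nat.succ_pos _)]
  congr 1
  rw [eq_iff_iff, Prod.ext_iff, Fin.ext_iff, Fin.ext_iff, Nat.succ_inj]
  refine and_congr_right fun _ => ⟨fun h => ?_, fun h => by simp [h]⟩
  have := Int.eq_zero_of_abs_lt_dvd h (by rw [abs_lt]; omega)
  omega

theorem exists_natCast_dvd_sub (n : ℕ) [NeZero n] (r : ℤ) :
    ∃ k : ℕ, k < n ∧ (n : ℤ) ∣ r - k := by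
  have hn : (n : ℤ) ≠ 0 := by exact_mod_cast NeZero.ne n
  have hr := Int.emod_nonneg r hn
  refine ⟨(r % n).toNat, (Int.toNat_lt hr).2 (Int.emod_lt_of_pos r (by omega)), ?_⟩
  rw [Int.toNat_of_nonneg hr]
  exact Int.dvd_self_sub_emod

theorem exists_equiv_simple (M : FDMod K (Hn n 1 q)) (hM : IsSimpleModule (Hn n 1 q) M.carrier) :
    ∃ i, Nonempty (M.carrier ≃ₗ[Hn n 1 q] (simple K n q i).carrier) := by
  obtain ⟨l, hl, r, h0, he⟩ := exists_equiv_V hM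
  obtain ⟨l, rfl⟩ := Nat.exists_eq_succ_of_ne_zero h0.ne'
  obtain ⟨k, hk, hdvd⟩ := exists_natCast_dvd_sub n r
  rw [V_eq_of_dvd hl hdvd] at he
  exact ⟨(⟨l, hl⟩, ⟨k, hk⟩), he⟩

section cover

variable (h2 : 2 ≤ n)

variable (K q) in
/-- A projective cover of the simple module `simple K n q i`. -/
def cover (i : Fin n × Fin n) : FDMod K (Hn n 1 q) :=
  (exists_isCover_V h2 i.1.val.succ_pos i.1.2 (i.2 : ℕ)).choose

variable (K q) in
/-- The covering map of `cover K q h2 i`. -/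
def coverMap (i : Fin n × Fin n) :
    (cover K q h2 i).carrier →ₗ[Hn n 1 q] (simple K n q i).carrier :=
  (exists_isCover_V h2 i.1.val.succ_pos i.1.2 (i.2 : ℕ)).choose_spec.choose

theorem isCover_coverMap (i : Fin n × Fin n) : IsCover (coverMap K q h2 i) :=
  (exists_isCover_V h2 i.1.val.succ_pos i.1.2 (i.2 : ℕ)).choose_spec.choose_spec

theorem cls_eq_sum_cover (hP : IsFDProjective P) :
    cls P = ∑ i, homDim P (simple K n q i) • cls (cover K q h2 i) :=
  have := isSimpleModule_simple (K := K) (n := n) (q := q)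
  cls_eq_sum_of_projective homDim_simple (isCover_coverMap h2) exists_equiv_simple hP

include h2 in
theorem cls_eq_of_homDim {P' : FDMod K (Hn n 1 q)} (hP : IsFDProjective P)
    (hP' : IsFDProjective P') (h : ∀ (l : ℕ) (hl : l ≤ n) (r : ℤ), 0 < l →
      homDim P (V (q := q) l hl r) = homDim P' (V (q := q) l hl r)) : cls P = cls P' := by
  rw [cls_eq_sum_cover h2 hP, cls_eq_sum_cover h2 hP']
  exact Finset.sum_congr rfl fun i _ => by rw [simple, h _ _ _ (Nat.succ_pos _)]

theorem linearIndependent_simple_cover_V : LinearIndependent ℤ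
    (Sum.elim (fun i : {i : Fin n × Fin n // (i.1 : ℕ) + 1 < n} => cls (simple K n q i))
      fun i => cls (cover K q h2 i)) :=
  have := isSimpleModule_simple (K := K) (n := n) (q := q)
  linearIndependent_simple_cover homDim_simple (isCover_coverMap h2) _
    fun _ hi => not_isFDProjective_V_succ h2 hi _

end cover

end Taft

/-! ### Lucas sequences -/

namespace Taft

section lucas

variable {R : Type*} [CommRing R] (x y : R)

/-- The Lucas sequence of the first kind with parameters `y` and `x`, beginning `0, 1, y`; its
`(k + 1)`-st term is the Dickson polynomial of the second kind `Polynomial.dickson 2 x k` at `y`. -/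
def lucasU : ℕ → R
  | 0 => 0
  | 1 => 1
  | k + 2 => y * lucasU (k + 1) - x * lucasU k

/-- The companion Lucas sequence of the second kind, beginning `2, y`; its `k`-th term is the
Dickson polynomial of the first kind `Polynomial.dickson 1 x k` at `y`. -/
def lucasV : ℕ → R
  | 0 => 2
  | 1 => y
  | k + 2 => y * lucasV (k + 1) - x * lucasV k

theorem lucasU_add_two (k : ℕ) :
    lucasU x y (k + 2) = y * lucasU x y (k + 1) - x * lucasU x y k := by rw [lucasU]

theorem lucasV_add_two (k : ℕ) :
    lucasV x y (k + 2) = y * lucasV x y (k + 1) - x * lucasV x y k := by rw [lucasV]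

theorem lucasV_succ (k : ℕ) :
    lucasV x y (k + 1) = lucasU x y (k + 2) - x * lucasU x y k := by
  induction k using Nat.twoStepInduction with
  | zero => simp [lucasU, lucasV]
  | one => simp only [lucasU, lucasV]; ring
  | more k h₁ h₂ =>
    rw [lucasV_add_two, h₁, h₂, lucasU_add_two x y (k + 2), lucasU_add_two x y (k + 1),
      lucasU_add_two x y k]
    ring

theorem lucasU_add (m k : ℕ) : lucasU x y (m + 1 + k) =
    lucasU x y (m + 1) * lucasU x y (k + 1) - x * lucasU x y m * lucasU x y k := by
  induction k using Nat.twoStepInduction with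
  | zero => simp [lucasU]
  | one => simp only [lucasU]; ring
  | more k h₁ h₂ =>
    rw [← add_assoc, lucasU_add_two, add_assoc (m + 1) k 1, h₁, h₂,
      lucasU_add_two x y (k + 1), lucasU_add_two x y k]
    ring

theorem lucasU_two_mul (k : ℕ) : lucasU x y (2 * k) = lucasV x y k * lucasU x y k := by
  cases k with
  | zero => simp [lucasU]
  | succ k =>
    rw [two_mul, lucasU_add, lucasV_succ]
    ring

theorem map_lucasU {S : Type*} [CommRing S] (f : R →+* S) (k : ℕ) :
    f (lucasU x y k) = lucasU (f x) (f y) k := by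
  induction k using Nat.twoStepInduction with
  | zero => simp [lucasU]
  | one => simp [lucasU]
  | more k h₁ h₂ => simp [lucasU_add_two, h₁, h₂]

theorem map_lucasV {S : Type*} [CommRing S] (f : R →+* S) (k : ℕ) :
    f (lucasV x y k) = lucasV (f x) (f y) k := by
  induction k using Nat.twoStepInduction with
  | zero => simp [lucasV, map_ofNat f 2]
  | one => simp [lucasV]
  | more k h₁ h₂ => simp [lucasV_add_two, h₁, h₂]

theorem choose_succ_mul_pow_sub (m i : ℕ) :
    (m.choose (i + 1) : R) * y ^ (m - i) =
      y * ((m.choose (i + 1) : R) * y ^ (m - (i + 1))) := by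
  rcases lt_or_ge i m with h | h
  · rw [mul_left_comm, ← pow_succ', Nat.sub_add_eq, Nat.sub_add_cancel (Nat.sub_pos_of_lt h)]
  · simp [Nat.choose_eq_zero_of_lt (Nat.lt_succ_of_le h)]

theorem lucasU_succ_eq_sum_antidiagonal (n : ℕ) :
    lucasU x y (n + 1) = ∑ p ∈ Finset.HasAntidiagonal.antidiagonal n,
      (-x) ^ p.2 * ((p.1.choose p.2 : R) * y ^ (p.1 - p.2)) := by
  have pascal : ∀ m i : ℕ, (-x) ^ (i + 1) * (((m + 1).choose (i + 1) : R) * y ^ (m - i)) =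
      y * ((-x) ^ (i + 1) * ((m.choose (i + 1) : R) * y ^ (m - (i + 1)))) -
        x * ((-x) ^ i * ((m.choose i : R) * y ^ (m - i))) := fun m i => by
    rw [Nat.choose_succ_succ, Nat.cast_add, add_mul, choose_succ_mul_pow_sub]
    ring
  induction n using Nat.twoStepInduction with
  | zero => simp [lucasU]
  | one => simp [lucasU, Finset.Nat.antidiagonal_succ]
  | more n h₁ h₂ =>
    rw [lucasU_add_two, h₁, h₂, Finset.Nat.antidiagonal_succ_succ',
      Finset.Nat.antidiagonal_succ']
    simp only [Finset.sum_cons, Finset.sum_map, Function.Embedding.coe_prodMap,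
      Function.Embedding.coeFn_mk, Function.Embedding.refl_apply, Prod.map, Nat.succ_eq_add_one,
      Nat.add_sub_add_right, pascal, Finset.sum_sub_distrib, ← Finset.mul_sum,
      Nat.choose_zero_succ, Nat.choose_zero_right, Nat.cast_zero, Nat.sub_zero]
    ring

theorem lucasU_eq_sum (n : ℕ) : lucasU x y (n + 1) = ∑ i ∈ Finset.range (n / 2 + 1),
    (-1) ^ i * ((n - i).choose i : R) * x ^ i * y ^ (n - 2 * i) := by
  rw [lucasU_succ_eq_sum_antidiagonal, ← Finset.Nat.sum_antidiagonal_swap,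
    Finset.Nat.sum_antidiagonal_eq_sum_range_succ_mk,
    ← Finset.sum_subset (Finset.range_subset_range.2 (show n / 2 + 1 ≤ n + 1 by omega))]
  · refine Finset.sum_congr rfl fun i _ => ?_
    rw [Prod.fst_swap, Prod.snd_swap, neg_pow, Nat.sub_sub, two_mul]
    ring
  · intro i _ hi
    rw [Finset.mem_range, not_lt] at hi
    rw [Prod.fst_swap, Prod.snd_swap, Nat.choose_eq_zero_of_lt (by omega)]
    simp

theorem lucasCoeff_add_two {n i : ℕ} (h : 2 * i ≤ n) :
    lucasCoeff (n + 2) (i + 1) = (n + 1 - i).choose (i + 1) + (n - i).choose i := by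
  have h₁ := sub_mul_lucasCoeff (n := n + 2) (i := i + 1) (by omega) (by omega)
  obtain ⟨m, rfl⟩ : ∃ m, n = m + i := ⟨n - i, by omega⟩
  have h₂ := Nat.add_one_mul_choose_eq m i
  rw [show m + i + 2 - (i + 1) = m + 1 by omega] at h₁
  rw [show m + i + 1 - i = m + 1 by omega, Nat.add_sub_cancel]
  refine Nat.eq_of_mul_eq_mul_left m.succ_pos (h₁.trans ?_)
  rw [Nat.succ_eq_add_one, mul_add, h₂]
  ring

theorem lucasV_eq_sum {n : ℕ} (hn : 0 < n) : lucasV x y n = ∑ i ∈ Finset.range (n / 2 + 1),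
    (-1) ^ i * (lucasCoeff n i : R) * x ^ i * y ^ (n - 2 * i) := by
  obtain ⟨k, rfl⟩ : ∃ k, n = k + 1 := ⟨n - 1, by omega⟩
  cases k with
  | zero => simp [lucasV, lucasCoeff]
  | succ k =>
    rw [lucasV_succ, lucasU_eq_sum, lucasU_eq_sum, show (k + 1 + 1) / 2 = k / 2 + 1 by omega,
      Finset.sum_range_succ', Finset.sum_range_succ' _ (k / 2 + 1), Finset.mul_sum,
      add_sub_right_comm, ← Finset.sum_sub_distrib]
    congr 1
    · refine Finset.sum_congr rfl fun i hi => ?_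
      rw [Finset.mem_range] at hi
      rw [lucasCoeff_add_two (by omega), show k + 1 + 1 - (i + 1) = k + 1 - i by omega,
        show k + 1 + 1 - 2 * (i + 1) = k - 2 * i by omega]
      push_cast
      ring
    · simp [lucasCoeff]

section degree

open Polynomial

theorem isMonicOfDegree_lucasU [Nontrivial R] (k : ℕ) :
    IsMonicOfDegree (lucasU (C x) X (k + 1)) k := by
  induction k using Nat.twoStepInduction with
  | zero => simp [lucasU]
  | one => simpa [lucasU] using isMonicOfDegree_X R
  | more k h₁ h₂ =>
    have hlt : (C x * lucasU (C x) X (k + 1)).natDegree < 1 + (k + 1) := by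
      refine (natDegree_C_mul_le _ _).trans_lt ?_
      rw [h₁.natDegree_eq]
      omega
    have h := ((isMonicOfDegree_X R).mul h₂).sub hlt
    rwa [add_comm 1, ← lucasU_add_two] at h

theorem isMonicOfDegree_lucasV_sub_two_mul_lucasU [Nontrivial R] {n : ℕ} (hn : 0 < n) :
    IsMonicOfDegree ((lucasV (C x) X n - 2) * lucasU (C x) X n) (2 * n - 1) := by
  obtain ⟨k, rfl⟩ : ∃ k, n = k + 1 := ⟨n - 1, by omega⟩
  rw [sub_mul, ← lucasU_two_mul, show 2 * (k + 1) = 2 * k + 1 + 1 by ring, Nat.add_sub_cancel]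
  refine (isMonicOfDegree_lucasU x _).sub ?_
  refine natDegree_mul_le.trans_lt ?_
  rw [(isMonicOfDegree_lucasU x k).natDegree_eq, natDegree_ofNat]
  omega

end degree

end lucas

section span

open Polynomial
open scoped Pointwise

variable {k A : Type*} [CommRing k] [CommRing A] [Algebra k A] {x y : A}

theorem adjoin_pair_eq_span {f : k[X]} (hf : f.Monic) (hfx : aeval x f = 0)
    {g : (Algebra.adjoin k {x})[X]} (hg : g.Monic) (hgy : aeval y g = 0) :
    Subalgebra.toSubmodule (Algebra.adjoin k {x, y}) =
      Submodule.span k (Set.range fun i : Fin f.natDegree × Fin g.natDegree =>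
        x ^ (i.1 : ℕ) * y ^ (i.2 : ℕ)) := by
  have h₁ := Submodule.span_range_natDegree_eq_adjoin hf hfx
  have h₂ := Submodule.span_range_natDegree_eq_adjoin hg hgy
  simp only [Finset.coe_image, Finset.coe_range] at h₁ h₂
  set T : Set A := (y ^ ·) '' Set.Iio g.natDegree
  have hsmul :
      (Set.univ : Set (Algebra.adjoin k {x})) • T = (Algebra.adjoin k {x} : Set A) * T := by
    ext z
    simp [Set.mem_smul, Set.mem_mul, Algebra.smul_def]
  calc Subalgebra.toSubmodule (Algebra.adjoin k {x, y})
      = (Submodule.span (Algebra.adjoin k {x}) T).restrictScalars k := by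
        rw [h₂, Set.insert_eq, Algebra.adjoin_union_eq_adjoin_adjoin]
        rfl
    _ = Submodule.span k ((Algebra.adjoin k {x} : Set A) * T) := by
        rw [← Submodule.span_smul_of_span_eq_top Submodule.span_univ T, hsmul]
    _ = Submodule.span k ((x ^ ·) '' Set.Iio f.natDegree) * Submodule.span k T := by
        rw [← Submodule.span_mul_span, h₁, ← Subalgebra.coe_toSubmodule, Submodule.span_eq]
    _ = _ := by
        rw [Submodule.span_mul_span]
        congr 1
        ext z
        simp [T, Set.mem_mul, Fin.exists_iff]

theorem adjoin_pair_eq_span_of_lucas {n : ℕ} (hn : 0 < n) (hx : x ^ n = 1)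
    (hy : (lucasV x y n - 2) * lucasU x y n = 0) :
    Subalgebra.toSubmodule (Algebra.adjoin k {x, y}) =
      Submodule.span k (Set.range fun i : Fin n × Fin (2 * n - 1) =>
        x ^ (i.1 : ℕ) * y ^ (i.2 : ℕ)) := by
  nontriviality A
  nontriviality k
  let x' : Algebra.adjoin k {x} := ⟨x, Algebra.self_mem_adjoin_singleton k x⟩
  have hf : IsMonicOfDegree (X ^ n - 1 : k[X]) n :=
    (isMonicOfDegree_X_pow k n).sub (by simpa using hn)
  have hg := isMonicOfDegree_lucasV_sub_two_mul_lucasU x' hn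
  have h := adjoin_pair_eq_span hf.monic (x := x) (by simp [hx]) hg.monic (y := y) ?_
  · rwa [hf.natDegree_eq, hg.natDegree_eq] at h
  · rw [← hy, aeval_def]
    change eval₂RingHom _ _ _ = _
    rw [map_mul, map_sub, map_lucasV, map_lucasU, map_ofNat]
    simp [x']

end span

end Taft

/-! ### Products in the Green ring -/

namespace Taft

open Green FDMod MvPolynomial

open scoped IsMulCommutative in
theorem exists_ringHom_of_commute {R : Type*} [Ring R] {x y : R} (h : Commute x y) :
    ∃ f : MvPolynomial (Fin 2) ℤ →+* R,
      f (X 0) = x ∧ f (X 1) = y := by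
  have : IsMulCommutative (Subring.closure {x, y}) := Subring.isMulCommutative_closure (by
    rintro a (rfl | rfl) b (rfl | rfl)
    exacts [rfl, h, h.symm, rfl])
  let x' : Subring.closure {x, y} := ⟨x, Subring.subset_closure (by simp)⟩
  let y' : Subring.closure {x, y} := ⟨y, Subring.subset_closure (by simp)⟩
  refine ⟨(Subring.subtype (Subring.closure {x, y})).comp
    (aeval ![x', y']).toRingHom, ?_, ?_⟩
  · simp [x']
  · simp [y']

variable {K : Type u} [Field K] {n : ℕ} {q : K} [NeZero n] [hq : Fact (IsPrimitiveRoot q n)]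
  {l : ℕ} {r : ℤ}

theorem cls_V_one_mul (h1 : 1 ≤ n) (hl : l ≤ n) (t : ℤ) :
    cls (V (q := q) 1 h1 t) * cls (V (q := q) l hl r) = cls (V (q := q) l hl (t + r)) := by
  obtain ⟨e⟩ := equiv_V_one_tensor (q := q) hl (r := r) (t := t) h1
  rw [← cls_tensor, cls_congr e]

theorem cls_V_two_mul (h2 : 2 ≤ n) (h0 : 0 < l) (hl : l < n) :
    cls (V (q := q) 2 h2 0) * cls (V (q := q) l hl.le r) =
      cls (V (q := q) (l + 1) hl r) + cls (V (q := q) (l - 1) (by omega) (r + 1)) := by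
  obtain ⟨e⟩ := equiv_twoTensor (q := q) hl.le (r := r) (t := 0) h2 h0 hl
  have h := cls_congr e
  rw [cls_sum, zero_add] at h
  exact (cls_tensor _ _).symm.trans h

theorem cls_V_one_zero (h1 : 1 ≤ n) : cls (V (q := q) 1 h1 0) = 1 := by
  obtain ⟨e⟩ := equiv_unit (q := q) h1
  rw [cls_congr e, cls_one]

theorem cls_V_zero (h0 : l = 0) (hl : l ≤ n) : cls (V (q := q) l hl r) = 0 :=
  cls_eq_zero ((dim_V hl).trans h0)

theorem commute_cls_V (h2 : 2 ≤ n) :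
    Commute (cls (V (q := q) 1 (one_le_two.trans h2) 1)) (cls (V (q := q) 2 h2 0)) := by
  rw [Commute, SemiconjBy, cls_V_one_mul, add_zero, cls_V_two_mul h2 one_pos h2,
    cls_V_zero (l := 1 - 1) rfl, add_zero]

variable (K q) in
/-- The homomorphism from `ℤ[x, y]` to the Green ring that sends `x` to `[V(1, 1)]` and `y` to
`[V(2, 0)]`; its image will be the projective class ring. -/
def toGreenRing (h2 : 2 ≤ n) : MvPolynomial (Fin 2) ℤ →+* GreenRing K (Hn n 1 q) :=
  (exists_ringHom_of_commute (commute_cls_V h2)).choose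

variable (h2 : 2 ≤ n)

theorem toGreenRing_X_zero :
    toGreenRing K q h2 (X 0) = cls (V (q := q) 1 (one_le_two.trans h2) 1) :=
  (exists_ringHom_of_commute (commute_cls_V h2)).choose_spec.1

theorem toGreenRing_X_one : toGreenRing K q h2 (X 1) = cls (V (q := q) 2 h2 0) :=
  (exists_ringHom_of_commute (commute_cls_V h2)).choose_spec.2

theorem toGreenRing_X_pow_mul_cls (hl : l ≤ n) (k : ℕ) :
    toGreenRing K q h2 (X 0 ^ k) * cls (V (q := q) l hl r) = cls (V (q := q) l hl (k + r)) := by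
  induction k with
  | zero => simp
  | succ k ih =>
    rw [pow_succ', map_mul, mul_assoc, ih, toGreenRing_X_zero, cls_V_one_mul, Nat.cast_succ,
      add_comm (k : ℤ) 1, add_assoc]

theorem toGreenRing_X_pow_self : toGreenRing K q h2 (X 0 ^ n) = 1 := by
  have h1 : 1 ≤ n := one_le_two.trans h2
  have h := toGreenRing_X_pow_mul_cls (q := q) h2 h1 n (r := 0)
  rwa [V_eq_of_dvd h1 (r := n + 0) (s := 0) (by simp), cls_V_one_zero, mul_one] at h

theorem toGreenRing_lucasU (hl : l ≤ n) :
    toGreenRing K q h2 (lucasU (X 0) (X 1) l) = cls (V l hl 0) := by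
  induction l using Nat.twoStepInduction with
  | zero => rw [cls_V_zero rfl, lucasU, map_zero]
  | one => rw [cls_V_one_zero, lucasU, map_one]
  | more l h₁ h₂ =>
    have h := cls_V_two_mul (q := q) h2 (l := l + 1) (r := 0) l.succ_pos hl
    simp only [add_tsub_cancel_right] at h
    rw [lucasU_add_two, map_sub, map_mul, map_mul, h₁ (by omega), h₂ (by omega),
      toGreenRing_X_zero, toGreenRing_X_one, h, cls_V_one_mul, add_zero, zero_add,
      add_sub_cancel_right]

theorem toGreenRing_X_pow_mul_lucasU (hl : l ≤ n) (k : ℕ) :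
    toGreenRing K q h2 (X 0 ^ k * lucasU (X 0) (X 1) l) = cls (V l hl k) := by
  rw [map_mul, toGreenRing_lucasU h2 hl, toGreenRing_X_pow_mul_cls, add_zero]

/-! ### Classes of projective covers -/

section covers

variable {Q Q₁ Q₂ : FDMod K (Hn n 1 q)} {j k : ℕ} {s : ℤ}

/-- For `0 < j < n`, a projective module whose largest semisimple quotient is `V(n - j, r)`, that
is, a projective cover of `V(n - j, r)`; for `j = 0` and `j = n`, two copies of `V(n, r)`. With this
doubling at the two ends, tensoring with `V(2, 0)` follows the recursion of the Lucas sequence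
`2, y, …` all the way from `j = 0` to `j = n`. -/
structure IsLucasCover (Q : FDMod K (Hn n 1 q)) (j : ℕ) (r : ℤ) : Prop where
  projective : IsFDProjective Q
  homDim_eq (l : ℕ) (hl : l ≤ n) (s : ℤ) : homDim Q (V (q := q) l hl s) =
    if 0 < l ∧ (l + j = n ∨ l + j = 2 * n) ∧ (n : ℤ) ∣ r - s then if l = n then 2 else 1 else 0

theorem isLucasCover_of_isCover (h0 : 0 < l) (hj : 0 < j) (hlj : l + j = n) {hl : l ≤ n}
    {π : Q.carrier →ₗ[Hn n 1 q] (V (q := q) l hl r).carrier} (hπ : IsCover π) :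
    IsLucasCover Q j r := by
  refine ⟨hπ.projective, fun m hm s => ?_⟩
  rcases m.eq_zero_or_pos with rfl | hm0
  · rw [homDim_eq_zero_of_dim_right (dim_V _), if_neg (by simp)]
  · have := isSimpleModule_V (q := q) hm (r := s) hm0
    have := isSimpleModule_V (q := q) hl (r := r) h0
    rw [hπ.homDim_eq, homDim_V _ _ h0 hm0]
    split_ifs <;> omega

theorem homDim_V_top (hl : l ≤ n) : homDim (V (q := q) n le_rfl r) (V (q := q) l hl s) =
    if l = n ∧ (n : ℤ) ∣ r - s then 1 else 0 := by
  rcases l.eq_zero_or_pos with rfl | h0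
  · rw [homDim_eq_zero_of_dim_right (dim_V _), if_neg fun h => NeZero.ne n h.1.symm]
  · rw [homDim_V _ _ (NeZero.pos n) h0]
    exact if_congr (and_congr_left' eq_comm) rfl rfl

theorem isLucasCover_sum_V (hj : j = 0 ∨ j = n) (r : ℤ) :
    IsLucasCover ((V (q := q) n le_rfl r).sum (V n le_rfl r)) j r := by
  refine ⟨(isFDProjective_V r).sum (isFDProjective_V r), fun l hl s => ?_⟩
  have := NeZero.pos n
  rw [homDim_sum_left, homDim_V_top]
  split_ifs <;> omega

include h2 in
theorem exists_isLucasCover (hj : j ≤ n) (r : ℤ) :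
    ∃ Q : FDMod K (Hn n 1 q), IsLucasCover Q j r := by
  by_cases h : j = 0 ∨ j = n
  · exact ⟨_, isLucasCover_sum_V h r⟩
  · obtain ⟨Q, π, hπ⟩ := exists_isCover_V (q := q) h2 (l := n - j) (by omega) (Nat.sub_le n j) r
    exact ⟨Q, isLucasCover_of_isCover (by omega) (by omega) (by omega) hπ⟩

theorem IsLucasCover.cls_two_mul (hj : 0 < j) (hjn : j < n) (h : IsLucasCover Q j r)
    (h₁ : IsLucasCover Q₁ (j + 1) (r + 1)) (h₂ : IsLucasCover Q₂ (j - 1) r) :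
    cls (V (q := q) 2 h2 0) * cls Q = cls Q₁ + cls Q₂ := by
  rw [← cls_tensor, ← cls_sum]
  refine cls_eq_of_homDim h2 ((dualityTwo h2).isFDProjective_tensor h.projective)
    (h₁.projective.sum h₂.projective) fun l hl s h0 => ?_
  have e : r - (s - 1) = r + 1 - s := by ring
  rw [homDim_sum_left, h₁.homDim_eq, h₂.homDim_eq]
  rcases hl.lt_or_eq with hlt | rfl
  · rw [homDim_two_tensor h2 Q h0 hlt, h.homDim_eq, h.homDim_eq, e]
    by_cases hA : (n : ℤ) ∣ r + 1 - s <;> by_cases hB : (n : ℤ) ∣ r - s <;>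
      simp only [hA, hB, and_true, and_false, if_false] <;> split_ifs <;> omega
  · rw [homDim_two_tensor_top h2 h.projective, h.homDim_eq, h.homDim_eq, e]
    by_cases hA : (l : ℤ) ∣ r + 1 - s <;> by_cases hB : (l : ℤ) ∣ r - s <;>
      simp only [hA, hB, and_true, and_false, if_false] <;> split_ifs <;> omega

theorem IsLucasCover.cls_two_mul_V (h : IsLucasCover Q 1 (r + 1)) :
    cls (V (q := q) 2 h2 0) * cls (V n le_rfl r) = cls Q := by
  rw [← cls_tensor]
  refine cls_eq_of_homDim h2 ((dualityTwo h2).isFDProjective_tensor (isFDProjective_V r))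
    h.projective fun l hl s h0 => ?_
  have e : r - (s - 1) = r + 1 - s := by ring
  rw [h.homDim_eq]
  rcases hl.lt_or_eq with hlt | rfl
  · rw [homDim_two_tensor h2 _ h0 hlt, homDim_V_top, homDim_V_top, e]
    split_ifs <;> omega
  · rw [homDim_two_tensor_top h2 (isFDProjective_V r), homDim_V_top, homDim_V_top, e]
    split_ifs <;> omega

include h2 in
theorem IsLucasCover.cls_eq (h : IsLucasCover Q j r) (h₁ : IsLucasCover Q₁ j s)
    (hrs : (n : ℤ) ∣ r - s) : cls Q = cls Q₁ := by
  refine cls_eq_of_homDim h2 h.projective h₁.projective fun l hl t _ => ?_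
  have ht : (n : ℤ) ∣ r - t ↔ (n : ℤ) ∣ s - t := by
    rw [← sub_add_sub_cancel r s t]
    exact dvd_add_right hrs
  simp only [h.homDim_eq, h₁.homDim_eq, ht]

theorem IsLucasCover.cls_eq_toGreenRing (hj : j ≤ n) (h : IsLucasCover Q j r)
    (hr : (n : ℤ) ∣ r - (j + k)) : cls Q =
      toGreenRing K q h2 (X 0 ^ k * (lucasV (X 0) (X 1) j * lucasU (X 0) (X 1) n)) := by
  induction j using Nat.twoStepInduction generalizing Q r k with
  | zero =>
    rw [h.cls_eq h2 (isLucasCover_sum_V (.inl rfl) k) (by simpa using hr), cls_sum,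
      ← toGreenRing_X_pow_mul_lucasU h2 le_rfl, lucasV, two_mul, mul_add, map_add]
  | one =>
    obtain ⟨Q', h'⟩ := exists_isLucasCover (q := q) h2 hj (k + 1)
    rw [h.cls_eq h2 h' (by simpa [add_comm] using hr), ← h'.cls_two_mul_V h2, lucasV,
      mul_left_comm, map_mul, toGreenRing_X_one, toGreenRing_X_pow_mul_lucasU]
  | more j ih₁ ih₂ =>
    obtain ⟨Q₁, h₁⟩ := exists_isLucasCover (q := q) h2 (j := j + 1) (by omega) (j + 1 + k)
    obtain ⟨Q₂, h₂⟩ := exists_isLucasCover (q := q) h2 (j := j) (by omega) (j + 1 + k)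
    obtain ⟨Q₃, h₃⟩ := exists_isLucasCover (q := q) h2 (j := j + 2) hj (j + 1 + k + 1)
    have e₂ : (j + 1 + k : ℤ) - (j + (k + 1 : ℕ)) = 0 := by push_cast; ring
    have e₃ : (j + 1 + k + 1 : ℤ) = (j + 2 : ℕ) + k := by push_cast; ring
    have e := h₁.cls_two_mul h2 j.succ_pos hj h₃ h₂
    rw [ih₂ (k := k) (by omega) h₁ (by simp), ih₁ (k := k + 1) (by omega) h₂ (e₂ ▸ dvd_zero _),
      ← toGreenRing_X_one, ← map_mul] at e
    rw [h.cls_eq h2 h₃ (by rwa [e₃]), eq_sub_of_add_eq e.symm, ← map_sub, lucasV_add_two]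
    congr 1
    ring

theorem toGreenRing_lucasV_mul_lucasU :
    toGreenRing K q h2 (lucasV (X 0) (X 1) n * lucasU (X 0) (X 1) n) =
      toGreenRing K q h2 (2 * lucasU (X 0) (X 1) n) := by
  have h₀ := (isLucasCover_sum_V (q := q) (.inl rfl) 0).cls_eq_toGreenRing h2
    (Nat.zero_le n) (k := 0) (by simp)
  have h₁ := (isLucasCover_sum_V (q := q) (.inr rfl) 0).cls_eq_toGreenRing h2
    le_rfl (k := 0) (by simp)
  simpa only [pow_zero, one_mul, lucasV] using h₁.symm.trans h₀

end covers

theorem cls_simple_mem_range (i : Fin n × Fin n) :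
    cls (simple K n q i) ∈ (toGreenRing K q h2).range :=
  ⟨_, toGreenRing_X_pow_mul_lucasU h2 _ _⟩

theorem cls_cover_mem_range (i : Fin n × Fin n) :
    cls (cover K q h2 i) ∈ (toGreenRing K q h2).range := by
  have hi := isCover_coverMap (K := K) (q := q) h2 i
  rcases Nat.lt_or_eq_of_le i.1.2 with hlt | heq
  · obtain ⟨j, hj⟩ := Nat.exists_eq_add_of_lt hlt
    have hQ : IsLucasCover (cover K q h2 i) (j + 1) (i.2 : ℕ) :=
      isLucasCover_of_isCover (Nat.succ_pos _) j.succ_pos hj.symm hi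
    obtain ⟨k, -, hk⟩ := exists_natCast_dvd_sub n ((i.2 : ℕ) - (j + 1 : ℕ) : ℤ)
    exact ⟨_, (hQ.cls_eq_toGreenRing h2 (by omega) (by rwa [← sub_sub])).symm⟩
  · have := isSimpleModule_simple (K := K) (q := q) i
    refine ⟨_, (toGreenRing_X_pow_mul_lucasU h2 le_rfl i.2).trans ?_⟩
    refine cls_eq_of_homDim h2 (isFDProjective_V _) hi.projective fun l hl s h0 => ?_
    have := isSimpleModule_V (q := q) hl (r := s) h0
    rw [hi.homDim_eq, simple, homDim_V _ _ (NeZero.pos n) h0, homDim_V _ _ (Nat.succ_pos _) h0]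
    rw [heq]

end Taft

/-! ### The presentation of the projective class ring -/

namespace Taft

open Green FDMod MvPolynomial

theorem relIdeal_eq {n : ℕ} (hn : 0 < n) : relIdeal n =
    Ideal.span {X 0 ^ n - 1, (lucasV (X 0) (X 1) n - 2) * lucasU (X 0) (X 1) n} := by
  obtain ⟨k, rfl⟩ : ∃ k, n = k + 1 := ⟨n - 1, by omega⟩
  rw [lucasV_eq_sum _ _ hn, lucasU_eq_sum]
  rfl

/-- The monomial `x ^ i * y ^ j` in `ℤ[x, y] ⧸ relIdeal n`. -/
def monomialMk (n : ℕ) (i : Fin n × Fin (2 * n - 1)) : MvPolynomial (Fin 2) ℤ ⧸ relIdeal n :=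
  Ideal.Quotient.mk _ (X 0) ^ (i.1 : ℕ) * Ideal.Quotient.mk _ (X 1) ^ (i.2 : ℕ)

theorem adjoin_mk_X_eq_top (I : Ideal (MvPolynomial (Fin 2) ℤ)) :
    Algebra.adjoin ℤ {Ideal.Quotient.mk I (X 0), Ideal.Quotient.mk I (X 1)} = ⊤ := by
  have h : (Set.range X : Set (MvPolynomial (Fin 2) ℤ)) = {X 0, X 1} := by
    ext p
    simp [Fin.exists_fin_two, eq_comm]
  have := congrArg (Subalgebra.map (Ideal.Quotient.mkₐ ℤ I)) (adjoin_range_X (R := ℤ) (σ := Fin 2))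
  rwa [h, AlgHom.map_adjoin, Set.image_pair, Algebra.map_top,
    (AlgHom.range_eq_top _).2 (Ideal.Quotient.mkₐ_surjective ℤ I)] at this

theorem span_monomialMk {n : ℕ} (hn : 0 < n) :
    Submodule.span ℤ (Set.range (monomialMk n)) = ⊤ := by
  have mk_eq_zero : ∀ p ∈ ({X 0 ^ n - 1, (lucasV (X 0) (X 1) n - 2) * lucasU (X 0) (X 1) n} :
      Set (MvPolynomial (Fin 2) ℤ)), Ideal.Quotient.mk (relIdeal n) p = 0 := fun p hp =>
    Ideal.Quotient.eq_zero_iff_mem.2 (relIdeal_eq hn ▸ Ideal.subset_span hp)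
  have hx := mk_eq_zero _ (.inl rfl)
  have hy := mk_eq_zero _ (.inr rfl)
  rw [map_sub, map_pow, map_one, sub_eq_zero] at hx
  rw [map_mul, map_sub, map_lucasV, map_lucasU, map_ofNat] at hy
  exact (adjoin_pair_eq_span_of_lucas hn hx hy).symm.trans
    (by rw [adjoin_mk_X_eq_top, Algebra.top_toSubmodule])

theorem linearIndependent_of_card_le {M ι κ : Type*} [AddCommGroup M] [Fintype ι] [Fintype κ]
    {b : ι → M} {w : κ → M} (hw : LinearIndependent ℤ w)
    (h : ∀ k, w k ∈ Submodule.span ℤ (Set.range b)) (hc : Fintype.card ι ≤ Fintype.card κ) :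
    LinearIndependent ℤ b := by
  rw [linearIndependent_iff_card_le_finrank_span]
  have : Module.Finite ℤ (Submodule.span ℤ (Set.range b)) :=
    Module.Finite.span_of_finite ℤ (Set.finite_range b)
  have hw' : LinearIndependent ℤ fun k => (⟨w k, h k⟩ : Submodule.span ℤ (Set.range b)) :=
    LinearIndependent.of_comp (Submodule.span ℤ (Set.range b)).subtype hw
  exact hc.trans hw'.fintype_card_le_finrank

theorem card_fin_prod_fin_le (n : ℕ) : Fintype.card (Fin n × Fin (2 * n - 1)) ≤
    Fintype.card ({i : Fin n × Fin n // (i.1 : ℕ) + 1 < n} ⊕ Fin n × Fin n) := by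
  cases n with
  | zero => simp
  | succ k =>
    have h := Fintype.card_le_of_injective
      (fun i : Fin k × Fin (k + 1) =>
        (⟨(i.1.castSucc, i.2), Nat.succ_lt_succ i.1.2⟩ :
          {i : Fin (k + 1) × Fin (k + 1) // (i.1 : ℕ) + 1 < k + 1}))
      fun i j h => by simpa [Prod.ext_iff] using h
    simp only [Fintype.card_sum, Fintype.card_prod, Fintype.card_fin] at h ⊢
    rw [show 2 * (k + 1) - 1 = k + (k + 1) by omega]
    linarith

variable {K : Type u} [Field K] {n : ℕ} {q : K} [NeZero n] [hq : Fact (IsPrimitiveRoot q n)]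
  (h2 : 2 ≤ n)

variable (K q) in
theorem relIdeal_le_ker : relIdeal n ≤ RingHom.ker (toGreenRing K q h2) := by
  rw [relIdeal_eq (NeZero.pos n), Ideal.span_le]
  rintro _ (rfl | rfl)
  · rw [SetLike.mem_coe, RingHom.mem_ker, map_sub, toGreenRing_X_pow_self, map_one, sub_self]
  · rw [SetLike.mem_coe, RingHom.mem_ker, sub_mul, map_sub, toGreenRing_lucasV_mul_lucasU,
      sub_self]

variable (K q) in
theorem range_toGreenRing :
    (toGreenRing K q h2).range = projectiveClassRing K (Hn n 1 q) := by
  refine le_antisymm ?_ (Subring.closure_le.2 ?_)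
  · rintro _ ⟨p, rfl⟩
    induction p using MvPolynomial.induction_on with
    | C a => rw [eq_intCast C a, map_intCast]; exact intCast_mem _ a
    | add p p' hp hp' => rw [map_add]; exact add_mem hp hp'
    | mul_X p i hp =>
      rw [map_mul]
      refine mul_mem hp (Subring.subset_closure ?_)
      fin_cases i
      · exact ⟨_, .inr (isSimpleModule_V _ one_pos), toGreenRing_X_zero h2⟩
      · exact ⟨_, .inr (isSimpleModule_V _ two_pos), toGreenRing_X_one h2⟩
  · rintro _ ⟨M, hM | hM, rfl⟩
    · rw [SetLike.mem_coe, cls_eq_sum_cover h2 isFDProjective_of_projective]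
      exact sum_mem fun i _ => nsmul_mem (cls_cover_mem_range h2 i) _
    · obtain ⟨i, ⟨e⟩⟩ := exists_equiv_simple M hM
      rw [cls_congr e]
      exact cls_simple_mem_range h2 i

variable (K q) in
/-- The homomorphism from the presented ring to the Green ring induced by `toGreenRing`. -/
def presentation : (MvPolynomial (Fin 2) ℤ ⧸ relIdeal n) →+* GreenRing K (Hn n 1 q) :=
  Ideal.Quotient.lift _ (toGreenRing K q h2) (relIdeal_le_ker K q h2)

theorem presentation_mk (p : MvPolynomial (Fin 2) ℤ) :
    presentation K q h2 (Ideal.Quotient.mk _ p) = toGreenRing K q h2 p :=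
  rfl

variable (K q) in
theorem range_presentation :
    (presentation K q h2).range = projectiveClassRing K (Hn n 1 q) := by
  rw [← range_toGreenRing K q h2]
  ext z
  exact Ideal.Quotient.mk_surjective.exists

theorem presentation_monomialMk (i : Fin n × Fin (2 * n - 1)) :
    presentation K q h2 (monomialMk n i) =
      cls (V 1 (one_le_two.trans h2) 1) ^ (i.1 : ℕ) * cls (V 2 h2 0) ^ (i.2 : ℕ) := by
  rw [monomialMk, map_mul, map_pow, map_pow, presentation_mk, presentation_mk,
    toGreenRing_X_zero, toGreenRing_X_one]

variable (K q) in
theorem linearIndependent_presentation_monomialMk :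
    LinearIndependent ℤ (presentation K q h2 ∘ monomialMk n) := by
  have hspan : ∀ z ∈ (toGreenRing K q h2).range,
      z ∈ Submodule.span ℤ (Set.range (presentation K q h2 ∘ monomialMk n)) := by
    rintro _ ⟨p, rfl⟩
    have hp : Ideal.Quotient.mk (relIdeal n) p ∈ Submodule.span ℤ (Set.range (monomialMk n)) :=
      span_monomialMk (NeZero.pos n) ▸ Submodule.mem_top
    rw [Set.range_comp]
    exact Submodule.apply_mem_span_image_of_mem_span
      (presentation K q h2).toIntAlgHom.toLinearMap hp
  refine linearIndependent_of_card_le (linearIndependent_simple_cover_V h2) ?_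
    (card_fin_prod_fin_le n)
  rintro (i | i)
  · exact hspan _ (cls_simple_mem_range h2 i)
  · exact hspan _ (cls_cover_mem_range h2 i)

variable (K q) in
/-- The monomials `x ^ i * y ^ j` with `i < n` and `j < 2 * n - 1` as a basis of the presented
ring. -/
def monomialBasis :
    Module.Basis (Fin n × Fin (2 * n - 1)) ℤ (MvPolynomial (Fin 2) ℤ ⧸ relIdeal n) :=
  .mk ((linearIndependent_presentation_monomialMk K q h2).of_comp
    (presentation K q h2).toIntAlgHom.toLinearMap) (span_monomialMk (NeZero.pos n)).ge

theorem monomialBasis_apply (i : Fin n × Fin (2 * n - 1)) :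
    monomialBasis K q h2 i = monomialMk n i :=
  Module.Basis.mk_apply _ _ i

variable (K q) in
theorem injective_presentation : Function.Injective (presentation K q h2) := by
  have h : (monomialBasis K q h2).constr ℤ (presentation K q h2 ∘ monomialMk n) =
      (presentation K q h2).toIntAlgHom.toLinearMap :=
    (monomialBasis K q h2).ext fun i => by
      rw [Module.Basis.constr_basis, monomialBasis_apply]
      rfl
  have hinj := (monomialBasis K q h2).injective_constr_of_linearIndependent (R₂ := ℤ)
    (linearIndependent_presentation_monomialMk K q h2)
  rwa [h] at hinj

end Taft

end

theorem theorem5p9_general {K : Type*} [Field K] (n : ℕ) [NeZero n] (hn : 2 ≤ n)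
    (q : K) [Fact (IsPrimitiveRoot q n)] :
    ∃ φ : (MvPolynomial (Fin 2) ℤ ⧸ Taft.relIdeal n) ≃+*
        Green.projectiveClassRing K (Taft.Hn n 1 q),
      (φ (Ideal.Quotient.mk _ (MvPolynomial.X 0)) : Green.GreenRing K (Taft.Hn n 1 q)) =
          Green.cls (Taft.V 1 (by omega) 1) ∧
      (φ (Ideal.Quotient.mk _ (MvPolynomial.X 1)) : Green.GreenRing K (Taft.Hn n 1 q)) =
          Green.cls (Taft.V 2 (by omega) 0) ∧
      ∃ B : Module.Basis (Fin n × Fin (2 * n - 1)) ℤ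
          (Green.projectiveClassRing K (Taft.Hn n 1 q)),
        ∀ (i : Fin n) (j : Fin (2 * n - 1)),
          (B (i, j) : Green.GreenRing K (Taft.Hn n 1 q)) =
            Green.cls (Taft.V 1 (by omega) 1) ^ (i : ℕ) *
              Green.cls (Taft.V 2 (by omega) 0) ^ (j : ℕ) := by
  have hinj := Taft.injective_presentation K q hn
  let φ := (RingEquiv.ofBijective (Taft.presentation K q hn).rangeRestrict
    ⟨fun _ _ h => hinj (congrArg Subtype.val h), RingHom.rangeRestrict_surjective _⟩).trans
      (RingEquiv.subringCongr (Taft.range_presentation K q hn))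
  refine ⟨φ, Taft.toGreenRing_X_zero hn, Taft.toGreenRing_X_one hn,
    (Taft.monomialBasis K q hn).map φ.toAddEquiv.toIntLinearEquiv, fun i j => ?_⟩
  rw [← Taft.presentation_monomialMk (q := q) hn (i, j), ← Taft.monomialBasis_apply (q := q) hn,
    Module.Basis.map_apply]
  rfl

theorem theorem5p9 {K : Type*} [Field K] [IsAlgClosed K] (n : ℕ) [NeZero n] (hn : 2 < n)
    (q : K) [Fact (IsPrimitiveRoot q n)] :
    ∃ φ : (MvPolynomial (Fin 2) ℤ ⧸ Taft.relIdeal n) ≃+*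
        Green.projectiveClassRing K (Taft.Hn n 1 q),
      (φ (Ideal.Quotient.mk _ (MvPolynomial.X 0)) : Green.GreenRing K (Taft.Hn n 1 q)) =
          Green.cls (Taft.V 1 (by omega) 1) ∧
      (φ (Ideal.Quotient.mk _ (MvPolynomial.X 1)) : Green.GreenRing K (Taft.Hn n 1 q)) =
          Green.cls (Taft.V 2 (by omega) 0) ∧
      ∃ B : Module.Basis (Fin n × Fin (2 * n - 1)) ℤ
          (Green.projectiveClassRing K (Taft.Hn n 1 q)),
        ∀ (i : Fin n) (j : Fin (2 * n - 1)),
          (B (i, j) : Green.GreenRing K (Taft.Hn n 1 q)) =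
            Green.cls (Taft.V 1 (by omega) 1) ^ (i : ℕ) *
              Green.cls (Taft.V 2 (by omega) 0) ^ (j : ℕ) :=
  theorem5p9_general n hn.le q
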